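/- Let $g\ge 2$ be even, $n\ge 1$, $M\ge 1$, $m=2^{\lfloor (g-1)/2\rfloor}$, $N=ngm$, $\lambda=n^2+g-1$, and $f(n,p)=n^2-((n-p)^+)^2$ with $a^+=\max\{a,0\}$. A *delay-optimal $g$-group code* for $N$ transmit antennas consists of $g\lambda$ complex $N\times N$ weight matrices $A_{k,i}$ ($1\le k\le g$, $1\le i\le\lambda$), linearly independent over $\mathbb R$, of the following form. For each $j$ there are unitary $m\times m$ matrices $U_{j,1},\dots,U_{j,g}$ with $U_{j,k}^HU_{j,k'}+U_{j,k'}^HU_{j,k}=0$ for $k\ne k'$, and for each $k$ there is a set $\mathcal V_k$ of $n^2$ unitary Hermitian $n\times n$ matrices that are linearly independent over $\mathbb R$, such that $A_{k,i}=\mathrm{diag}(D_1,\dots,D_g)$ with $D_k=V\otimes U_{k,k}$ for some $V\in\mathcal V_k$ and $D_j=\pm I_n\otimes U_{j,k}$ for $j\ne k$. The channel $H\in\mathbb C^{N\times M}$ and the noise $W\in\mathbb C^{N\times M}$ are independent, with i.i.d. circularly symmetric complex Gaussian entries of mean $0$ and variance $1$. For a complex matrix $Y$ let $\widetilde{vec}(Y)$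 be the real vector of the stacked columns of $\mathrm{Re}\,Y$ followed by those of $\mathrm{Im}\,Y$. The channel submatrix of group $k$ is the real $2MN\times\lambda$ matrix $G_k=[\widetilde{vec}(A_{k,1}H)\ \cdots\ \widetilde{vec}(A_{k,\lambda}H)]$. Let $\Theta_1,\dots,\Theta_g$ be invertible real $\lambda\times\lambda$ matrices. The symbols of group $k$ are $x_k=\Theta_ks_k$ with $s_k\in S^\lambda$, where $S\subset\mathbb Z$ is an alphabet with $|S|=q\ge 1$, and $y=\widetilde{vec}\big(\big(\sum_{k,i}x_{k,i}A_{k,i}\big)H+W\big)$ is received. For each group $k$ the sphere decoder takes the QR decomposition of $G_k\Theta_k$ obtained by the Gram–Schmidt process and deletes the zero rows of the triangular factor; it calls $s_a$ the coordinates whose columns are independent of the preceding columns, $s_b$ the others, and $R_a$ the full-rank upper triangular part belonging to $s_a$. A pass with search radius $\rho$ runs, for each value in $S$ of the coordinates $s_b$, the tree search on $s_a$ with matrix $R_a$ that visits the root and, level by level from the last coordinate of $s_a$ on, all partial assignments in $S$ whose partial squared distance is at most $\rho^2$. Passes are made with $\rho=r,2r,4r,\dots$ for a fixed initial radius $r>0$,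 up to the first one that finds a vector $s_k\in S^\lambda$ for which $G_k\Theta_ks_k$ has distance at most $\rho$ from the orthogonal projection of $y$ to the column space of $G_k\Theta_k$. (Partial squared distances are those contributed by the corresponding last rows of the triangular factor.) The *sphere decoding complexity* of the code is the total number of tree nodes visited by the $g$ decoders, averaged over $H$ and $W$. Then delay-optimal $g$-group codes exist for these parameters, and every such code has the following properties. 1. For each group $k$, $\mathrm{rank}(G_k)=f(n,mM)+g-1$ with probability $1$. 2. The sphere decoding complexity is of order $q^{((n-mM)^+)^2}$: for all invertible $\Theta_1,\dots,\Theta_g$ and every $r>0$ there are constants $c,C>0$ such that for every $q\ge1$, every alphabet $S\subset\mathbb Z$ with $|S|=q$, and all transmitted vectors $s_1,\dots,s_g\in S^\lambda$, the sphere decoding complexity lies between $c\,q^{((n-mM)^+)^2}$ and $C\,q^{((n-mM)^+)^2}$. -/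

import Mathlib

open MeasureTheory ProbabilityTheory InnerProductSpace
open scoped Matrix Kronecker ENNReal

noncomputable section

namespace STBC

/-! ### Linear dispersion codes and their equivalent channel matrix -/

/-- The real vector of a complex matrix `Y`: the stacked columns of the real part of `Y`,
followed by the stacked columns of the imaginary part of `Y`. -/
def realVec {τ μ : Type*} (Y : Matrix τ μ ℂ) : (μ × τ) ⊕ (μ × τ) → ℝ :=
  Sum.elim (fun p => (Y.vec p).re) (fun p => (Y.vec p).im)

/-- The equivalent channel matrix of the weight matrices `A i`: its columns are the real vectors
of the matrices `A i * H`. -/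
def equivChannel {ι τ ν μ : Type*} [Fintype ν] (A : ι → Matrix τ ν ℂ) (H : Matrix ν μ ℂ) :
    Matrix ((μ × τ) ⊕ (μ × τ)) ι ℝ :=
  Matrix.of fun r i => realVec (A i * H) r

/-- The law of a circularly symmetric complex Gaussian variable of mean zero and unit variance:
real and imaginary part are independent centred Gaussians of variance `1 / 2`. -/
def complexGaussian : Measure ℂ :=
  ((gaussianReal 0 (1 / 2)).prod (gaussianReal 0 (1 / 2))).map Complex.measurableEquivRealProd.symm

/-- The law of a random matrix (as a function of row and column) with i.i.d. entries that are
circularly symmetric complex Gaussian of mean zero and unit variance. -/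
def gaussianMatrix (ν μ : Type*) [Fintype ν] [Fintype μ] : Measure (ν → μ → ℂ) :=
  Measure.pi fun _ => Measure.pi fun _ => complexGaussian

/-! ### The delay-optimal multigroup codes -/

/-- The size `m` of the blocks `U`. -/
abbrev blockSize (g : ℕ) : ℕ := 2 ^ ((g - 1) / 2)

/-- The index set of the transmit antennas, and of the channel uses. It has
`N = n * g * 2 ^ ((g - 1) / 2)` elements, arranged in `g` blocks of size `n * m`. -/
abbrev Antenna (n g : ℕ) : Type := (Fin n × Fin (blockSize g)) × Fin g

/-- The number of real symbols in each group. -/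
abbrev groupSize (n g : ℕ) : ℕ := n ^ 2 + (g - 1)

/-- The matrix `diag (D₁, …, D_g)` with `D_k = V ⊗ U_k` and `D_j = ± I ⊗ U_j` for `j ≠ k`. -/
def blockWeight {n g : ℕ} (k : Fin g) (V : Matrix (Fin n) (Fin n) ℂ)
    (U : Fin g → Matrix (Fin (blockSize g)) (Fin (blockSize g)) ℂ) (ε : Fin g → ℤˣ) :
    Matrix (Antenna n g) (Antenna n g) ℂ :=
  Matrix.blockDiagonal fun j =>
    if j = k then V ⊗ₖ U j else (ε j : ℤ) • ((1 : Matrix (Fin n) (Fin n) ℂ) ⊗ₖ U j)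

/-- `A k i` (group `k`, symbol `i`) are the weight matrices of a delay-optimal `g`-group code.

* In each diagonal block `j` there are unitary matrices `U j 0, …, U j (g - 1)`, one for each
  group, that are pairwise Hurwitz-Radon orthogonal (this makes the groups separately decodable).
* For each group `k` there are `n ^ 2` unitary Hermitian `n × n` matrices `V k l`, linearly
  independent over the reals.
* A weight matrix of group `k` has the block `V k l ⊗ U k k`, for some `l`, in position `k`
  and a block `± I ⊗ U j k` in each other position `j`.
* All the weight matrices together are linearly independent over the reals. -/
def IsDelayOptimalCode {n g : ℕ}
    (A : Fin g → Fin (groupSize n g) → Matrix (Antenna n g) (Antenna n g) ℂ) : Prop :=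
  ∃ (U : Fin g → Fin g → Matrix (Fin (blockSize g)) (Fin (blockSize g)) ℂ)
    (V : Fin g → Fin (n ^ 2) → Matrix (Fin n) (Fin n) ℂ)
    (idx : Fin g → Fin (groupSize n g) → Fin (n ^ 2))
    (ε : Fin g → Fin (groupSize n g) → Fin g → ℤˣ),
    (∀ j k, (U j k)ᴴ * U j k = 1) ∧
    (∀ j k k', k ≠ k' → (U j k)ᴴ * U j k' + (U j k')ᴴ * U j k = 0) ∧
    (∀ k l, (V k l).IsHermitian ∧ (V k l)ᴴ * V k l = 1) ∧
    (∀ k, LinearIndependent ℝ (V k)) ∧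
    (∀ k i, A k i = blockWeight k (V k (idx k i)) (fun j => U j k) (ε k i)) ∧
    LinearIndependent ℝ (fun p : Fin g × Fin (groupSize n g) => A p.1 p.2)

/-- `f(n, m) = n ^ 2 - ((n - m)⁺) ^ 2`; the truncated subtraction of natural numbers is the
positive part. -/
def f (n m : ℕ) : ℕ := n ^ 2 - (n - m) ^ 2

/-! ### The sphere decoder for a possibly rank-deficient matrix

The decoder minimizes `‖y - ∑ j, s j • c j‖` over integer vectors `s` with coordinates in a finite
set `S`, where `c j` are the columns of a real matrix, by means of its QR decomposition. -/

section Decoder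

variable {E : Type*} [NormedAddCommGroup E] [InnerProductSpace ℝ E] {d : ℕ}

/-- The entries of the upper triangular factor of the QR decomposition by Gram-Schmidt. If column
`l` depends on the earlier columns, the `l`-th Gram-Schmidt vector, and with it row `l`, is zero. -/
def factorR (c : Fin d → E) (l j : Fin d) : ℝ := inner ℝ (gramSchmidtNormed ℝ c l) (c j)

/-- The columns that are independent of the earlier ones. They index the nonzero rows of the
triangular factor and form, together with these rows, its full-rank triangular part `R_a`. The
remaining columns form `R_b`. -/
def pivots (c : Fin d → E) : Finset (Fin d) := {l | factorR c l l ≠ 0}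

/-- The squared distance contributed by the nonzero rows `l ≥ i` of the triangular factor. Since
the factor is upper triangular, it depends only on the coordinates `s j` with `j ≥ i`. -/
def partialMetric (c : Fin d → E) (y : E) (s : Fin d → ℤ) (i : Fin d) : ℝ :=
  ∑ l ∈ (pivots c).filter (fun l => i ≤ l),
    (inner ℝ (gramSchmidtNormed ℝ c l) y - ∑ j, factorR c l j * (s j : ℝ)) ^ 2

/-- The squared distance between the projection of `y` to the span of the columns and
`∑ j, s j • c j`. -/
def fullMetric (c : Fin d → E) (y : E) (s : Fin d → ℤ) : ℝ :=
  ∑ l ∈ pivots c,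
    (inner ℝ (gramSchmidtNormed ℝ c l) y - ∑ j, factorR c l j * (s j : ℝ)) ^ 2

open Classical in
/-- The number of nodes of the search tree that the sphere decoder for `R_a` with radius `ρ` visits
after the value `b` of the non-pivot coordinates `s_b` has been fixed: the root, and at the level of
each pivot `i` the assignments of values in `S` to the pivot coordinates `j ≥ i` whose partial
metric is within the radius. Coordinates not yet assigned are set to `0`. -/
def innerNodes (c : Fin d → E) (y : E) (S : Finset ℤ) (ρ : ℝ) (b : Fin d → ℤ) : ℕ :=
  1 + ∑ i ∈ pivots c,
    ((Fintype.piFinset fun j =>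
        if j ∉ pivots c then {b j} else if i ≤ j then S else {0}).filter
      fun s => partialMetric c y s i ≤ ρ ^ 2).card

open Classical in
/-- The number of nodes visited in one pass with search radius `ρ`: the sphere decoder for `R_a` is
run once for each value of the non-pivot coordinates `s_b`. -/
def passNodes (c : Fin d → E) (y : E) (S : Finset ℤ) (ρ : ℝ) : ℕ :=
  ∑ b ∈ Fintype.piFinset (fun j => if j ∈ pivots c then {0} else S), innerNodes c y S ρ b

/-- The number of times the search radius is doubled, from the initial radius `r`, until the pass
finds a symbol vector within the radius. -/
def doublings (c : Fin d → E) (y : E) (S : Finset ℤ) (r : ℝ) : ℕ :=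
  sInf {t : ℕ | ∃ s : Fin d → ℤ, (∀ j, s j ∈ S) ∧ fullMetric c y s ≤ (2 ^ t * r) ^ 2}

/-- The number of nodes visited by the sphere decoder: passes with radius `r`, `2 * r`, `4 * r`, …
are made up to the first pass that finds a symbol vector; the best vector found in it minimizes the
distance. -/
def decoderNodes (c : Fin d → E) (y : E) (S : Finset ℤ) (r : ℝ) : ℕ :=
  ∑ t ∈ Finset.range (doublings c y S r + 1), passNodes c y S (2 ^ t * r)

end Decoder

/-! ### Sphere decoding complexity of a multigroup code -/

section Complexity

variable {τ ν μ : Type*} [Fintype τ] [Fintype ν] [Fintype μ] {g d : ℕ}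

/-- The transmitted codeword: group `k` carries the real symbols `x_k = Θ_k s_k`, where `s_k` is
an integer vector. -/
def codeword (A : Fin g → Fin d → Matrix τ ν ℂ) (Θ : Fin g → Matrix (Fin d) (Fin d) ℝ)
    (s : Fin g → Fin d → ℤ) : Matrix τ ν ℂ :=
  ∑ k, ∑ i, ((Θ k *ᵥ fun j => (s k j : ℝ)) i) • A k i

/-- The columns of `G_k Θ_k`, where `G_k` is the part of the equivalent channel matrix that belongs
to group `k`, as vectors of Euclidean space. -/
def groupColumns (A : Fin g → Fin d → Matrix τ ν ℂ) (Θ : Fin g → Matrix (Fin d) (Fin d) ℝ)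
    (H : Matrix ν μ ℂ) (k : Fin g) (j : Fin d) : EuclideanSpace ℝ ((μ × τ) ⊕ (μ × τ)) :=
  WithLp.toLp 2 ((equivChannel (A k) H * Θ k).col j)

/-- The number of nodes visited by the `g` sphere decoders, one for each group of symbols, when the
symbols `s` are transmitted over the channel `H` with noise `W`. -/
def codeNodes (A : Fin g → Fin d → Matrix τ ν ℂ) (Θ : Fin g → Matrix (Fin d) (Fin d) ℝ)
    (S : Finset ℤ) (r : ℝ) (s : Fin g → Fin d → ℤ) (H : Matrix ν μ ℂ) (W : Matrix τ μ ℂ) : ℕ :=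
  ∑ k, decoderNodes (groupColumns A Θ H k)
    (WithLp.toLp 2 (realVec (codeword A Θ s * H + W))) S r

/-- The sphere decoding complexity with the symbol alphabet `S`, initial radius `r` and transmitted
symbols `s`: the number of visited nodes, averaged over the channel and the noise. -/
def avgComplexity (μ : Type*) [Fintype μ] (A : Fin g → Fin d → Matrix τ ν ℂ)
    (Θ : Fin g → Matrix (Fin d) (Fin d) ℝ) (S : Finset ℤ) (r : ℝ) (s : Fin g → Fin d → ℤ) : ℝ≥0∞ :=
  ∫⁻ H, ∫⁻ W, (codeNodes A Θ S r s (Matrix.of H) (Matrix.of W) : ℝ≥0∞)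
    ∂(gaussianMatrix τ μ) ∂(gaussianMatrix ν μ)

end Complexity

end STBC

end

/-! Lower bound. The decoder of a group runs one tree search for each of the `q ^ (λ - rank)` values
of `s_b`, and every tree has a root. Almost surely the rank is `f(n, mM) + g - 1`, so `λ - rank =
((n - mM)⁺)²` and the constant `1` works (`le_passNodes`).

Upper bound for one channel. Over all values of `s_b`, the nodes at a level with `k` assigned pivots
are integer points that the last `k` pivot rows of the triangular factor send into a box. Given a
nonzero `k × k` minor of these rows, fixing the coordinates off the minor leaves a square system,
whose integer solutions are counted by volume; exactly `λ - rank` of the free coordinates lie off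
the minor. The minor need not sit in the pivot columns. A determinant of rank size that tests
combinations of the columns against vectors `w` factors through the triangular factor, so at every
level it is at most a polynomial in the channel norm times some minor (`card_levelNodes_mul_le`).
Hence the number of nodes times any such determinant is at most `q ^ (λ - rank)` times polynomials
in the norms of channel and noise (`decoderNodes_mul_abs_det_le`). The noise enters only through the
last radius: the other groups are orthogonal to the columns, so the transmitted vector is within the
norm of the noise.

Choice of the determinant. The weight matrices of group `k` are a basis of the space of all block
matrices with `X ⊗ U_k`, `X` Hermitian, in block `k` and real multiples of `I ⊗ U_j` elsewhere. The
unitary factors drop out, and block `k` of the channel becomes `mM` Gaussian vectors of `ℂ ^ n` on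
which `X` acts. In their Gram-Schmidt basis, the Hermitian units at `(a, b)` with `min a b < mM`
give a triangular matrix, whose diagonal entries are at least half the distance of vector number `c
= min a b` to the span of its predecessors. This distance occurs `2(n-1-c)+1` times, and it is the
length of a Gaussian vector of real dimension at least `2(n-c)`, one more. So the reciprocal of the
determinant has finite expectation, even against polynomials (`lintegral_channelWeight_lt_top`); in
particular the determinant is almost surely nonzero, which also gives the rank.

Existence. Pauli-type matrices give the `U`, reflections span the Hermitian matrices, and single
sign flips make the weights independent. -/

noncomputable section

namespace STBC

/-! ### Integer points and minors -/

/-- Integer points which a real matrix maps into a box: their number times the determinant is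
bounded by the volume of a slightly larger box. -/
lemma card_mul_abs_det_le {κ : Type*} [Fintype κ] [DecidableEq κ] (A : Matrix κ κ ℝ) {K ρ : ℝ}
    (hK : ∀ l j, |A l j| ≤ K) (hρ : 0 ≤ ρ) (hK0 : 0 ≤ K) (z : κ → ℝ) (U : Finset (κ → ℤ))
    (hU : ∀ u ∈ U, ∀ l, |∑ j, A l j * (u j : ℝ) - z l| ≤ ρ) :
    (U.card : ℝ) * |A.det| ≤ (2 * (ρ + Fintype.card κ * K)) ^ Fintype.card κ := by
  classical
  set B : ℝ := ρ + Fintype.card κ * K with hB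
  have hB0 : 0 ≤ B := by positivity
  -- Disjoint unit cubes with corners at the points of `U` turn the count into a volume, which `A`
  -- scales by `|det A|`.
  let cube : (κ → ℤ) → Set (κ → ℝ) := fun u =>
    Set.univ.pi fun j => Set.Ico (u j : ℝ) ((u j : ℝ) + 1)
  have hcube : ∀ u, volume (cube u) = 1 := by
    intro u
    simp [cube, volume_pi_pi]
  have hdisj : Set.PairwiseDisjoint (U : Set (κ → ℤ)) cube := by
    intro u _ v _ huv
    refine Set.disjoint_left.2 fun x hx hy => huv ?_
    funext j
    have h1 := hx j (Set.mem_univ _)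
    have h2 := hy j (Set.mem_univ _)
    rw [← Int.floor_eq_iff.2 h1, ← Int.floor_eq_iff.2 h2]
  have hmeas : ∀ u ∈ U, MeasurableSet (cube u) := fun u _ =>
    MeasurableSet.univ_pi fun j => measurableSet_Ico
  have hvol : volume (⋃ u ∈ U, cube u) = U.card := by
    rw [measure_biUnion_finset hdisj hmeas]
    simp [hcube]
  -- Moving a point within its cube changes each coordinate of the image by at most `card κ * K`,
  -- hence the half side `B`.
  have himg : Matrix.toLin' A '' (⋃ u ∈ U, cube u) ⊆
      Set.Icc (fun l => z l - B) (fun l => z l + B) := by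
    rintro _ ⟨x, hx, rfl⟩
    simp only [Set.mem_iUnion] at hx
    obtain ⟨u, hu, hx⟩ := hx
    have key : ∀ l, |Matrix.toLin' A x l - z l| ≤ B := by
      intro l
      have h1 : Matrix.toLin' A x l = ∑ j, A l j * (u j : ℝ) + ∑ j, A l j * (x j - u j) := by
        simp only [Matrix.toLin'_apply, Matrix.mulVec, dotProduct, ← Finset.sum_add_distrib]
        exact Finset.sum_congr rfl fun j _ => by ring
      have h2 : |∑ j, A l j * (x j - u j)| ≤ Fintype.card κ * K := by
        calc _ ≤ ∑ j, |A l j * (x j - u j)| := Finset.abs_sum_le_sum_abs _ _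
          _ ≤ ∑ _j : κ, K := by
            refine Finset.sum_le_sum fun j _ => ?_
            have := hx j (Set.mem_univ _)
            rw [abs_mul]
            have h3 : |x j - u j| ≤ 1 := by
              rw [abs_le]; constructor <;> linarith [this.1, this.2]
            calc _ ≤ K * 1 := mul_le_mul (hK l j) h3 (abs_nonneg _) hK0
              _ = K := mul_one K
          _ = _ := by simp
      have h3 := hU u hu l
      rw [h1, hB]
      rw [abs_le] at *
      constructor <;> linarith [h2.1, h2.2, h3.1, h3.2]
    constructor <;> intro l <;> have := abs_le.1 (key l)
    · change z l - B ≤ _; linarith [this.1]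
    · change _ ≤ z l + B; linarith [this.2]
  have hle := measure_mono (μ := volume) himg
  rw [Measure.addHaar_image_linearMap, hvol, LinearMap.det_toLin', Real.volume_Icc_pi] at hle
  have h4 : ∀ l : κ, z l + B - (z l - B) = 2 * B := fun l => by ring
  simp only [h4, Finset.prod_const, Finset.card_univ] at hle
  rw [← ENNReal.ofReal_pow (by positivity), ← ENNReal.ofReal_natCast,
    ← ENNReal.ofReal_mul (abs_nonneg _), ENNReal.ofReal_le_ofReal_iff (by positivity)] at hle
  linarith [mul_comm (U.card : ℝ) |A.det|]

/-- Integer points which a wide real matrix maps into a box, by means of a square minor. -/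
lemma card_mul_abs_minor_le {κ : Type*} [Fintype κ] [DecidableEq κ] {d : ℕ}
    (A : Matrix κ (Fin d) ℝ) (e : κ → Fin d) {K ρ : ℝ} (hK : ∀ l j, |A l j| ≤ K) (hρ : 0 ≤ ρ)
    (hK0 : 0 ≤ K) (z : κ → ℝ) (Z : Finset (Fin d → ℤ)) (Q : ℕ)
    (hZ : ∀ s ∈ Z, ∀ l, |∑ j, A l j * (s j : ℝ) - z l| ≤ ρ)
    (T : Fin d → Finset ℤ) (hT : ∀ s ∈ Z, ∀ j, s j ∈ T j)
    (hQ : (A.submatrix id e).det ≠ 0 → ∏ j with j ∉ Set.range e, (T j).card ≤ Q) :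
    (Z.card : ℝ) * |(A.submatrix id e).det| ≤
      Q * (2 * (ρ + Fintype.card κ * K)) ^ Fintype.card κ := by
  classical
  by_cases hdet : (A.submatrix id e).det = 0
  · rw [hdet, abs_zero, mul_zero]; positivity
  have hinj : Function.Injective e := by
    intro a b hab
    by_contra hne
    exact hdet (Matrix.det_zero_of_column_eq hne fun i => by simp [hab])
  -- `off` keeps the coordinates outside the minor. It takes at most `Q` values, and on each of its
  -- fibres the remaining coordinates solve a square system.
  let off : (Fin d → ℤ) → (Fin d → ℤ) := fun s j => if j ∈ Set.range e then 0 else s j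
  have himage : (Z.image off).card ≤ Q := by
    refine le_trans ?_ (hQ hdet)
    calc (Z.image off).card
        ≤ (Fintype.piFinset fun j => if j ∈ Set.range e then {0} else T j).card := by
          refine Finset.card_le_card fun b hb => ?_
          obtain ⟨s, hs, rfl⟩ := Finset.mem_image.1 hb
          refine Fintype.mem_piFinset.2 fun j => ?_
          by_cases h : j ∈ Set.range e
          · simp only [off, if_pos h, Finset.mem_singleton]
          · simp only [off, if_neg h]; exact hT s hs j
      _ = ∏ j, (if j ∈ Set.range e then 1 else (T j).card) := by
          rw [Fintype.card_piFinset]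
          refine Finset.prod_congr rfl fun j _ => ?_
          split_ifs <;> simp
      _ = _ := by
          rw [Finset.prod_filter]
          refine Finset.prod_congr rfl fun j _ => ?_
          by_cases h : j ∈ Set.range e <;> simp only [h, if_true, if_false, not_true, not_false_iff]
  have hfib : ∀ b ∈ Z.image off, ((Z.filter fun s => off s = b).card : ℝ) *
      |(A.submatrix id e).det| ≤ (2 * (ρ + Fintype.card κ * K)) ^ Fintype.card κ := by
    intro b _
    have hcard : (Z.filter fun s => off s = b).card =
        ((Z.filter fun s => off s = b).image fun s => s ∘ e).card := by
      refine (Finset.card_image_of_injOn ?_).symm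
      intro s hs t ht hst
      simp only [Finset.coe_filter, Set.mem_ofPred_eq] at hs ht
      funext j
      by_cases h : j ∈ Set.range e
      · obtain ⟨i, rfl⟩ := h
        exact congrFun hst i
      · have := congrFun (hs.2.trans ht.2.symm) j
        simpa only [off, if_neg h] using this
    rw [hcard]
    refine card_mul_abs_det_le _ (fun l j => hK l (e j)) hρ hK0
      (fun l => z l - ∑ j, A l j * (b j : ℝ)) _ ?_
    intro u hu l
    obtain ⟨s, hs, rfl⟩ := Finset.mem_image.1 hu
    obtain ⟨hs, hsb⟩ := Finset.mem_filter.1 hs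
    -- On a fibre `s - b` is supported on the columns of the minor, so fixing `b` only shifts the
    -- centre of the box.
    have h1 : ∑ i, A l (e i) * (s (e i) : ℝ) = ∑ j, A l j * ((s j : ℝ) - b j) := by
      refine Fintype.sum_of_injective e hinj _ _ (fun j hj => ?_) fun i => ?_
      · have : b j = s j := by rw [← hsb]; simp only [off, if_neg hj]
        rw [this, sub_self, mul_zero]
      · have : b (e i) = 0 := by
          rw [← hsb]; simp only [off, Set.mem_range_self, if_true]
        rw [this]; simp
    have h2 := hZ s hs l
    simp only [Function.comp]
    erw [h1]
    simp only [mul_sub, Finset.sum_sub_distrib]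
    convert h2 using 2
    ring
  have hsum : (Z.card : ℝ) = ∑ b ∈ Z.image off, ((Z.filter fun s => off s = b).card : ℝ) := by
    rw [Finset.card_eq_sum_card_image off Z]; push_cast; rfl
  rw [hsum, Finset.sum_mul]
  calc _ ≤ ∑ _b ∈ Z.image off, (2 * (ρ + Fintype.card κ * K)) ^ Fintype.card κ :=
        Finset.sum_le_sum hfib
    _ = (Z.image off).card * (2 * (ρ + Fintype.card κ * K)) ^ Fintype.card κ := by simp
    _ ≤ _ := by gcongr

/-- Expansion of a determinant along its first `u` rows: some minor of the last `k` rows is not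
too small. -/
lemma exists_abs_det_le_minor {K : ℝ} (hK0 : 0 ≤ K) (k u : ℕ)
    (A : Matrix (Fin (k + u)) (Fin (k + u)) ℝ) (hK : ∀ l j, |A l j| ≤ K) :
    ∃ e : Fin k → Fin (k + u),
      |A.det| ≤ ((k + u : ℕ) * K) ^ u * |(A.submatrix (fun i => i.addNat u) e).det| := by
  induction u with
  | zero => exact ⟨id, by simp [Fin.addNat]; rfl⟩
  | succ u ih =>
    let minor : Fin (k + u + 1) → ℝ := fun j => |(A.submatrix Fin.succ j.succAbove).det|
    -- Laplace expansion along the first row, with every cofactor replaced by the largest one.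
    obtain ⟨j, -, hj⟩ := Finset.exists_max_image Finset.univ minor Finset.univ_nonempty
    have h1 : |A.det| ≤ (k + u + 1 : ℕ) * K * minor j := by
      rw [Matrix.det_succ_row_zero]
      calc _ ≤ ∑ i : Fin (k + u + 1), |(-1) ^ (i : ℕ) * A 0 i *
            (A.submatrix Fin.succ i.succAbove).det| := Finset.abs_sum_le_sum_abs _ _
        _ ≤ ∑ _i : Fin (k + u + 1), K * minor j := by
          refine Finset.sum_le_sum fun i _ => ?_
          rw [abs_mul, abs_mul, abs_pow, abs_neg, abs_one, one_pow, one_mul]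
          exact mul_le_mul (hK 0 i) (hj i (Finset.mem_univ _)) (abs_nonneg _) hK0
        _ = _ := by simp; ring
    obtain ⟨e, he⟩ := ih (A.submatrix Fin.succ j.succAbove) fun l i => hK _ _
    refine ⟨fun i => j.succAbove (e i), h1.trans ?_⟩
    rw [Matrix.submatrix_submatrix] at he
    calc _ ≤ (k + u + 1 : ℕ) * K * (((k + u : ℕ) * K) ^ u * _) :=
          mul_le_mul_of_nonneg_left he (by positivity)
      _ ≤ (k + u + 1 : ℕ) * K * (((k + u + 1 : ℕ) * K) ^ u * _) := by
          have h2 : ((k + u : ℕ) : ℝ) ≤ (k + u + 1 : ℕ) := by exact_mod_cast Nat.le_succ _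
          have h3 := mul_le_mul_of_nonneg_right h2 hK0
          have h4 : 0 ≤ ((k + u : ℕ) : ℝ) * K := by positivity
          exact mul_le_mul_of_nonneg_left (mul_le_mul_of_nonneg_right
            (pow_le_pow_left₀ h4 h3 u) (abs_nonneg _)) (by positivity)
      _ = ((k + (u + 1) : ℕ) * K) ^ (u + 1) * _ := by
          rw [← mul_assoc, pow_succ' _ u]
          rfl

/-- Multilinear expansion of the determinant of a product: some minor of the left factor is not too
small. -/
lemma exists_abs_det_mul_le {κ δ : Type*} [Fintype κ] [DecidableEq κ] [Fintype δ] [DecidableEq δ]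
    [Nonempty δ] (N : Matrix κ δ ℝ) (X : Matrix δ κ ℝ) {ξ : ℝ} (hX : ∀ j l, |X j l| ≤ ξ) :
    ∃ e : κ → δ, |(N * X).det| ≤
      (Fintype.card δ * ξ) ^ Fintype.card κ * |(N.submatrix id e).det| := by
  let minor : (κ → δ) → ℝ := fun e => |(N.submatrix id e).det|
  obtain ⟨e, -, he⟩ := Finset.exists_max_image Finset.univ minor Finset.univ_nonempty
  refine ⟨e, ?_⟩
  -- Each column of `N * X` is a combination of the columns of `N`. Choices `a` that repeat a column
  -- contribute vanishing minors and need no separate treatment.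
  have h1 : (N * X).det = ∑ a : κ → δ, (∏ l, X (a l) l) * (N.submatrix id a).det := by
    rw [← Matrix.det_transpose]
    have : (N * X)ᵀ = fun l => ∑ j, X j l • Nᵀ j := by
      funext l i
      simp [Matrix.mul_apply, Finset.sum_apply, mul_comm]
    rw [this]
    change Matrix.detRowAlternating.toMultilinearMap _ = _
    rw [MultilinearMap.map_sum]
    refine Finset.sum_congr rfl fun a _ => ?_
    rw [MultilinearMap.map_smul_univ, smul_eq_mul]
    congr 1
    rw [← Matrix.det_transpose]
    rfl
  rw [h1]
  calc _ ≤ ∑ a : κ → δ, |(∏ l, X (a l) l) * (N.submatrix id a).det| :=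
        Finset.abs_sum_le_sum_abs _ _
    _ ≤ ∑ _a : κ → δ, ξ ^ Fintype.card κ * minor e := by
        refine Finset.sum_le_sum fun a _ => ?_
        rw [abs_mul, Finset.abs_prod]
        have hp : ∏ l, |X (a l) l| ≤ ξ ^ Fintype.card κ := by
          calc _ ≤ ∏ _l : κ, ξ := Finset.prod_le_prod (fun _ _ => abs_nonneg _) fun l _ => hX _ _
            _ = _ := by simp
        refine mul_le_mul hp (he a (Finset.mem_univ _)) (abs_nonneg _) ?_
        exact le_trans (Finset.prod_nonneg fun _ _ => abs_nonneg _) hp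
    _ = _ := by simp [minor, mul_pow, mul_assoc]

/-! ### The triangular factor -/

section Decoder

variable {E : Type*} [NormedAddCommGroup E] [InnerProductSpace ℝ E] {d : ℕ}

lemma factorR_self (c : Fin d → E) (l : Fin d) : factorR c l l = ‖gramSchmidt ℝ c l‖ := by
  have h : inner ℝ (gramSchmidt ℝ c l) (c l) = ‖gramSchmidt ℝ c l‖ ^ 2 := by
    conv_lhs => rw [gramSchmidt_def'' ℝ c l]
    rw [inner_add_right, inner_sum, real_inner_self_eq_norm_sq]
    refine add_eq_left.2 (Finset.sum_eq_zero fun i hi => ?_)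
    rw [inner_smul_right, gramSchmidt_orthogonal ℝ c (Finset.mem_Iio.1 hi).ne', mul_zero]
  rw [factorR, gramSchmidtNormed, real_inner_smul_left, h]
  by_cases h0 : ‖gramSchmidt ℝ c l‖ = 0
  · simp [h0]
  · simp; field_simp

lemma mem_pivots (c : Fin d → E) (l : Fin d) : l ∈ pivots c ↔ gramSchmidtNormed ℝ c l ≠ 0 := by
  simp [pivots, factorR_self, gramSchmidtNormed]

lemma norm_gramSchmidtNormed_le (c : Fin d → E) (l : Fin d) : ‖gramSchmidtNormed ℝ c l‖ ≤ 1 := by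
  by_cases h : gramSchmidtNormed ℝ c l = 0
  · simp [h]
  · exact (gramSchmidtNormed_unit_length' h).le

lemma abs_factorR_le (c : Fin d → E) (l j : Fin d) : |factorR c l j| ≤ ‖c j‖ := by
  refine (abs_real_inner_le_norm _ _).trans ?_
  simpa using mul_le_mul_of_nonneg_right (norm_gramSchmidtNormed_le c l) (norm_nonneg (c j))

lemma factorR_eq_zero (c : Fin d → E) {l j : Fin d} (h : j < l) : factorR c l j = 0 := by
  rw [factorR, gramSchmidtNormed, real_inner_smul_left, gramSchmidt_inv_triangular ℝ c h, mul_zero]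

lemma span_gramSchmidtNormed_eq (c : Fin d → E) :
    Submodule.span ℝ (Set.range (gramSchmidtNormed ℝ c)) = Submodule.span ℝ (Set.range c) := by
  rw [span_gramSchmidtNormed_range, span_gramSchmidt]

lemma orthonormal_pivots (c : Fin d → E) :
    Orthonormal ℝ fun l : pivots c => gramSchmidtNormed ℝ c l := by
  have h := gramSchmidtNormed_orthonormal' (𝕜 := ℝ) c
  exact h.comp (fun l : pivots c => ⟨l.1, (mem_pivots c l.1).1 l.2⟩) fun a b hab =>
    Subtype.ext (congrArg (fun x => x.1) hab)

lemma span_pivots (c : Fin d → E) :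
    Submodule.span ℝ (Set.range fun l : pivots c => gramSchmidtNormed ℝ c l) =
      Submodule.span ℝ (Set.range c) := by
  rw [← span_gramSchmidtNormed_eq]
  refine le_antisymm (Submodule.span_mono ?_) (Submodule.span_le.2 ?_)
  · rintro _ ⟨l, rfl⟩; exact ⟨l, rfl⟩
  · rintro _ ⟨l, rfl⟩
    by_cases h : gramSchmidtNormed ℝ c l = 0
    · rw [h]; exact Submodule.zero_mem _
    · exact Submodule.subset_span ⟨⟨l, (mem_pivots c l).2 h⟩, rfl⟩

/-- The number of pivots is the rank of the columns. -/
lemma card_pivots (c : Fin d → E) :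
    (pivots c).card = Module.finrank ℝ (Submodule.span ℝ (Set.range c)) := by
  rw [← span_pivots, finrank_span_eq_card (orthonormal_pivots c).linearIndependent]
  simp

/-- The Gram-Schmidt vectors of the pivots are an orthonormal basis of the column space. -/
lemma sum_pivots_smul (c : Fin d → E) {v : E} (hv : v ∈ Submodule.span ℝ (Set.range c)) :
    ∑ l ∈ pivots c, inner ℝ (gramSchmidtNormed ℝ c l) v • gramSchmidtNormed ℝ c l = v := by
  classical
  rw [← span_pivots] at hv
  rw [← Finset.sum_coe_sort]
  induction hv using Submodule.span_induction with
  | mem x hx =>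
    obtain ⟨j, rfl⟩ := hx
    rw [Finset.sum_eq_single j]
    · have := (orthonormal_pivots c).1 j
      simp only at this
      rw [real_inner_self_eq_norm_sq, this]; simp
    · intro l _ hl
      have := (orthonormal_pivots c).2 hl
      simp only at this
      rw [this, zero_smul]
    · simp
  | zero => simp
  | add x y _ _ hx hy =>
    simp only [inner_add_right, add_smul, Finset.sum_add_distrib, hx, hy]
  | smul a x _ hx =>
    simp only [inner_smul_right, mul_smul, ← Finset.smul_sum, hx]

lemma inner_eq_sum_pivots (c : Fin d → E) (w : E) {v : E}
    (hv : v ∈ Submodule.span ℝ (Set.range c)) :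
    inner ℝ w v = ∑ l ∈ pivots c,
      inner ℝ w (gramSchmidtNormed ℝ c l) * inner ℝ (gramSchmidtNormed ℝ c l) v := by
  conv_lhs => rw [← sum_pivots_smul c hv]
  rw [inner_sum]
  exact Finset.sum_congr rfl fun l _ => by rw [inner_smul_right, mul_comm]

lemma inner_gramSchmidtNormed_sum (c : Fin d → E) (l : Fin d) (x : Fin d → ℝ) :
    inner ℝ (gramSchmidtNormed ℝ c l) (∑ j, x j • c j) = ∑ j, factorR c l j * x j := by
  rw [inner_sum]
  exact Finset.sum_congr rfl fun j _ => by rw [inner_smul_right, mul_comm]; rfl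

/-- The transmitted symbols are within the norm of the noise, if the interference is orthogonal to
the columns. -/
lemma fullMetric_le (c : Fin d → E) (s : Fin d → ℤ) {y u w : E}
    (hy : y = ∑ j, (s j : ℝ) • c j + u + w) (hu : ∀ j, inner ℝ (c j) u = 0) :
    fullMetric c y s ≤ ‖w‖ ^ 2 := by
  have hperp : ∀ v ∈ Submodule.span ℝ (Set.range c), inner ℝ v u = 0 := by
    intro v hv
    induction hv using Submodule.span_induction with
    | mem x hx => obtain ⟨j, rfl⟩ := hx; exact hu j
    | zero => simp
    | add x y _ _ hx hy => rw [inner_add_left, hx, hy, add_zero]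
    | smul a x _ hx => rw [real_inner_smul_left, hx, mul_zero]
  have h : ∀ l, inner ℝ (gramSchmidtNormed ℝ c l) y - ∑ j, factorR c l j * (s j : ℝ) =
      inner ℝ (gramSchmidtNormed ℝ c l) w := by
    intro l
    have hl : gramSchmidtNormed ℝ c l ∈ Submodule.span ℝ (Set.range c) := by
      rw [← span_gramSchmidtNormed_eq]; exact Submodule.subset_span ⟨l, rfl⟩
    rw [hy, inner_add_right, inner_add_right, inner_gramSchmidtNormed_sum, hperp _ hl]
    ring
  unfold fullMetric
  simp only [h]
  -- Bessel's inequality: only the component of the noise in the column space counts.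
  have hb := (orthonormal_pivots c).sum_inner_products_le w (s := Finset.univ)
  simp only [Real.norm_eq_abs, sq_abs] at hb
  rw [← Finset.sum_coe_sort]
  exact hb

open Classical in
/-- All the partial assignments at the level of pivot `i`, for all values of the non-pivot
coordinates. -/
def levelNodes (c : Fin d → E) (y : E) (S : Finset ℤ) (ρ : ℝ) (i : Fin d) : Finset (Fin d → ℤ) :=
  (Fintype.piFinset fun j => if j ∉ pivots c ∨ i ≤ j then S else {0}).filter
    fun s => partialMetric c y s i ≤ ρ ^ 2

lemma card_nonpivot (c : Fin d → E) (S : Finset ℤ) :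
    (Fintype.piFinset (fun j => if j ∈ pivots c then {0} else S)).card =
      S.card ^ (d - (pivots c).card) := by
  classical
  rw [Fintype.card_piFinset]
  have : ∀ j, (if j ∈ pivots c then ({0} : Finset ℤ) else S).card =
      if j ∈ pivots c then 1 else S.card := fun j => by split_ifs <;> simp
  simp only [this]
  rw [Finset.prod_ite]
  simp only [Finset.prod_const_one, one_mul, Finset.prod_const]
  congr 1
  have h2 : (Finset.univ.filter fun j => j ∉ pivots c) = (pivots c)ᶜ := by
    ext; simp
  rw [h2, Finset.card_compl, Fintype.card_fin]

/-- Each tree search visits its root, whatever the radius. This is the whole lower bound. -/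
lemma le_passNodes (c : Fin d → E) (y : E) (S : Finset ℤ) (ρ : ℝ) :
    S.card ^ (d - (pivots c).card) ≤ passNodes c y S ρ := by
  rw [← card_nonpivot, passNodes, Finset.card_eq_sum_ones]
  exact Finset.sum_le_sum fun b _ => by rw [innerNodes]; omega

/-- The trees of the different values of `s_b` are merged level by level, so that all unassigned and
assigned coordinates can be counted together; the first summand counts the roots. -/
lemma passNodes_le (c : Fin d → E) (y : E) (S : Finset ℤ) (ρ : ℝ) :
    passNodes c y S ρ ≤
      S.card ^ (d - (pivots c).card) + ∑ i ∈ pivots c, (levelNodes c y S ρ i).card := by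
  classical
  unfold passNodes innerNodes
  rw [Finset.sum_add_distrib, ← card_nonpivot, Finset.sum_comm]
  refine add_le_add (by simp) (Finset.sum_le_sum fun i hi => ?_)
  rw [← Finset.card_sigma]
  refine Finset.card_le_card_of_injOn (fun p => p.2) ?_ ?_
  · rintro ⟨b, s⟩ hp
    simp only [Finset.coe_sigma, Set.mem_sigma_iff, Finset.mem_coe, Fintype.mem_piFinset,
      Finset.mem_filter] at hp
    simp only [levelNodes, Finset.mem_coe, Finset.mem_filter, Fintype.mem_piFinset]
    refine ⟨fun j => ?_, hp.2.2⟩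
    have h1 := hp.1 j
    have h2 := hp.2.1 j
    by_cases hj : j ∈ pivots c
    · simpa [hj] using h2
    · simp only [hj, if_false, not_false_iff, if_true, Finset.mem_singleton, true_or] at h1 h2 ⊢
      rwa [h2]
  · rintro ⟨b, s⟩ hp ⟨b', s'⟩ hp' (h : s = s')
    subst h
    simp only [Finset.coe_sigma, Set.mem_sigma_iff, Finset.mem_coe, Fintype.mem_piFinset,
      Finset.mem_filter] at hp hp'
    -- A partial assignment remembers its tree: `b` agrees with `s` off the pivots and is `0` on
    -- them.
    have : b = b' := by
      funext j
      have h1 := hp.1 j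
      have h2 := hp.2.1 j
      have h3 := hp'.1 j
      have h4 := hp'.2.1 j
      by_cases hj : j ∈ pivots c
      · simp only [hj, if_true, Finset.mem_singleton] at h1 h3
        rw [h1, h3]
      · simp only [hj, not_false_iff, if_true, Finset.mem_singleton] at h2 h4
        rw [← h2, ← h4]
    rw [this]

/-- The number of partial assignments at the level of the pivot number `u`. -/
lemma card_levelNodes_mul_le (c : Fin d → E) (y : E) (S : Finset ℤ) {ρ K ξ : ℝ} (hρ : 0 ≤ ρ)
    (hK : ∀ j, ‖c j‖ ≤ K) (hK0 : 0 ≤ K) (hξ : 0 ≤ ξ) [Nonempty (Fin d)] {k u : ℕ}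
    (hr : (pivots c).card = k + u) (i : Fin d)
    (hi : ∀ v : Fin (k + u), i ≤ (pivots c).orderEmbOfFin hr v ↔ u ≤ v)
    (w : Fin (k + u) → E) (hw : ∀ l, ‖w l‖ ≤ 1) (X : Matrix (Fin d) (Fin (k + u)) ℝ)
    (hX : ∀ j l, |X j l| ≤ ξ) :
    ((levelNodes c y S ρ i).card : ℝ) *
        |(Matrix.of fun l' l => inner ℝ (w l') (∑ j, X j l • c j)).det| ≤
      S.card ^ (d - (pivots c).card) * (2 * (ρ + d * K)) ^ k * ((k + u).factorial *
        (((k + u : ℕ) * (d * (K * ξ))) ^ u * (d * ξ) ^ k)) := by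
  classical
  set e := (pivots c).orderEmbOfFin hr with he
  let R : Matrix (Fin (k + u)) (Fin d) ℝ := fun v j => factorR c (e v) j
  let W : Matrix (Fin (k + u)) (Fin (k + u)) ℝ := fun l' v =>
    inner ℝ (w l') (gramSchmidtNormed ℝ c (e v))
  have hsum : ∀ F : Fin d → ℝ, ∑ l ∈ pivots c, F l = ∑ v, F (e v) := by
    intro F
    have : pivots c = Finset.univ.map e.toEmbedding := by
      rw [he, Finset.map_orderEmbOfFin_univ]
    conv_lhs => rw [this]
    rw [Finset.sum_map]; rfl
  -- Inserting the orthonormal basis of the column space factors the test determinant through the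
  -- pivot rows `R`.
  have hT : (Matrix.of fun l' l => inner ℝ (w l') (∑ j, X j l • c j)) = W * (R * X) := by
    ext l' l
    rw [Matrix.of_apply, inner_eq_sum_pivots c (w l')
      (Submodule.sum_mem _ fun j _ => Submodule.smul_mem _ _ (Submodule.subset_span ⟨j, rfl⟩)),
      hsum, Matrix.mul_apply]
    refine Finset.sum_congr rfl fun v _ => ?_
    rw [inner_gramSchmidtNormed_sum, Matrix.mul_apply]
  have hR : ∀ v j, |R v j| ≤ K := fun v j => (abs_factorR_le c _ j).trans (hK j)
  have hW : |W.det| ≤ (k + u).factorial := by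
    have := Matrix.det_le (A := W) (abv := IsAbsoluteValue.toAbsoluteValue abs) (x := 1)
      fun l v => (abs_real_inner_le_norm _ _).trans (by
        simpa using mul_le_mul (hw l) (norm_gramSchmidtNormed_le c (e v)) (norm_nonneg _)
          zero_le_one)
    simpa using this
  have hRX : ∀ v l, |(R * X) v l| ≤ d * (K * ξ) := by
    intro v l
    rw [Matrix.mul_apply]
    calc _ ≤ ∑ j, |R v j * X j l| := Finset.abs_sum_le_sum_abs _ _
      _ ≤ ∑ _j : Fin d, K * ξ := by
        refine Finset.sum_le_sum fun j _ => ?_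
        rw [abs_mul]
        exact mul_le_mul (hR v j) (hX j l) (abs_nonneg _) hK0
      _ = _ := by simp
  -- The first `u` rows belong to pivots not yet assigned at this level and are expanded away.
  obtain ⟨a, ha⟩ := exists_abs_det_le_minor (by positivity) k u (R * X) hRX
  set R' : Matrix (Fin k) (Fin d) ℝ := R.submatrix (fun v => v.addNat u) id with hR'
  have hsub : (R * X).submatrix (fun v => v.addNat u) a = R' * X.submatrix id a := by
    rw [hR', Matrix.submatrix_mul_equiv R X (fun v : Fin k => v.addNat u) (Equiv.refl _) a |>.symm]
    rfl
  rw [hsub] at ha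
  -- The factor `X` is removed in turn, which leaves a minor of the `k` active rows in columns `b`
  -- that need not be pivots.
  obtain ⟨b, hb⟩ := exists_abs_det_mul_le R' (X.submatrix id a) fun j l => hX j (a l)
  rw [Fintype.card_fin, Fintype.card_fin] at hb
  have hdetT : |(Matrix.of fun l' l => inner ℝ (w l') (∑ j, X j l • c j)).det| ≤
      (k + u).factorial * (((k + u : ℕ) * (d * (K * ξ))) ^ u * ((d * ξ) ^ k *
        |(R'.submatrix id b).det|)) := by
    rw [hT, Matrix.det_mul, abs_mul]
    refine mul_le_mul hW (ha.trans ?_) (abs_nonneg _) (by positivity)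
    exact mul_le_mul_of_nonneg_left hb (by positivity)
  let T : Fin d → Finset ℤ := fun j => if j ∉ pivots c ∨ i ≤ j then S else {0}
  have hcount := card_mul_abs_minor_le R' b (fun v j => hR _ j) hρ hK0
    (fun v => inner ℝ (gramSchmidtNormed ℝ c (e (v.addNat u))) y) (levelNodes c y S ρ i)
    (S.card ^ (d - (pivots c).card)) ?_ T ?_ ?_
  · have hkd : (k : ℝ) ≤ d := by
      have : (pivots c).card ≤ d := by simpa using Finset.card_le_univ (pivots c)
      exact_mod_cast (by omega : k ≤ d)
    rw [Fintype.card_fin] at hcount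
    push_cast at hcount
    calc _ ≤ ((levelNodes c y S ρ i).card : ℝ) * _ := mul_le_mul_of_nonneg_left hdetT (by positivity)
      _ = ((levelNodes c y S ρ i).card * |(R'.submatrix id b).det|) * ((k + u).factorial *
        (((k + u : ℕ) * (d * (K * ξ))) ^ u * (d * ξ) ^ k)) := by ring
      _ ≤ (S.card ^ (d - (pivots c).card) * (2 * (ρ + k * K)) ^ k) * ((k + u).factorial *
        (((k + u : ℕ) * (d * (K * ξ))) ^ u * (d * ξ) ^ k)) :=
          mul_le_mul_of_nonneg_right hcount (by positivity)
      _ ≤ _ := by gcongr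
  · intro s hs v
    have hm := (Finset.mem_filter.1 hs).2
    have hiv : i ≤ e (v.addNat u) := (hi _).2 (by simp)
    have hle : (inner ℝ (gramSchmidtNormed ℝ c (e (v.addNat u))) y -
        ∑ j, factorR c (e (v.addNat u)) j * (s j : ℝ)) ^ 2 ≤ ρ ^ 2 := by
      refine le_trans ?_ hm
      unfold partialMetric
      refine Finset.single_le_sum (f := fun l => (inner ℝ (gramSchmidtNormed ℝ c l) y -
        ∑ j, factorR c l j * (s j : ℝ)) ^ 2) (fun l _ => sq_nonneg _) ?_
      rw [Finset.mem_filter]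
      exact ⟨Finset.orderEmbOfFin_mem _ _ _, hiv⟩
    rw [abs_sub_comm]
    exact abs_le_of_sq_le_sq hle hρ
  · intro s hs j
    exact Fintype.mem_piFinset.1 (Finset.mem_filter.1 hs).1 j
  · intro hdet
    have hinj : Function.Injective b := by
      intro v v' hab
      by_contra hne
      exact hdet (Matrix.det_zero_of_column_eq hne fun l => by simp [hab])
    -- The active rows vanish in all columns before `i`, so a nonzero minor uses only coordinates
    -- that are free at this level.
    have hbi : ∀ v, i ≤ b v := by
      intro v
      by_contra hlt
      refine hdet (Matrix.det_eq_zero_of_column_eq_zero v fun l => ?_)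
      exact factorR_eq_zero c (lt_of_lt_of_le (not_le.1 hlt) ((hi _).2 (by simp)))
    have hTc : ∀ j, (T j).card = if j ∉ pivots c ∨ i ≤ j then S.card else 1 := fun j => by
      simp only [T]; split_ifs <;> simp
    simp only [hTc]
    rw [Finset.prod_ite, Finset.prod_const_one, mul_one, Finset.prod_const]
    refine le_of_eq ?_
    congr 1
    -- The free coordinates are the `d - rank` non-pivots and the `k` assigned pivots; removing the
    -- `k` columns of the minor leaves `d - rank`.
    have hset : (Finset.univ.filter fun j => j ∉ Set.range b).filter
        (fun j => j ∉ pivots c ∨ i ≤ j) =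
        ((pivots c)ᶜ ∪ (pivots c).filter (fun j => i ≤ j)) \ Finset.univ.image b := by
      ext j
      simp only [Finset.mem_filter, Finset.mem_univ, true_and, Set.mem_range, Finset.mem_sdiff,
        Finset.mem_union, Finset.mem_compl, Finset.mem_image]
      tauto
    have hk : ((pivots c).filter (fun j => i ≤ j)).card = k := by
      have : (pivots c).filter (fun j => i ≤ j) =
          Finset.univ.image fun v : Fin k => e (v.addNat u) := by
        ext j
        simp only [Finset.mem_filter, Finset.mem_image, Finset.mem_univ, true_and]
        constructor
        · rintro ⟨hj, hij⟩
          have : j ∈ Set.range e := by rw [he, Finset.range_orderEmbOfFin]; exact hj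
          obtain ⟨v, rfl⟩ := this
          have huv := (hi v).1 hij
          refine ⟨⟨v - u, by omega⟩, ?_⟩
          congr 1
          ext
          simp; omega
        · rintro ⟨v, rfl⟩
          exact ⟨Finset.orderEmbOfFin_mem _ _ _, (hi _).2 (by simp)⟩
      rw [this, Finset.card_image_of_injective, Finset.card_univ, Fintype.card_fin]
      intro v v' h
      have := e.injective h
      ext
      simpa [Fin.ext_iff] using this
    rw [hset, Finset.card_sdiff_of_subset, Finset.card_union_of_disjoint, hk, Finset.card_compl,
      Finset.card_image_of_injective _ hinj, Finset.card_univ, Fintype.card_fin, Fintype.card_fin]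
    · omega
    · rw [Finset.disjoint_left]
      intro j hj hj'
      exact (Finset.mem_compl.1 hj) (Finset.mem_filter.1 hj').1
    · intro j hj
      obtain ⟨v, -, rfl⟩ := Finset.mem_image.1 hj
      simp only [Finset.mem_union, Finset.mem_compl, Finset.mem_filter]
      have := hbi v
      tauto

end Decoder

/-! ### Nodes of one pass and of the whole decoder -/

section Decoder

variable {E : Type*} [NormedAddCommGroup E] [InnerProductSpace ℝ E] {d : ℕ}

/-- The number of nodes visited in one pass, in terms of any minor of the columns. -/
lemma passNodes_mul_abs_det_le (c : Fin d → E) (y : E) (S : Finset ℤ) {ρ K ξ : ℝ} (hρ : 0 ≤ ρ)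
    (hK : ∀ j, ‖c j‖ ≤ K) (hξ : 1 ≤ ξ) [Nonempty (Fin d)] {ι : Type*} [Fintype ι]
    [DecidableEq ι] (hι : (pivots c).card = Fintype.card ι) (w : ι → E) (hw : ∀ l, ‖w l‖ ≤ 1)
    (X : Matrix (Fin d) ι ℝ) (hX : ∀ j l, |X j l| ≤ ξ) :
    (passNodes c y S ρ : ℝ) * |(Matrix.of fun l' l => inner ℝ (w l') (∑ j, X j l • c j)).det| ≤
      (d + 1).factorial * (2 * d ^ 2 * ξ) ^ (2 * d) * (1 + ρ + K) ^ (2 * d) *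
        S.card ^ (d - (pivots c).card) := by
  classical
  have hd1 : 1 ≤ d := Fin.pos_iff_nonempty.2 inferInstance
  have hd1' : (1 : ℝ) ≤ d := by exact_mod_cast hd1
  have hK0 : 0 ≤ K := (norm_nonneg _).trans (hK (Classical.arbitrary _))
  have hpd : (pivots c).card ≤ d := by simpa using Finset.card_le_univ (pivots c)
  set T : Matrix ι ι ℝ := Matrix.of fun l' l => inner ℝ (w l') (∑ j, X j l • c j) with hT
  set B : ℝ := 1 + ρ + K with hB
  have hB1 : 1 ≤ B := by linarith
  -- One base that dominates all those in the level bound: `d * ξ`, `d * (d * (K * ξ))` and `2 * (ρ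
  -- + d * K)`.
  set m : ℝ := 2 * d ^ 2 * ξ * B with hm
  have hdm : (d : ℝ) * ξ ≤ m := by
    rw [hm]
    nlinarith [mul_le_mul hd1' hB1 zero_le_one (by positivity), mul_nonneg (by positivity :
      (0:ℝ) ≤ d) (by positivity : 0 ≤ ξ), mul_nonneg (mul_nonneg (by positivity :
      (0:ℝ) ≤ d) (by positivity : 0 ≤ ξ)) (by nlinarith : 0 ≤ (d : ℝ) * B - 1)]
  have hm1 : 1 ≤ m := le_trans (by nlinarith) hdm
  have hdK : (d : ℝ) * (d * (K * ξ)) ≤ m := by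
    rw [hm]
    nlinarith [mul_nonneg (mul_nonneg (by positivity : (0:ℝ) ≤ (d : ℝ) ^ 2)
      (by positivity : 0 ≤ ξ)) (by linarith : 0 ≤ B - K), mul_nonneg (mul_nonneg
      (by positivity : (0:ℝ) ≤ (d : ℝ) ^ 2) (by positivity : 0 ≤ ξ)) (by linarith : 0 ≤ B)]
  -- The roots contribute `|T.det|` each; the exponent `2 * d` is chosen to fit the levels, which
  -- need `k + u + k ≤ 2 * d`.
  have hroot : |T.det| ≤ d.factorial * m ^ (2 * d) := by
    have hent : ∀ l' l, |T l' l| ≤ d * (K * ξ) := by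
      intro l' l
      rw [hT, Matrix.of_apply]
      calc _ ≤ ‖w l'‖ * ‖∑ j, X j l • c j‖ := abs_real_inner_le_norm _ _
        _ ≤ 1 * ∑ _j : Fin d, K * ξ := by
          refine mul_le_mul (hw l') ((norm_sum_le _ _).trans (Finset.sum_le_sum fun j _ => ?_))
            (norm_nonneg _) zero_le_one
          rw [norm_smul, mul_comm]
          exact mul_le_mul (hK j) (hX j l) (abs_nonneg _) hK0
        _ = _ := by simp
    have h1 := Matrix.det_le (A := T) (abv := IsAbsoluteValue.toAbsoluteValue abs) hent
    simp only [IsAbsoluteValue.toAbsoluteValue_apply, nsmul_eq_mul] at h1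
    rw [← hι] at h1
    have h2 : (d : ℝ) * (K * ξ) ≤ m :=
      le_trans (le_mul_of_one_le_left (by positivity) hd1') hdK
    calc _ ≤ _ := h1
      _ ≤ d.factorial * m ^ (pivots c).card := by gcongr
      _ ≤ _ := by gcongr <;> first | exact hm1 | omega
  have hlevel : ∀ i ∈ pivots c, ((levelNodes c y S ρ i).card : ℝ) * |T.det| ≤
      S.card ^ (d - (pivots c).card) * (d.factorial * m ^ (2 * d)) := by
    intro i hi
    obtain ⟨v, hv⟩ : i ∈ Set.range ((pivots c).orderEmbOfFin rfl) := by
      rw [Finset.range_orderEmbOfFin]; exact hi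
    -- `u` is the number of pivots before `i`, and `k` the number of pivots from `i` on.
    obtain ⟨k, u, hku, hu⟩ : ∃ k u : ℕ, (pivots c).card = k + u ∧ u = v :=
      ⟨(pivots c).card - v, v, by omega, rfl⟩
    let eqv : Fin (k + u) ≃ ι := Fintype.equivOfCardEq (by simp [← hι, hku])
    have h := card_levelNodes_mul_le c y S hρ hK hK0 (by linarith : 0 ≤ ξ) hku i ?_ (w ∘ eqv)
      (fun l => hw _) (X.submatrix id eqv) fun j l => hX _ _
    · have hdet : (Matrix.of fun l' l => inner ℝ ((w ∘ eqv) l')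
          (∑ j, (X.submatrix id eqv) j l • c j)).det = T.det := by
        rw [← Matrix.det_submatrix_equiv_self eqv T]; rfl
      rw [hdet] at h
      refine h.trans ?_
      rw [mul_assoc]
      refine mul_le_mul_of_nonneg_left ?_ (by positivity)
      have hkud : k + u ≤ d := by omega
      have e1 : (2 * (ρ + d * K)) ^ k ≤ m ^ k := by
        refine pow_le_pow_left₀ (by positivity) ?_ k
        have h2 : ρ + d * K ≤ d ^ 2 * B := by
          have h3 : (d : ℝ) ≤ d ^ 2 := by nlinarith
          nlinarith [mul_nonneg (by linarith : (0 : ℝ) ≤ d ^ 2 - d) hK0,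
            mul_nonneg (by nlinarith : (0 : ℝ) ≤ d ^ 2 - 1) hρ]
        have h4 : (d : ℝ) ^ 2 * B ≤ d ^ 2 * B * ξ := le_mul_of_one_le_right (by positivity) hξ
        rw [hm]; nlinarith
      have e2 : (((k + u : ℕ) : ℝ) * (d * (K * ξ))) ^ u ≤ m ^ u := by
        refine pow_le_pow_left₀ (by positivity) (le_trans ?_ hdK) u
        gcongr
      have e3 : ((d : ℝ) * ξ) ^ k ≤ m ^ k := pow_le_pow_left₀ (by positivity) hdm k
      calc _ ≤ m ^ k * (d.factorial * (m ^ u * m ^ k)) := by gcongr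
        _ = d.factorial * m ^ (k + u + k) := by ring
        _ ≤ _ := by gcongr <;> first | exact hm1 | omega
    · intro v'
      have h1 : (pivots c).orderEmbOfFin hku v' =
          (pivots c).orderEmbOfFin rfl (Fin.cast hku.symm v') :=
        Finset.orderEmbOfFin_eq_orderEmbOfFin_iff.2 rfl
      rw [h1, ← hv, OrderEmbedding.le_iff_le, Fin.le_def, ← hu]
      rfl
  have hpass : (passNodes c y S ρ : ℝ) ≤ S.card ^ (d - (pivots c).card) +
      ∑ i ∈ pivots c, ((levelNodes c y S ρ i).card : ℝ) := by exact_mod_cast passNodes_le c y S ρ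
  calc _ ≤ (S.card ^ (d - (pivots c).card) +
      ∑ i ∈ pivots c, ((levelNodes c y S ρ i).card : ℝ)) * |T.det| :=
        mul_le_mul_of_nonneg_right hpass (abs_nonneg _)
    _ = S.card ^ (d - (pivots c).card) * |T.det| +
        ∑ i ∈ pivots c, ((levelNodes c y S ρ i).card : ℝ) * |T.det| := by
      rw [add_mul, Finset.sum_mul]
    _ ≤ S.card ^ (d - (pivots c).card) * (d.factorial * m ^ (2 * d)) +
        ∑ _i ∈ pivots c, S.card ^ (d - (pivots c).card) * (d.factorial * m ^ (2 * d)) := by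
      refine add_le_add (mul_le_mul_of_nonneg_left hroot (by positivity)) ?_
      exact Finset.sum_le_sum hlevel
    _ = ((pivots c).card + 1) * (S.card ^ (d - (pivots c).card) * (d.factorial * m ^ (2 * d))) := by
      rw [Finset.sum_const, nsmul_eq_mul]; ring
    _ ≤ (d + 1) * (S.card ^ (d - (pivots c).card) * (d.factorial * m ^ (2 * d))) := by
      gcongr
    _ = _ := by
      rw [hm, Nat.factorial_succ]; push_cast; rw [mul_pow _ B]; ring

/-- For the least such `t > 0` the previous radius is still below `ω`, so the last one overshoots by
a factor of at most `2`; the summand `1` covers `t = 0`. -/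
lemma exists_pow_two_mul_ge {r ω : ℝ} (hr : 0 < r) (hω : 0 ≤ ω) :
    ∃ t : ℕ, ω ≤ 2 ^ t * r ∧ (2 : ℝ) ^ t ≤ 1 + 2 * ω / r := by
  classical
  have hex : ∃ t : ℕ, ω ≤ 2 ^ t * r := by
    obtain ⟨t, ht⟩ := pow_unbounded_of_one_lt (ω / r) (by norm_num : (1 : ℝ) < 2)
    exact ⟨t, ((div_lt_iff₀ hr).1 ht).le⟩
  refine ⟨Nat.find hex, Nat.find_spec hex, ?_⟩
  rcases Nat.eq_zero_or_pos (Nat.find hex) with h | h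
  · rw [h, pow_zero]
    have : 0 ≤ 2 * ω / r := by positivity
    linarith
  · obtain ⟨t, ht⟩ := Nat.exists_eq_succ_of_ne_zero h.ne'
    have h1 := Nat.find_min hex (m := t) (by omega)
    rw [ht, pow_succ]
    have : (2 : ℝ) ^ t ≤ ω / r := by rw [le_div_iff₀ hr]; exact (not_le.1 h1).le
    have h2 : 2 * ω / r = ω / r * 2 := by ring
    rw [h2]; linarith

/-- The number of nodes visited by the sphere decoder, in terms of any minor of the columns and of
the distance of some symbol vector. -/
lemma decoderNodes_mul_abs_det_le {r ξ : ℝ} (hr : 0 < r) (hξ : 1 ≤ ξ) (hd : 1 ≤ d) :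
    ∃ C : ℝ, 0 < C ∧ ∀ (c : Fin d → E) (y : E) (S : Finset ℤ) (s : Fin d → ℤ) (K ω : ℝ),
      (∀ j, ‖c j‖ ≤ K) → 0 ≤ ω → (∀ j, s j ∈ S) → fullMetric c y s ≤ ω ^ 2 →
      ∀ (ι : Type) [Fintype ι] [DecidableEq ι] (w : ι → E) (X : Matrix (Fin d) ι ℝ),
      (pivots c).card = Fintype.card ι → (∀ l, ‖w l‖ ≤ 1) → (∀ j l, |X j l| ≤ ξ) →
      (decoderNodes c y S r : ℝ) *
          |(Matrix.of fun l' l => inner ℝ (w l') (∑ j, X j l • c j)).det| ≤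
        C * (1 + ω) ^ (2 * d + 1) * (1 + K) ^ (2 * d) * S.card ^ (d - (pivots c).card) := by
  have : Nonempty (Fin d) := Fin.pos_iff_nonempty.1 hd
  set C₁ : ℝ := (d + 1).factorial * (2 * d ^ 2 * ξ) ^ (2 * d) with hC₁
  have hd0 : (0 : ℝ) < d := by exact_mod_cast hd
  have hC₁0 : 0 < C₁ := by positivity
  refine ⟨(1 + 2 / r) * (C₁ * (2 + r) ^ (2 * d)), by positivity, ?_⟩
  intro c y S s K ω hK hω hs hmetric ι _ _ w X hι hw hX
  have hK0 : 0 ≤ K := (norm_nonneg _).trans (hK (Classical.arbitrary _))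
  obtain ⟨t, ht, ht2⟩ := exists_pow_two_mul_ge hr hω
  -- A radius of at least `ω` is sure to find `s`, so all radii used are at most `2 ^ t * r ≤ r + 2
  -- * ω`.
  have hdoub : doublings c y S r ≤ t := by
    refine Nat.sInf_le ⟨s, hs, hmetric.trans ?_⟩
    gcongr
  set D := |(Matrix.of fun l' l => inner ℝ (w l') (∑ j, X j l • c j)).det| with hD
  set Q : ℝ := (S.card : ℝ) ^ (d - (pivots c).card) with hQ
  have hpass : ∀ t' ∈ Finset.range (doublings c y S r + 1),
      (passNodes c y S (2 ^ t' * r) : ℝ) * D ≤ C₁ * (1 + 2 ^ t * r + K) ^ (2 * d) * Q := by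
    intro t' ht'
    have ht'' : t' ≤ t := by have := Finset.mem_range.1 ht'; omega
    refine (passNodes_mul_abs_det_le c y S (by positivity) hK hξ hι w hw X hX).trans ?_
    have : (2 : ℝ) ^ t' ≤ 2 ^ t := pow_le_pow_right₀ (by norm_num) ht''
    gcongr
  -- The crude bound `t + 1 ≤ 2 ^ t` on the number of passes costs one more power of `1 + ω`, hence
  -- the exponent `2 * d + 1`.
  have hcard : ((doublings c y S r + 1 : ℕ) : ℝ) ≤ (1 + 2 / r) * (1 + ω) := by
    have h1 : t + 1 ≤ 2 ^ t := Nat.lt_two_pow_self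
    have h2 : ((doublings c y S r + 1 : ℕ) : ℝ) ≤ 2 ^ t := by exact_mod_cast (by omega)
    refine h2.trans (ht2.trans ?_)
    have : 0 < 2 / r := by positivity
    have h3 : 2 * ω / r = 2 / r * ω := by ring
    rw [h3]; nlinarith
  have hbase : 1 + 2 ^ t * r + K ≤ (2 + r) * (1 + ω) * (1 + K) := by
    have h1 : (2 : ℝ) ^ t * r ≤ r + 2 * ω := by
      calc _ ≤ (1 + 2 * ω / r) * r := by gcongr
        _ = _ := by field_simp
    nlinarith [mul_nonneg hω hK0, mul_nonneg hr.le hK0, mul_nonneg hr.le hω,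
      mul_nonneg hr.le (mul_nonneg hω hK0)]
  unfold decoderNodes
  push_cast
  rw [Finset.sum_mul]
  calc _ ≤ ∑ _t' ∈ Finset.range (doublings c y S r + 1),
        C₁ * (1 + 2 ^ t * r + K) ^ (2 * d) * Q := Finset.sum_le_sum hpass
    _ = ((doublings c y S r + 1 : ℕ) : ℝ) * (C₁ * (1 + 2 ^ t * r + K) ^ (2 * d) * Q) := by simp
    _ ≤ ((1 + 2 / r) * (1 + ω)) * (C₁ * ((2 + r) * (1 + ω) * (1 + K)) ^ (2 * d) * Q) := by
      gcongr
    _ = _ := by rw [mul_pow, mul_pow, pow_succ]; ring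

/-- The pass with the initial radius is always made, whatever the noise. -/
lemma le_decoderNodes (c : Fin d → E) (y : E) (S : Finset ℤ) (r : ℝ) :
    S.card ^ (d - (pivots c).card) ≤ decoderNodes c y S r := by
  refine (le_passNodes c y S (2 ^ 0 * r)).trans ?_
  exact Finset.single_le_sum (f := fun t => passNodes c y S (2 ^ t * r)) (fun _ _ => Nat.zero_le _)
    (Finset.mem_range.2 (Nat.succ_pos _))

end Decoder

/-! ### Densities on product spaces -/

lemma lintegral_fin_prod_eq_prod {N : ℕ} {E : Type*} [MeasurableSpace E]
    (μ : Fin N → Measure E) [∀ i, SigmaFinite (μ i)] (φ : Fin N → E → ℝ≥0∞)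
    (hφ : ∀ i, Measurable (φ i)) :
    ∫⁻ x, ∏ i, φ i (x i) ∂(Measure.pi μ) = ∏ i, ∫⁻ x, φ i x ∂(μ i) := by
  induction N with
  | zero => simp
  | succ N ih =>
    have hm : Measurable fun y : Fin N → E => ∏ i, φ i.succ (y i) :=
      Finset.measurable_prod _ fun i _ => (hφ i.succ).comp (measurable_pi_apply i)
    have h := MeasurePreserving.lintegral_map_equiv (fun x => ∏ i, φ i (x i)) _
      (measurePreserving_piFinSuccAbove μ 0).symm
    have hz : ∀ z : E × (Fin N → E),
        ∏ i, φ i ((MeasurableEquiv.piFinSuccAbove (fun _ => E) 0).symm z i) =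
        φ 0 z.1 * ∏ i : Fin N, φ i.succ (z.2 i) := fun z => by
      rw [Fin.prod_univ_succ]; rfl
    rw [h, lintegral_congr hz, Fin.prod_univ_succ, ← ih _ _ fun i => hφ _]
    exact lintegral_prod_mul (hφ 0).aemeasurable hm.aemeasurable

lemma lintegral_fintype_prod_eq_prod {ι E : Type*} [Fintype ι] [MeasurableSpace E]
    (μ : ι → Measure E) [∀ i, SigmaFinite (μ i)] (φ : ι → E → ℝ≥0∞)
    (hφ : ∀ i, Measurable (φ i)) :
    ∫⁻ x, ∏ i, φ i (x i) ∂(Measure.pi μ) = ∏ i, ∫⁻ x, φ i x ∂(μ i) := by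
  let e := (Fintype.equivFin ι).symm
  rw [MeasurePreserving.lintegral_map_equiv _ _ (measurePreserving_piCongrLeft μ e)]
  simp_rw [← e.prod_comp, MeasurableEquiv.coe_piCongrLeft, Equiv.piCongrLeft_apply_apply]
  exact lintegral_fin_prod_eq_prod _ _ fun i => hφ _

/-- It suffices to compare boxes, and on a box the indicator times the product density is again a
product. -/
lemma pi_withDensity {ι E : Type*} [Fintype ι] [MeasurableSpace E]
    (μ : ι → Measure E) [∀ i, SigmaFinite (μ i)] (φ : ι → E → ℝ≥0∞)
    (hφ : ∀ i, Measurable (φ i)) [∀ i, SigmaFinite ((μ i).withDensity (φ i))] :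
    Measure.pi (fun i => (μ i).withDensity (φ i)) =
      (Measure.pi μ).withDensity fun x => ∏ i, φ i (x i) := by
  classical
  refine Measure.pi_eq fun s hs => ?_
  rw [withDensity_apply _ (MeasurableSet.univ_pi hs), ← lintegral_indicator (MeasurableSet.univ_pi hs)]
  have h : ∀ x, (Set.univ.pi s).indicator (fun x => ∏ i, φ i (x i)) x =
      ∏ i, (s i).indicator (φ i) (x i) := by
    intro x
    by_cases hx : x ∈ Set.univ.pi s
    · rw [Set.indicator_of_mem hx]
      exact Finset.prod_congr rfl fun i _ =>
        (Set.indicator_of_mem (hx i (Set.mem_univ i)) _).symm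
    · rw [Set.indicator_of_notMem hx]
      simp only [Set.mem_pi, Set.mem_univ, true_implies, not_forall] at hx
      obtain ⟨i, hi⟩ := hx
      exact (Finset.prod_eq_zero (Finset.mem_univ i) (Set.indicator_of_notMem hi _)).symm
  simp_rw [h]
  rw [lintegral_fintype_prod_eq_prod μ (fun i => (s i).indicator (φ i))
    fun i => (hφ i).indicator (hs i)]
  exact Finset.prod_congr rfl fun i _ => by
    rw [lintegral_indicator (hs i), withDensity_apply _ (hs i)]

/-- The density of the standard complex Gaussian law. -/
def complexDensity (z : ℂ) : ℝ≥0∞ := ENNReal.ofReal (Real.pi⁻¹ * Real.exp (-‖z‖ ^ 2))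

lemma measurable_complexDensity : Measurable complexDensity := by
  unfold complexDensity; fun_prop

lemma complexGaussian_eq : complexGaussian = volume.withDensity complexDensity := by
  have hv : ((1 / 2 : NNReal)) ≠ 0 := by norm_num
  have hd : ∀ p : ℝ × ℝ, gaussianPDF 0 (1 / 2) p.1 * gaussianPDF 0 (1 / 2) p.2 =
      complexDensity (Complex.measurableEquivRealProd.symm p) := by
    intro p
    rw [gaussianPDF, gaussianPDF, ← ENNReal.ofReal_mul (gaussianPDFReal_nonneg _ _ _),
      complexDensity]
    congr 1
    rw [Complex.sq_norm, Complex.normSq_apply]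
    simp only [gaussianPDFReal, Complex.measurableEquivRealProd_symm_apply]
    have h1 : (√(2 * Real.pi * ((1 / 2 : NNReal) : ℝ)))⁻¹ *
        (√(2 * Real.pi * ((1 / 2 : NNReal) : ℝ)))⁻¹ = Real.pi⁻¹ := by
      rw [← mul_inv, Real.mul_self_sqrt (by positivity)]
      simp
      ring
    calc _ = ((√(2 * Real.pi * ((1 / 2 : NNReal) : ℝ)))⁻¹ *
        (√(2 * Real.pi * ((1 / 2 : NNReal) : ℝ)))⁻¹) *
        (Real.exp (-(p.1 - 0) ^ 2 / (2 * ((1 / 2 : NNReal) : ℝ))) *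
        Real.exp (-(p.2 - 0) ^ 2 / (2 * ((1 / 2 : NNReal) : ℝ)))) := by ring
      _ = _ := by
        rw [h1, ← Real.exp_add]
        congr 2
        push_cast
        ring
  rw [complexGaussian, gaussianReal_of_var_ne_zero _ hv,
    prod_withDensity (measurable_gaussianPDF _ _) (measurable_gaussianPDF _ _)]
  simp_rw [hd]
  ext s hs
  rw [Measure.map_apply Complex.measurableEquivRealProd.symm.measurable hs,
    withDensity_apply _ hs, withDensity_apply _
    (Complex.measurableEquivRealProd.symm.measurable hs)]
  exact Complex.volume_preserving_equiv_real_prod.symm.setLIntegral_comp_preimage_emb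
    (MeasurableEquiv.measurableEmbedding _) complexDensity s

instance : IsProbabilityMeasure complexGaussian := by
  unfold complexGaussian
  exact Measure.isProbabilityMeasure_map (MeasurableEquiv.measurable _).aemeasurable

instance (ν μ : Type*) [Fintype ν] [Fintype μ] : IsProbabilityMeasure (gaussianMatrix ν μ) := by
  unfold gaussianMatrix; infer_instance

instance : SigmaFinite ((volume : Measure ℂ).withDensity complexDensity) := by
  rw [← complexGaussian_eq]; infer_instance

lemma gaussianMatrix_eq (ν μ : Type*) [Fintype ν] [Fintype μ] :
    gaussianMatrix ν μ = volume.withDensity fun H => ∏ i, ∏ j, complexDensity (H i j) := by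
  have h1 : (Measure.pi fun _ : μ => complexGaussian) =
      volume.withDensity fun x => ∏ j, complexDensity (x j) := by
    rw [complexGaussian_eq, pi_withDensity _ _ fun _ => measurable_complexDensity]; rfl
  have hm : Measurable fun x : μ → ℂ => ∏ j, complexDensity (x j) :=
    Finset.measurable_prod _ fun j _ => measurable_complexDensity.comp (measurable_pi_apply j)
  have : SigmaFinite ((volume : Measure (μ → ℂ)).withDensity
      fun x => ∏ j, complexDensity (x j)) := by rw [← h1]; infer_instance
  rw [gaussianMatrix, h1, pi_withDensity _ _ fun _ => hm]; rfl

/-- From `1 + x ≤ exp x` and `K x ≤ (K² + x²) / 2`. Half of the Gaussian exponent pays for the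
polynomial, the other half remains. -/
lemma one_add_pow_le_exp (K : ℕ) {x : ℝ} (hx : 0 ≤ x) :
    (1 + x) ^ K ≤ Real.exp (K ^ 2 / 2) * Real.exp (x ^ 2 / 2) := by
  calc (1 + x) ^ K ≤ Real.exp x ^ K := by
        gcongr; linarith [Real.add_one_le_exp x]
    _ = Real.exp (K * x) := by rw [← Real.exp_nat_mul]
    _ ≤ Real.exp (K ^ 2 / 2 + x ^ 2 / 2) := by
        gcongr; nlinarith [sq_nonneg ((K : ℝ) - x)]
    _ = _ := Real.exp_add _ _

lemma norm_sq_le_sum {ν μ : Type*} [Fintype ν] [Fintype μ] (H : ν → μ → ℂ) :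
    ‖H‖ ^ 2 ≤ ∑ i, ∑ j, ‖H i j‖ ^ 2 := by
  have h0 : 0 ≤ ∑ i, ∑ j, ‖H i j‖ ^ 2 :=
    Finset.sum_nonneg fun _ _ => Finset.sum_nonneg fun _ _ => sq_nonneg _
  have h : ‖H‖ ≤ √(∑ i, ∑ j, ‖H i j‖ ^ 2) := by
    refine (pi_norm_le_iff_of_nonneg (Real.sqrt_nonneg _)).2 fun i =>
      (pi_norm_le_iff_of_nonneg (Real.sqrt_nonneg _)).2 fun j => Real.le_sqrt_of_sq_le ?_
    exact (Finset.single_le_sum (f := fun j => ‖H i j‖ ^ 2) (fun _ _ => sq_nonneg _)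
      (Finset.mem_univ j)).trans (Finset.single_le_sum (f := fun i => ∑ j, ‖H i j‖ ^ 2)
      (fun _ _ => Finset.sum_nonneg fun _ _ => sq_nonneg _) (Finset.mem_univ i))
  calc ‖H‖ ^ 2 ≤ √(∑ i, ∑ j, ‖H i j‖ ^ 2) ^ 2 := by gcongr
    _ = _ := Real.sq_sqrt h0

/-- A polynomial factor is absorbed by the Gaussian density. -/
lemma lintegral_pow_mul_gaussianMatrix_le (ν μ : Type*) [Fintype ν] [Fintype μ] (K : ℕ) :
    ∃ C : ℝ≥0∞, C ≠ ∞ ∧ ∀ F : (ν → μ → ℂ) → ℝ≥0∞,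
      ∫⁻ H, ENNReal.ofReal ((1 + ‖H‖) ^ K) * F H ∂(gaussianMatrix ν μ) ≤
        C * ∫⁻ H, F H * ENNReal.ofReal (Real.exp (-(∑ i, ∑ j, ‖H i j‖ ^ 2) / 2)) := by
  set c : ℝ := (∏ _i : ν, ∏ _j : μ, Real.pi⁻¹) * Real.exp (K ^ 2 / 2) with hc
  have hc0 : 0 ≤ c := by positivity
  refine ⟨ENNReal.ofReal c, ENNReal.ofReal_ne_top, fun F => ?_⟩
  have hm : Measurable fun H : ν → μ → ℂ => ∏ i, ∏ j, complexDensity (H i j) :=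
    Finset.measurable_prod _ fun i _ => Finset.measurable_prod _ fun j _ =>
      measurable_complexDensity.comp ((measurable_pi_apply j).comp (measurable_pi_apply i))
  rw [gaussianMatrix_eq, ← lintegral_const_mul' _ _ ENNReal.ofReal_ne_top]
  -- Only this inequality is needed, and it holds without measurability of `F`.
  refine (lintegral_withDensity_le_lintegral_mul _ hm _).trans (lintegral_mono fun H => ?_)
  have hprod : ∏ i, ∏ j, complexDensity (H i j) = ENNReal.ofReal
      ((∏ _i : ν, ∏ _j : μ, Real.pi⁻¹) * Real.exp (-∑ i, ∑ j, ‖H i j‖ ^ 2)) := by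
    simp only [complexDensity]
    rw [← Finset.sum_neg_distrib, Real.exp_sum, ← Finset.prod_mul_distrib,
      ENNReal.ofReal_prod_of_nonneg fun _ _ => by positivity]
    refine Finset.prod_congr rfl fun i _ => ?_
    rw [← Finset.sum_neg_distrib, Real.exp_sum, ← Finset.prod_mul_distrib,
      ENNReal.ofReal_prod_of_nonneg fun _ _ => by positivity]
  simp only [Pi.mul_apply]
  rw [hprod, ← mul_assoc, mul_comm (F H), ← mul_assoc]
  refine mul_le_mul_left ?_ (F H)
  rw [← ENNReal.ofReal_mul (by positivity), ← ENNReal.ofReal_mul hc0]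
  refine ENNReal.ofReal_le_ofReal ?_
  set s := ∑ i, ∑ j, ‖H i j‖ ^ 2 with hs
  have h1 : (1 + ‖H‖) ^ K ≤ Real.exp (K ^ 2 / 2) * Real.exp (s / 2) := by
    refine (one_add_pow_le_exp K (norm_nonneg H)).trans ?_
    have := norm_sq_le_sum H
    gcongr
  calc _ ≤ (∏ _i : ν, ∏ _j : μ, Real.pi⁻¹) * Real.exp (-s) *
        (Real.exp (K ^ 2 / 2) * Real.exp (s / 2)) := by gcongr
    _ = c * (Real.exp (-s) * Real.exp (s / 2)) := by rw [hc]; ring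
    _ = _ := by rw [← Real.exp_add]; congr 2; ring

/-! ### Negative moments of distances to subspaces -/

/-- In polar coordinates the radial integrand is `y ^ (dim - 1 - e) * exp (-b * y ^ 2)`, with a
nonnegative exponent since `e < dim`. -/
lemma lintegral_inv_norm_pow_lt_top {E : Type*} [NormedAddCommGroup E] [NormedSpace ℝ E]
    [FiniteDimensional ℝ E] [MeasurableSpace E] [BorelSpace E] (μ : Measure E)
    [μ.IsAddHaarMeasure] {e : ℕ} (he : e < Module.finrank ℝ E) {b : ℝ} (hb : 0 < b) :
    ∫⁻ x, (ENNReal.ofReal ‖x‖)⁻¹ ^ e * ENNReal.ofReal (Real.exp (-b * ‖x‖ ^ 2)) ∂μ < ∞ := by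
  have hnt : Nontrivial E := Module.nontrivial_of_finrank_pos (R := ℝ) (by omega)
  let φ : ℝ → ℝ := fun y => (y ^ e)⁻¹ * Real.exp (-b * y ^ 2)
  have hint : Integrable (fun x : E => φ ‖x‖) μ := by
    rw [integrable_fun_norm_addHaar]
    have h := integrableOn_rpow_mul_exp_neg_mul_sq hb
      (s := ((Module.finrank ℝ E - 1 - e : ℕ) : ℝ)) (by
        have : (0 : ℝ) ≤ ((Module.finrank ℝ E - 1 - e : ℕ) : ℝ) := Nat.cast_nonneg _
        linarith)
    refine h.congr_fun (fun y hy => ?_) measurableSet_Ioi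
    have hy0 : (y : ℝ) ≠ 0 := (Set.mem_Ioi.1 hy).ne'
    simp only [φ, smul_eq_mul, Real.rpow_natCast]
    have : Module.finrank ℝ E - 1 = (Module.finrank ℝ E - 1 - e) + e := by omega
    rw [this, pow_add, Nat.add_sub_cancel]
    field_simp
  have hae : ∀ᵐ x ∂μ, x ≠ 0 := by
    rw [ae_iff]; simp
  have hcongr : ∀ᵐ x ∂μ, (ENNReal.ofReal ‖x‖)⁻¹ ^ e * ENNReal.ofReal (Real.exp (-b * ‖x‖ ^ 2)) =
      ENNReal.ofReal (φ ‖x‖) := by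
    filter_upwards [hae] with x hx
    have hx' : 0 < ‖x‖ := norm_pos_iff.2 hx
    rw [← ENNReal.inv_pow, ← ENNReal.ofReal_pow hx'.le, ← ENNReal.ofReal_inv_of_pos (by positivity),
      ← ENNReal.ofReal_mul (by positivity)]
  rw [lintegral_congr_ae hcongr]
  exact hint.lintegral_lt_top

lemma lintegral_exp_norm_lt_top {E : Type*} [NormedAddCommGroup E] [NormedSpace ℝ E]
    [FiniteDimensional ℝ E] [MeasurableSpace E] [BorelSpace E] (μ : Measure E)
    [μ.IsAddHaarMeasure] {b : ℝ} (hb : 0 < b) :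
    ∫⁻ x, ENNReal.ofReal (Real.exp (-b * ‖x‖ ^ 2)) ∂μ < ∞ := by
  rcases Nat.eq_zero_or_pos (Module.finrank ℝ E) with h | h
  -- In dimension `0` the previous lemma does not apply even with exponent `0`; the space is a point
  -- of finite mass.
  · have : Subsingleton E := Module.finrank_zero_iff.1 h
    have h1 : ∀ x : E, ENNReal.ofReal (Real.exp (-b * ‖x‖ ^ 2)) = 1 := fun x => by
      rw [Subsingleton.elim x 0]; simp
    simp_rw [h1]
    rw [lintegral_one]
    exact (Set.finite_univ.isCompact).measure_lt_top
  · simpa using lintegral_inv_norm_pow_lt_top μ h hb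

/-- The coordinates from `a` on, and the coordinates before `a`. -/
def splitCoord (n a : ℕ) : EuclideanSpace ℂ (Fin n) ≃ₗ[ℝ]
    ({i : Fin n // a ≤ i} → ℂ) × ({i : Fin n // ¬ a ≤ i} → ℂ) where
  toFun x := (fun i => x i, fun i => x i)
  invFun y := WithLp.toLp 2 fun i => if h : a ≤ i then y.1 ⟨i, h⟩ else y.2 ⟨i, h⟩
  map_add' _ _ := rfl
  map_smul' _ _ := rfl
  left_inv x := by
    ext i
    by_cases h : a ≤ (i : ℕ) <;> simp [h]
  right_inv y := by
    ext ⟨i, h⟩ <;> simp [h]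

/-- The coordinates from `a` on have real dimension `2 * (n - a)`, one more than the exponent; the
other coordinates only see the Gaussian factor. -/
lemma lintegral_inv_norm_split_lt_top {n a : ℕ} (ha : a < n) :
    ∫⁻ x : EuclideanSpace ℂ (Fin n), (ENNReal.ofReal ‖(splitCoord n a x).1‖)⁻¹ ^
      (2 * (n - 1 - a) + 1) * ENNReal.ofReal (Real.exp (-‖x‖ ^ 2 / 2)) < ∞ := by
  set L := (splitCoord n a).toContinuousLinearEquiv with hL
  set e := 2 * (n - 1 - a) + 1 with he
  have hfin : e < Module.finrank ℝ ({i : Fin n // a ≤ i} → ℂ) := by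
    rw [Module.finrank_pi_fintype]
    simp only [Complex.finrank_real_complex, Finset.sum_const, smul_eq_mul, Finset.card_univ]
    have : Fintype.card {i : Fin n // a ≤ i} = n - a := by
      rw [Fintype.card_subtype]
      have h : (Finset.univ.filter fun i : Fin n => a ≤ i) = Finset.Ici ⟨a, ha⟩ := by
        ext i; simp [Fin.le_def]
      rw [h, Fin.card_Ici]
    rw [this]; omega
  -- Both sup norms are at most `‖x‖`, so `exp (-‖x‖² / 2)` splits into two factors with constant `1
  -- / 4`, without comparing the sum of squares with `‖x‖²`.
  let φ : ({i : Fin n // a ≤ i} → ℂ) → ℝ≥0∞ := fun y =>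
    (ENNReal.ofReal ‖y‖)⁻¹ ^ e * ENNReal.ofReal (Real.exp (-(1 / 4) * ‖y‖ ^ 2))
  let ψ : ({i : Fin n // ¬ a ≤ i} → ℂ) → ℝ≥0∞ := fun y =>
    ENNReal.ofReal (Real.exp (-(1 / 4) * ‖y‖ ^ 2))
  have hφ : Measurable φ := by fun_prop
  have hψ : Measurable ψ := by fun_prop
  have hpt : ∀ x : EuclideanSpace ℂ (Fin n),
      (ENNReal.ofReal ‖(splitCoord n a x).1‖)⁻¹ ^ e * ENNReal.ofReal (Real.exp (-‖x‖ ^ 2 / 2)) ≤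
        (fun z : _ × _ => φ z.1 * ψ z.2) (L x) := by
    intro x
    have h1 : ‖(splitCoord n a x).1‖ ≤ ‖x‖ :=
      (pi_norm_le_iff_of_nonneg (norm_nonneg _)).2 fun i => PiLp.norm_apply_le x i
    have h2 : ‖(splitCoord n a x).2‖ ≤ ‖x‖ :=
      (pi_norm_le_iff_of_nonneg (norm_nonneg _)).2 fun i => PiLp.norm_apply_le x i
    change _ ≤ φ (splitCoord n a x).1 * ψ (splitCoord n a x).2
    simp only [φ, ψ]
    rw [mul_assoc, ← ENNReal.ofReal_mul (by positivity), ← Real.exp_add]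
    refine mul_le_mul_right (ENNReal.ofReal_le_ofReal (Real.exp_le_exp.2 ?_)) _
    nlinarith [mul_self_le_mul_self (norm_nonneg _) h1, mul_self_le_mul_self (norm_nonneg _) h2]
  refine (lintegral_mono hpt).trans_lt ?_
  have : (volume : Measure (({i : Fin n // a ≤ i} → ℂ) ×
      ({i : Fin n // ¬ a ≤ i} → ℂ))).IsAddHaarMeasure := Measure.prod.instIsAddHaarMeasure _ _
  -- By uniqueness of Haar measure `L` changes volume by a finite constant, whose value is
  -- irrelevant.
  have hmap : Measure.map L (volume : Measure (EuclideanSpace ℂ (Fin n))) =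
      (Measure.map L volume).addHaarScalarFactor volume • volume :=
    Measure.isAddLeftInvariant_eq_smul _ _
  have := lintegral_map_equiv (μ := (volume : Measure (EuclideanSpace ℂ (Fin n))))
    (fun z : _ × _ => φ z.1 * ψ z.2) L.toHomeomorph.toMeasurableEquiv
  change _ = ∫⁻ x, (fun z : _ × _ => φ z.1 * ψ z.2) (L x) at this
  rw [← this]
  change ∫⁻ z, φ z.1 * ψ z.2 ∂(Measure.map L volume) < ∞
  have hprod : ∫⁻ z, φ z.1 * ψ z.2 ∂(volume : Measure (({i : Fin n // a ≤ i} → ℂ) ×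
      ({i : Fin n // ¬ a ≤ i} → ℂ))) < ∞ := by
    rw [Measure.volume_eq_prod, lintegral_prod_mul hφ.aemeasurable hψ.aemeasurable]
    exact ENNReal.mul_lt_top (lintegral_inv_norm_pow_lt_top _ hfin (by norm_num))
      (lintegral_exp_norm_lt_top _ (by norm_num))
  rw [hmap, lintegral_smul_measure]
  exact ENNReal.mul_lt_top ENNReal.coe_lt_top hprod

/-- An orthonormal basis whose members from `a` on are orthogonal to a given subspace of dimension
at most `a`. -/
lemma exists_orthonormalBasis_orthogonal {n a : ℕ} (U : Submodule ℂ (EuclideanSpace ℂ (Fin n)))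
    (hU : Module.finrank ℂ U ≤ a) :
    ∃ b : OrthonormalBasis (Fin n) ℂ (EuclideanSpace ℂ (Fin n)),
      ∀ i : Fin n, a ≤ i → ∀ u ∈ U, inner ℂ (b i) u = 0 := by
  classical
  set k := Module.finrank ℂ U with hk
  let s := stdOrthonormalBasis ℂ U
  -- Only the first `k` entries matter: they are a basis of `U`, and the extension to an orthonormal
  -- basis ignores the zeros.
  let v : Fin n → EuclideanSpace ℂ (Fin n) := fun i => if h : (i : ℕ) < k then s ⟨i, h⟩ else 0
  have hv : ∀ (i : Fin n) (h : (i : ℕ) < k), v i = s ⟨i, h⟩ := fun i h => by simp [v, h]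
  have horth : Orthonormal ℂ (({i : Fin n | (i : ℕ) < k} : Set (Fin n)).domRestrict v) := by
    have h1 : Orthonormal ℂ fun j : Fin k => (s j : EuclideanSpace ℂ (Fin n)) :=
      s.orthonormal.comp_linearIsometry U.subtypeₗᵢ
    have h2 := h1.comp (fun i : {i : Fin n | (i : ℕ) < k} => (⟨i.1, i.2⟩ : Fin k))
      fun i j hij => by
        ext; simpa using hij
    convert h2 using 1
    funext i
    exact hv i.1 i.2
  obtain ⟨b, hb⟩ := horth.exists_orthonormalBasis_extension_of_card_eq (by simp)
  refine ⟨b, fun i hi u hu => ?_⟩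
  have hkn : k ≤ n := by
    have := Submodule.finrank_le U
    simpa using this
  have hsum : u = ∑ j : Fin k, s.repr ⟨u, hu⟩ j • (s j : EuclideanSpace ℂ (Fin n)) := by
    have := congrArg Subtype.val (s.sum_repr ⟨u, hu⟩)
    simpa using this.symm
  rw [hsum, inner_sum]
  refine Finset.sum_eq_zero fun j _ => ?_
  have hj : b ⟨j, j.2.trans_le hkn⟩ = s j := by
    rw [hb _ (by exact j.2), hv _ (by exact j.2)]
  rw [inner_smul_right, ← hj, b.orthonormal.2, mul_zero]
  intro h
  have := congrArg Fin.val h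
  have := j.2
  simp at *
  omega

/-- The negative moments of the distance to a subspace of dimension at most `a` are bounded
uniformly in the subspace. -/
lemma exists_lintegral_inv_infDist_le {n a : ℕ} (ha : a < n) :
    ∃ C : ℝ≥0∞, C < ∞ ∧ ∀ U : Submodule ℂ (EuclideanSpace ℂ (Fin n)), Module.finrank ℂ U ≤ a →
      ∫⁻ x : EuclideanSpace ℂ (Fin n), (ENNReal.ofReal (Metric.infDist x U))⁻¹ ^
        (2 * (n - 1 - a) + 1) * ENNReal.ofReal (Real.exp (-‖x‖ ^ 2 / 2)) ≤ C := by
  refine ⟨_, lintegral_inv_norm_split_lt_top ha, fun U hU => ?_⟩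
  obtain ⟨b, hb⟩ := exists_orthonormalBasis_orthogonal U hU
  -- The rotation to the basis `b` preserves volume and norm. The coordinates from `a` on do not
  -- change when a vector of `U` is subtracted, so their sup norm bounds the distance to `U` from
  -- below, uniformly in `U`.
  let Q : EuclideanSpace ℂ (Fin n) ≃ₗᵢ[ℝ] EuclideanSpace ℂ (Fin n) :=
    ⟨b.repr.toLinearEquiv.restrictScalars ℝ, b.repr.norm_map⟩
  have hQ : ∀ x i, Q x i = inner ℂ (b i) x := fun x i => b.repr_apply_apply x i
  refine (lintegral_mono fun x => ?_).trans_eq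
    (Q.measurePreserving.lintegral_comp_emb Q.toMeasurableEquiv.measurableEmbedding _)
  rw [Q.norm_map]
  refine mul_le_mul_left (pow_le_pow_left' (ENNReal.inv_le_inv.2 (ENNReal.ofReal_le_ofReal ?_)) _) _
  have hne : (U : Set (EuclideanSpace ℂ (Fin n))).Nonempty := ⟨0, U.zero_mem⟩
  refine (Metric.le_infDist hne).2 fun u hu => ?_
  refine (pi_norm_le_iff_of_nonneg dist_nonneg).2 fun i => ?_
  change ‖Q x i‖ ≤ _
  have h1 : Q x i = inner ℂ (b i) (x - u) := by
    rw [hQ, inner_sub_right, hb i i.2 u hu, sub_zero]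
  rw [h1, dist_eq_norm]
  refine (norm_inner_le_norm (𝕜 := ℂ) (b i) (x - u)).trans_eq ?_
  rw [b.norm_eq_one, one_mul]

/-! ### The distances of successive Gaussian vectors -/

/-- The distance of the vector `h a` to the span of the preceding vectors. -/
def columnDist {n p : ℕ} (h : Fin p → EuclideanSpace ℂ (Fin n)) (a : Fin p) : ℝ :=
  Metric.infDist (h a) (Submodule.span ℂ (h '' Set.Iio a))

/-- The product of negative powers of the distances of the vectors `h a` to the span of the
preceding vectors. -/
def columnWeight {n p : ℕ} (h : Fin p → EuclideanSpace ℂ (Fin n)) : ℝ≥0∞ :=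
  ∏ a : Fin p, if (a : ℕ) < n then
    (ENNReal.ofReal (columnDist h a))⁻¹ ^ (2 * (n - 1 - a) + 1) else 1

/-- The distance is not continuous where the span drops in dimension, but it is below `r` iff some
finite combination of the preceding vectors is closer than `r`, which is a union of open conditions.
-/
lemma measurable_columnDist {n p : ℕ} (a : Fin p) :
    Measurable fun h : Fin p → EuclideanSpace ℂ (Fin n) => columnDist h a := by
  refine measurable_of_Iio fun r => IsOpen.measurableSet ?_
  have : (fun h : Fin p → EuclideanSpace ℂ (Fin n) => columnDist h a) ⁻¹' Set.Iio r =
      ⋃ (t : Finset (Fin p)) (_ : (t : Set (Fin p)) ⊆ Set.Iio a) (c : t → ℂ),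
        {h | dist (h a) (∑ i, c i • h i) < r} := by
    ext h
    simp only [Set.mem_preimage, Set.mem_Iio, Set.mem_iUnion, Set.mem_ofPred_eq, columnDist]
    rw [Metric.infDist_lt_iff ⟨0, Submodule.zero_mem _⟩]
    constructor
    · rintro ⟨y, hy, hr⟩
      obtain ⟨t, ht, c, rfl⟩ := Submodule.mem_span_image_iff_exists_fun ℂ |>.1 hy
      exact ⟨t, ht, c, hr⟩
    · rintro ⟨t, ht, c, hr⟩
      exact ⟨_, (Submodule.mem_span_image_iff_exists_fun ℂ).2 ⟨t, ht, c, rfl⟩, hr⟩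
  rw [this]
  refine isOpen_iUnion fun t => isOpen_iUnion fun _ => isOpen_iUnion fun c => ?_
  exact isOpen_lt (by fun_prop) continuous_const

lemma measurable_columnWeight {n p : ℕ} :
    Measurable (columnWeight : (Fin p → EuclideanSpace ℂ (Fin n)) → ℝ≥0∞) := by
  refine Finset.measurable_prod _ fun a _ => ?_
  split_ifs
  · exact (measurable_columnDist a).ennreal_ofReal.inv.pow_const _
  · exact measurable_const

/-- A vector appended at the end does not enter the earlier spans, so it adds a single factor. This
is the induction step of the integration below. -/
lemma columnWeight_insertNth {n p : ℕ} (x : EuclideanSpace ℂ (Fin n))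
    (h : Fin p → EuclideanSpace ℂ (Fin n)) :
    columnWeight ((Fin.last p).insertNth x h : Fin (p + 1) → EuclideanSpace ℂ (Fin n)) =
      columnWeight h * if p < n then (ENNReal.ofReal
        (Metric.infDist x (Submodule.span ℂ (Set.range h))))⁻¹ ^ (2 * (n - 1 - p) + 1) else 1 := by
  set h' : Fin (p + 1) → EuclideanSpace ℂ (Fin n) := (Fin.last p).insertNth x h with hh'
  have h1 : ∀ a : Fin p, h' a.castSucc = h a := fun a => by
    rw [hh', ← Fin.succAbove_last, Fin.insertNth_apply_succAbove]
  have h2 : h' (Fin.last p) = x := Fin.insertNth_apply_same _ _ _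
  have h3 : ∀ a : Fin p, h' '' Set.Iio a.castSucc = h '' Set.Iio a := by
    intro a
    ext v
    constructor
    · rintro ⟨b, hb, rfl⟩
      obtain ⟨b, rfl⟩ := Fin.exists_castSucc_eq.2 (ne_of_lt (lt_of_lt_of_le hb (Fin.le_last _)))
      exact ⟨b, Fin.castSucc_lt_castSucc_iff.1 hb, (h1 b).symm⟩
    · rintro ⟨b, hb, rfl⟩
      exact ⟨b.castSucc, Fin.castSucc_lt_castSucc_iff.2 hb, h1 b⟩
  have h4 : h' '' Set.Iio (Fin.last p) = Set.range h := by
    ext v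
    constructor
    · rintro ⟨b, hb, rfl⟩
      obtain ⟨b, rfl⟩ := Fin.exists_castSucc_eq.2 (ne_of_lt hb)
      exact ⟨b, (h1 b).symm⟩
    · rintro ⟨b, rfl⟩
      exact ⟨b.castSucc, Fin.castSucc_lt_last b, h1 b⟩
  unfold columnWeight columnDist
  rw [Fin.prod_univ_castSucc]
  simp only [h1, h2, h3, h4, Fin.val_castSucc, Fin.val_last]

/-- The last vector is integrated first. Its predecessors span at most `p` dimensions, and the bound
on the inner integral is uniform in that span, so no independence of the distances is needed. -/
lemma lintegral_columnWeight_lt_top (n p : ℕ) :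
    ∫⁻ h : Fin p → EuclideanSpace ℂ (Fin n),
      columnWeight h * ∏ a, ENNReal.ofReal (Real.exp (-‖h a‖ ^ 2 / 2)) < ∞ := by
  induction p with
  | zero => simp [columnWeight, lintegral_const, volume_pi]
  | succ p ih =>
    let V := EuclideanSpace ℂ (Fin n)
    obtain ⟨C, hC, hbound⟩ : ∃ C : ℝ≥0∞, C < ∞ ∧ ∀ h : Fin p → V,
        ∫⁻ x : V, (if p < n then (ENNReal.ofReal
          (Metric.infDist x (Submodule.span ℂ (Set.range h))))⁻¹ ^ (2 * (n - 1 - p) + 1) else 1) *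
          ENNReal.ofReal (Real.exp (-‖x‖ ^ 2 / 2)) ≤ C := by
      by_cases hp : p < n
      · obtain ⟨C, hC, hb⟩ := exists_lintegral_inv_infDist_le hp
        refine ⟨C, hC, fun h => ?_⟩
        simp only [if_pos hp]
        refine hb _ ?_
        exact (finrank_range_le_card (R := ℂ) h).trans_eq (Fintype.card_fin p)
      · refine ⟨_, lintegral_exp_norm_lt_top (volume : Measure V) (b := 1 / 2) (by norm_num),
          fun h => lintegral_mono fun x => ?_⟩
        simp only [if_neg hp, one_mul]
        refine (congrArg (fun t => ENNReal.ofReal (Real.exp t)) ?_).le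
        ring
    -- Split off the last vector and swap, so that it becomes the inner variable.
    rw [MeasurePreserving.lintegral_map_equiv _ _
      (volume_preserving_piFinSuccAbove (fun _ => V) (Fin.last p)).symm,
      Measure.volume_eq_prod, MeasurePreserving.lintegral_map_equiv _ MeasurableEquiv.prodComm
        (Measure.measurePreserving_swap (μ := (volume : Measure (Fin p → V))) (ν := volume))]
    refine (lintegral_prod_le _).trans_lt ?_
    have hinner : ∀ h : Fin p → V, ∫⁻ x : V, columnWeight
        ((MeasurableEquiv.piFinSuccAbove (fun _ => V) (Fin.last p)).symm
          (MeasurableEquiv.prodComm (h, x))) *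
        ∏ a, ENNReal.ofReal (Real.exp (-‖(MeasurableEquiv.piFinSuccAbove (fun _ => V)
          (Fin.last p)).symm (MeasurableEquiv.prodComm (h, x)) a‖ ^ 2 / 2)) ≤
        (columnWeight h * ∏ a, ENNReal.ofReal (Real.exp (-‖h a‖ ^ 2 / 2))) * C := by
      intro h
      have hpt : ∀ x : V, columnWeight
          ((MeasurableEquiv.piFinSuccAbove (fun _ => V) (Fin.last p)).symm
            (MeasurableEquiv.prodComm (h, x))) *
          ∏ a, ENNReal.ofReal (Real.exp (-‖(MeasurableEquiv.piFinSuccAbove (fun _ => V)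
            (Fin.last p)).symm (MeasurableEquiv.prodComm (h, x)) a‖ ^ 2 / 2)) =
          (columnWeight h * ∏ a, ENNReal.ofReal (Real.exp (-‖h a‖ ^ 2 / 2))) *
          ((if p < n then (ENNReal.ofReal
            (Metric.infDist x (Submodule.span ℂ (Set.range h))))⁻¹ ^ (2 * (n - 1 - p) + 1)
            else 1) * ENNReal.ofReal (Real.exp (-‖x‖ ^ 2 / 2))) := by
        intro x
        have h0 : (MeasurableEquiv.piFinSuccAbove (fun _ => V) (Fin.last p)).symm
            (MeasurableEquiv.prodComm (h, x)) =
            ((Fin.last p).insertNth x h : Fin (p + 1) → V) := rfl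
        rw [h0, columnWeight_insertNth, Fin.prod_univ_castSucc]
        have h1 : ∀ a : Fin p, ((Fin.last p).insertNth x h : Fin (p + 1) → V) a.castSucc = h a :=
          fun a => by rw [← Fin.succAbove_last, Fin.insertNth_apply_succAbove]
        have h2 : ((Fin.last p).insertNth x h : Fin (p + 1) → V) (Fin.last p) = x :=
          Fin.insertNth_apply_same _ _ _
        simp only [h1, h2]
        ring
      rw [lintegral_congr hpt, lintegral_const_mul]
      · exact mul_le_mul_right (hbound h) _
      · refine Measurable.mul ?_ (by fun_prop)
        split_ifs
        · exact (Metric.continuous_infDist_pt _).measurable.ennreal_ofReal.inv.pow_const _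
        · exact measurable_const
    refine (lintegral_mono hinner).trans_lt ?_
    rw [lintegral_mul_const' _ _ hC.ne]
    exact ENNReal.mul_lt_top ih hC

/-! ### The columns of the channel blocks -/

/-- The vectors in `ℂ ^ n` of which the blocks of the channel matrix consist. -/
def blockColumns {n g M : ℕ} :
    (Antenna n g → Fin M → ℂ) ≃ₗ[ℝ]
      (Fin g → Fin (blockSize g * M) → EuclideanSpace ℂ (Fin n)) where
  toFun H j a := WithLp.toLp 2 fun α =>
    H ((α, (finProdFinEquiv.symm a).1), j) (finProdFinEquiv.symm a).2
  invFun h i μ := h i.2 (finProdFinEquiv (i.1.2, μ)) i.1.1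
  map_add' _ _ := rfl
  map_smul' _ _ := rfl
  left_inv H := by
    funext ⟨⟨α, β⟩, j⟩ μ
    simp
  right_inv h := by
    funext j a
    ext α
    simp [-finProdFinEquiv_symm_apply]

lemma sum_norm_blockColumns {n g M : ℕ} (H : Antenna n g → Fin M → ℂ) :
    ∑ j, ∑ a, ‖blockColumns H j a‖ ^ 2 = ∑ i, ∑ μ, ‖H i μ‖ ^ 2 := by
  simp only [EuclideanSpace.norm_sq_eq]
  rw [Fintype.sum_prod_type_right]
  refine Finset.sum_congr rfl fun j _ => ?_
  rw [← finProdFinEquiv.sum_comp, Fintype.sum_prod_type, Fintype.sum_prod_type_right]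
  refine Finset.sum_congr rfl fun β _ => ?_
  rw [Finset.sum_comm]
  refine Finset.sum_congr rfl fun α _ => Finset.sum_congr rfl fun μ _ => ?_
  change ‖H ((α, (finProdFinEquiv.symm (finProdFinEquiv (β, μ))).1), j)
    (finProdFinEquiv.symm (finProdFinEquiv (β, μ))).2‖ ^ 2 = _
  rw [Equiv.symm_apply_apply]

/-- The reciprocal of the minor of the channel of group `k` that controls the complexity. -/
def channelWeight {n g M : ℕ} (hp : 0 < blockSize g * M) (k : Fin g)
    (H : Antenna n g → Fin M → ℂ) : ℝ≥0∞ :=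
  ∏ j, if j = k then columnWeight (blockColumns H j)
    else (ENNReal.ofReal ‖blockColumns H j ⟨0, hp⟩‖)⁻¹

lemma measurable_channelWeight {n g M : ℕ} (hp : 0 < blockSize g * M) (k : Fin g) :
    Measurable (channelWeight hp k : (Antenna n g → Fin M → ℂ) → ℝ≥0∞) := by
  have hL : Measurable (blockColumns : (Antenna n g → Fin M → ℂ) ≃ₗ[ℝ] _) :=
    (LinearMap.continuous_of_finiteDimensional blockColumns.toLinearMap).measurable
  refine Finset.measurable_prod _ fun j _ => ?_
  split_ifs
  · exact measurable_columnWeight.comp ((measurable_pi_apply j).comp hL)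
  · exact (((measurable_pi_apply (⟨0, hp⟩ : Fin (blockSize g * M))).comp
      ((measurable_pi_apply j).comp hL)).norm.ennreal_ofReal).inv

/-- Once the polynomial is absorbed, weight and density are a product over the `g` blocks. Block `k`
is the iterated distance integral; any other block has one factor `1 / ‖h‖`, with `h` of real
dimension `2 * n > 1`. -/
lemma lintegral_channelWeight_lt_top {n g M : ℕ} (hn : 1 ≤ n) (hp : 0 < blockSize g * M)
    (k : Fin g) (K : ℕ) :
    ∫⁻ H, ENNReal.ofReal ((1 + ‖H‖) ^ K) * channelWeight hp k H
      ∂(gaussianMatrix (Antenna n g) (Fin M)) < ∞ := by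
  obtain ⟨C, hC, hle⟩ := lintegral_pow_mul_gaussianMatrix_le (Antenna n g) (Fin M) K
  refine (hle _).trans_lt (ENNReal.mul_lt_top hC.lt_top ?_)
  let V := EuclideanSpace ℂ (Fin n)
  let Λ : Fin g → (Fin (blockSize g * M) → V) → ℝ≥0∞ := fun j h =>
    (if j = k then columnWeight h else (ENNReal.ofReal ‖h ⟨0, hp⟩‖)⁻¹) *
      ∏ a, ENNReal.ofReal (Real.exp (-‖h a‖ ^ 2 / 2))
  have hexp : Measurable fun h : Fin (blockSize g * M) → V =>
      ∏ a, ENNReal.ofReal (Real.exp (-‖h a‖ ^ 2 / 2)) := by fun_prop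
  have hΛm : ∀ j, Measurable (Λ j) := by
    intro j
    refine Measurable.mul ?_ hexp
    split_ifs
    · exact measurable_columnWeight
    · fun_prop
  have hΛ : ∀ j, ∫⁻ h, Λ j h < ∞ := by
    intro j
    by_cases hj : j = k
    · simp only [Λ, if_pos hj]
      exact lintegral_columnWeight_lt_top _ _
    · simp only [Λ, if_neg hj]
      -- The exponent is `1` at the one vector tested in this block and `0` at the others.
      let F : Fin (blockSize g * M) → V → ℝ≥0∞ := fun a x =>
        (ENNReal.ofReal ‖x‖)⁻¹ ^ (if a = ⟨0, hp⟩ then 1 else 0) *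
          ENNReal.ofReal (Real.exp (-(1 / 2) * ‖x‖ ^ 2))
      have hF : ∀ h : Fin (blockSize g * M) → V, (ENNReal.ofReal ‖h ⟨0, hp⟩‖)⁻¹ *
          ∏ a, ENNReal.ofReal (Real.exp (-‖h a‖ ^ 2 / 2)) = ∏ a, F a (h a) := by
        intro h
        simp only [F]
        rw [Finset.prod_mul_distrib]
        congr 1
        · rw [Finset.prod_eq_single ⟨0, hp⟩]
          · simp
          · intro b _ hb; simp [hb]
          · simp
        · refine Finset.prod_congr rfl fun a _ => ?_
          congr 2; ring
      rw [lintegral_congr hF, volume_pi, lintegral_fintype_prod_eq_prod _ F fun a => by fun_prop]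
      refine ENNReal.prod_lt_top fun a _ => lintegral_inv_norm_pow_lt_top _ ?_ (by norm_num)
      rw [finrank_real_of_complex, finrank_euclideanSpace, Fintype.card_fin]
      split_ifs <;> omega
  let L := (blockColumns (n := n) (g := g) (M := M)).toContinuousLinearEquiv
  have hpt : ∀ H : Antenna n g → Fin M → ℂ, channelWeight hp k H *
      ENNReal.ofReal (Real.exp (-(∑ i, ∑ j, ‖H i j‖ ^ 2) / 2)) =
      (fun h => ∏ j, Λ j (h j)) (L H) := by
    intro H
    change _ = ∏ j, Λ j (blockColumns H j)
    simp only [Λ]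
    rw [Finset.prod_mul_distrib]
    congr 1
    rw [← sum_norm_blockColumns, neg_div, Finset.sum_div, ← Finset.sum_neg_distrib, Real.exp_sum,
      ENNReal.ofReal_prod_of_nonneg fun _ _ => by positivity]
    refine Finset.prod_congr rfl fun j _ => ?_
    rw [Finset.sum_div, ← Finset.sum_neg_distrib, Real.exp_sum,
      ENNReal.ofReal_prod_of_nonneg fun _ _ => by positivity]
    simp only [neg_div]
  have : (volume : Measure (Antenna n g → Fin M → ℂ)).IsAddHaarMeasure :=
    Measure.pi.isAddHaarMeasure _
  have : (volume : Measure (Fin (blockSize g * M) → EuclideanSpace ℂ (Fin n))).IsAddHaarMeasure :=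
    Measure.pi.isAddHaarMeasure fun _ => volume
  let ν : Measure (Fin g → Fin (blockSize g * M) → EuclideanSpace ℂ (Fin n)) :=
    Measure.pi fun _ => volume
  have : ν.IsAddHaarMeasure := Measure.pi.isAddHaarMeasure fun _ => volume
  have : (Measure.map L (volume : Measure (Antenna n g → Fin M → ℂ))).IsAddHaarMeasure :=
    L.isAddHaarMeasure_map volume
  have hmap : Measure.map L (volume : Measure (Antenna n g → Fin M → ℂ)) =
      (Measure.map L volume).addHaarScalarFactor ν • ν :=
    Measure.isAddLeftInvariant_eq_smul _ _
  have := lintegral_map_equiv (μ := (volume : Measure (Antenna n g → Fin M → ℂ)))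
    (fun h => ∏ j, Λ j (h j)) L.toHomeomorph.toMeasurableEquiv
  change _ = ∫⁻ x, (fun h => ∏ j, Λ j (h j)) (L x) at this
  rw [lintegral_congr hpt, ← this]
  change ∫⁻ h, ∏ j, Λ j (h j) ∂(Measure.map L volume) < ∞
  rw [hmap, lintegral_smul_measure, lintegral_fintype_prod_eq_prod _ _ hΛm]
  exact ENNReal.mul_lt_top ENNReal.coe_lt_top (ENNReal.prod_lt_top fun j _ => hΛ j)

/-! ### Real vectors of complex matrices -/

section RealVec

variable {τ ν μ : Type*} [Fintype τ] [Fintype ν] [Fintype μ]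

/-- The real vector of a complex matrix, as an element of Euclidean space. -/
def realVecL : Matrix τ μ ℂ →ₗ[ℝ] EuclideanSpace ℝ ((μ × τ) ⊕ (μ × τ)) where
  toFun Y := WithLp.toLp 2 (realVec Y)
  map_add' Y Z := by
    ext r; rcases r with r | r <;> simp [realVec, Matrix.vec]
  map_smul' a Y := by
    ext r; rcases r with r | r <;> simp [realVec, Matrix.vec]

lemma inner_realVecL (Y Z : Matrix τ μ ℂ) :
    inner ℝ (realVecL Y) (realVecL Z) = (Yᴴ * Z).trace.re := by
  rw [PiLp.inner_apply, Fintype.sum_sum_type, ← Finset.sum_add_distrib, Fintype.sum_prod_type,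
    Matrix.trace, Complex.re_sum]
  refine Finset.sum_congr rfl fun j _ => ?_
  rw [Matrix.diag_apply, Matrix.mul_apply, Complex.re_sum]
  refine Finset.sum_congr rfl fun i _ => ?_
  simp [realVecL, realVec, Matrix.vec, mul_comm]

/-- The real inner product is symmetric, and its symmetrization is the trace of `Hᴴ (Aᴴ B + Bᴴ A)
H`. So Hurwitz-Radon orthogonality separates the groups for every channel. -/
lemma inner_realVecL_eq_zero {A B : Matrix τ ν ℂ} (h : Aᴴ * B + Bᴴ * A = 0) (H : Matrix ν μ ℂ) :
    inner ℝ (realVecL (A * H)) (realVecL (B * H)) = 0 := by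
  have h1 : inner ℝ (realVecL (A * H)) (realVecL (B * H)) +
      inner ℝ (realVecL (B * H)) (realVecL (A * H)) = 0 := by
    rw [inner_realVecL, inner_realVecL, ← Complex.add_re, ← Matrix.trace_add]
    have : (A * H)ᴴ * (B * H) + (B * H)ᴴ * (A * H) = Hᴴ * (Aᴴ * B + Bᴴ * A) * H := by
      simp only [Matrix.conjTranspose_mul, Matrix.mul_add, Matrix.add_mul, Matrix.mul_assoc]
    rw [this, h]; simp
  rw [real_inner_comm (realVecL (A * H))] at h1
  linarith

variable {g d : ℕ} (A : Fin g → Fin d → Matrix τ ν ℂ) (Θ : Fin g → Matrix (Fin d) (Fin d) ℝ)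
  (H : Matrix ν μ ℂ) (k : Fin g)

lemma groupColumns_eq (j : Fin d) :
    groupColumns A Θ H k j = realVecL ((∑ i, Θ k i j • A k i) * H) := by
  have : (∑ i, Θ k i j • A k i) * H = ∑ i, Θ k i j • (A k i * H) := by
    rw [Matrix.sum_mul]; simp
  rw [this, map_sum]
  ext r
  simp [groupColumns, Matrix.col, Matrix.mul_apply, equivChannel, realVecL]

lemma sum_smul_groupColumns (z : Fin d → ℝ) :
    ∑ j, z j • groupColumns A Θ H k j = realVecL ((∑ i, (Θ k *ᵥ z) i • A k i) * H) := by
  simp only [groupColumns_eq, ← map_smul, ← map_sum, ← Matrix.smul_mul, ← Matrix.sum_mul]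
  congr 2
  simp only [Finset.smul_sum, Matrix.mulVec, dotProduct, Finset.sum_smul]
  rw [Finset.sum_comm]
  refine Finset.sum_congr rfl fun i _ => Finset.sum_congr rfl fun j _ => ?_
  rw [smul_smul, mul_comm]

/-- Signal of group `k`, interference of the other groups, and noise: the form in which
`fullMetric_le` applies. -/
lemma realVec_received (s : Fin g → Fin d → ℤ) (W : Matrix τ μ ℂ) :
    (WithLp.toLp 2 (realVec (codeword A Θ s * H + W)) : EuclideanSpace ℝ _) =
      ∑ j, (s k j : ℝ) • groupColumns A Θ H k j +
      ∑ k' ∈ Finset.univ.erase k, ∑ j, (s k' j : ℝ) • groupColumns A Θ H k' j + realVecL W := by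
  rw [Finset.add_sum_erase _ (fun k' => ∑ j, (s k' j : ℝ) • groupColumns A Θ H k' j)
    (Finset.mem_univ k)]
  simp only [sum_smul_groupColumns, ← map_sum, ← Matrix.sum_mul, ← map_add]
  rfl

/-- If the weight matrices of different groups are Hurwitz-Radon orthogonal, the distance of the
transmitted symbols is at most the norm of the noise. -/
lemma fullMetric_received_le
    (hA : ∀ k k' i i', k ≠ k' → (A k i)ᴴ * A k' i' + (A k' i')ᴴ * A k i = 0)
    (s : Fin g → Fin d → ℤ) (W : Matrix τ μ ℂ) :
    fullMetric (groupColumns A Θ H k) (WithLp.toLp 2 (realVec (codeword A Θ s * H + W))) (s k) ≤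
      ‖(realVecL W : EuclideanSpace ℝ ((μ × τ) ⊕ (μ × τ)))‖ ^ 2 := by
  refine fullMetric_le _ (s k) (realVec_received A Θ H k s W) fun j => ?_
  rw [inner_sum]
  refine Finset.sum_eq_zero fun k' hk' => ?_
  rw [sum_smul_groupColumns, groupColumns_eq]
  refine inner_realVecL_eq_zero ?_ H
  have hne : k ≠ k' := (Finset.ne_of_mem_erase hk').symm
  simp only [Matrix.conjTranspose_sum, Matrix.conjTranspose_smul, Matrix.sum_mul, Matrix.mul_sum,
    Matrix.smul_mul, Matrix.mul_smul, star_trivial, Finset.smul_sum]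
  rw [Finset.sum_comm, ← Finset.sum_add_distrib]
  refine Finset.sum_eq_zero fun i _ => ?_
  rw [← Finset.sum_add_distrib]
  refine Finset.sum_eq_zero fun i' _ => ?_
  rw [smul_comm (Θ k _ j), ← smul_add, ← smul_add, hA _ _ _ _ hne]
  simp

/-- The rank of the channel submatrix of group `k` is the dimension of its column space, and
invertible `Θ` do not change it. -/
lemma span_groupColumns (hΘ : IsUnit (Θ k).det) :
    Submodule.span ℝ (Set.range (groupColumns A Θ H k)) =
      Submodule.span ℝ (Set.range fun i => realVecL (A k i * H)) := by
  have h1 : ∀ x : Fin d → ℝ, realVecL ((∑ i, x i • A k i) * H) =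
      ∑ i, x i • (realVecL (A k i * H) : EuclideanSpace ℝ ((μ × τ) ⊕ (μ × τ))) := by
    intro x
    rw [Matrix.sum_mul, map_sum]
    simp [Matrix.smul_mul]
  refine le_antisymm (Submodule.span_le.2 ?_) (Submodule.span_le.2 ?_)
  · rintro _ ⟨j, rfl⟩
    rw [groupColumns_eq, h1]
    exact Submodule.sum_mem _ fun i _ => Submodule.smul_mem _ _ (Submodule.subset_span ⟨i, rfl⟩)
  · rintro _ ⟨i, rfl⟩
    have h2 : realVecL (A k i * H) = ∑ j, ((Θ k)⁻¹ *ᵥ Pi.single i 1) j • groupColumns A Θ H k j := by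
      rw [sum_smul_groupColumns, Matrix.mulVec_mulVec, Matrix.mul_nonsing_inv _ hΘ,
        Matrix.one_mulVec, h1]
      rw [Finset.sum_eq_single i]
      · simp
      · intro j _ hj; simp [hj]
      · simp
    simp only [h2]
    exact Submodule.sum_mem _ fun j _ => Submodule.smul_mem _ _ (Submodule.subset_span ⟨j, rfl⟩)

lemma rank_equivChannel :
    (equivChannel (A k) H).rank = Module.finrank ℝ (Submodule.span ℝ
      (Set.range fun i => (realVecL (A k i * H) : EuclideanSpace ℝ ((μ × τ) ⊕ (μ × τ))))) := by
  rw [Matrix.rank_eq_finrank_span_cols]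
  let e : EuclideanSpace ℝ ((μ × τ) ⊕ (μ × τ)) ≃ₗ[ℝ] _ := WithLp.linearEquiv 2 ℝ _
  have : Submodule.span ℝ (Set.range (equivChannel (A k) H).col) =
      (Submodule.span ℝ (Set.range fun i => (realVecL (A k i * H) :
        EuclideanSpace ℝ ((μ × τ) ⊕ (μ × τ))))).map e.toLinearMap := by
    rw [Submodule.map_span, ← Set.range_comp]
    rfl
  rw [this, LinearEquiv.finrank_map_eq]

end RealVec

/-! ### Real coordinates of a group of weight matrices -/

/-- A real-linear parametrization of the Hermitian matrices by the real matrices. -/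
def hermOf {n : ℕ} : (Fin n → Fin n → ℝ) →ₗ[ℝ] Matrix (Fin n) (Fin n) ℂ where
  toFun R := Matrix.of fun a b =>
    (1 + Complex.I) / 2 * (R a b : ℂ) + (1 - Complex.I) / 2 * (R b a : ℂ)
  map_add' R R' := by ext a b; simp; ring
  map_smul' c R := by ext a b; simp; ring

lemma hermOf_apply {n : ℕ} (R : Fin n → Fin n → ℝ) (a b : Fin n) : hermOf R a b =
    (1 + Complex.I) / 2 * (R a b : ℂ) + (1 - Complex.I) / 2 * (R b a : ℂ) := rfl

lemma isHermitian_hermOf {n : ℕ} (R : Fin n → Fin n → ℝ) : (hermOf R).IsHermitian := by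
  ext a b
  simp only [Matrix.conjTranspose_apply, hermOf_apply, star_add, star_mul', star_div₀, star_sub,
    star_one, RCLike.star_def, Complex.conj_I, Complex.conj_ofReal, Complex.conj_ofNat]
  ring

/-- The real coordinates of a Hermitian matrix. -/
def hermCoord {n : ℕ} (X : Matrix (Fin n) (Fin n) ℂ) : Fin n → Fin n → ℝ :=
  fun a b => (X a b).re + (X a b).im

/-- For Hermitian `X` the coordinates at `(a, b)` and `(b, a)` are the sum and the difference of
real and imaginary part of one entry, which they determine. -/
lemma hermOf_hermCoord {n : ℕ} {X : Matrix (Fin n) (Fin n) ℂ} (hX : X.IsHermitian) :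
    hermOf (hermCoord X) = X := by
  ext a b
  have h : X b a = star (X a b) := by rw [← hX.apply b a]
  rw [hermOf_apply, hermCoord, hermCoord, h]
  apply Complex.ext <;> simp <;> ring

lemma hermCoord_hermOf {n : ℕ} (R : Fin n → Fin n → ℝ) : hermCoord (hermOf R) = R := by
  funext a b
  rw [hermCoord, hermOf_apply]
  simp
  ring

/-- The real parameters of the weight matrices of group `k`: a Hermitian matrix, and a scalar for
each other group. -/
abbrev GroupCoord (n : ℕ) {g : ℕ} (k : Fin g) : Type :=
  (Fin n → Fin n → ℝ) × ({j : Fin g // j ≠ k} → ℝ)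

/-- This is the number of weight matrices in a group, so their independence makes them a basis of
the parameter space. -/
lemma finrank_groupCoord (n : ℕ) {g : ℕ} (k : Fin g) :
    Module.finrank ℝ (GroupCoord n k) = groupSize n g := by
  rw [Module.finrank_prod, Module.finrank_pi_fintype]
  simp only [Module.finrank_fintype_fun_eq_card, Fintype.card_fin, Finset.sum_const,
    Finset.card_univ, smul_eq_mul]
  rw [groupSize, Fintype.card_subtype_compl, Fintype.card_fin, Fintype.card_subtype_eq, pow_two]

/-- The left tensor factor of the diagonal block `j`. -/
def blockCoeff {n g : ℕ} (k : Fin g) (j : Fin g) :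
    GroupCoord n k →ₗ[ℝ] Matrix (Fin n) (Fin n) ℂ where
  toFun x := if h : j = k then hermOf x.1 else ((x.2 ⟨j, h⟩ : ℝ) : ℂ) • 1
  map_add' x y := by
    split_ifs <;> simp [add_smul]
  map_smul' c x := by
    split_ifs <;> simp [mul_smul]

lemma blockCoeff_self {n g : ℕ} (k : Fin g) (x : GroupCoord n k) :
    blockCoeff k k x = hermOf x.1 := by simp [blockCoeff]

lemma blockCoeff_of_ne {n g : ℕ} {k j : Fin g} (h : j ≠ k) (x : GroupCoord n k) :
    blockCoeff k j x = ((x.2 ⟨j, h⟩ : ℝ) : ℂ) • 1 := by simp [blockCoeff, h]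

lemma isHermitian_blockCoeff {n g : ℕ} (k j : Fin g) (x : GroupCoord n k) :
    (blockCoeff k j x).IsHermitian := by
  by_cases h : j = k
  · subst h; rw [blockCoeff_self]; exact isHermitian_hermOf _
  · rw [blockCoeff_of_ne h, Matrix.IsHermitian, Matrix.conjTranspose_smul]
    simp

/-- Block `j` differs from `k` or from `k'`, so one of the two factors is a scalar. -/
lemma commute_blockCoeff {n g : ℕ} {k k' : Fin g} (hk : k ≠ k') (j : Fin g) (x : GroupCoord n k)
    (x' : GroupCoord n k') : blockCoeff k j x * blockCoeff k' j x' =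
      blockCoeff k' j x' * blockCoeff k j x := by
  by_cases h : j = k
  · rw [blockCoeff_of_ne (h ▸ hk : j ≠ k')]; simp
  · rw [blockCoeff_of_ne h]; simp

/-- The matrix `diag (X₁ ⊗ U₁, …, X_g ⊗ U_g)` with the given parameters. -/
def groupMatrix {n g : ℕ} (U : Fin g → Matrix (Fin (blockSize g)) (Fin (blockSize g)) ℂ)
    (k : Fin g) : GroupCoord n k →ₗ[ℝ] Matrix (Antenna n g) (Antenna n g) ℂ where
  toFun x := Matrix.blockDiagonal fun j => blockCoeff k j x ⊗ₖ U j
  map_add' x y := by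
    rw [← Matrix.blockDiagonal_add]
    congr 1
    funext j
    rw [map_add, Matrix.add_kronecker]; rfl
  map_smul' c x := by
    rw [RingHom.id_apply, ← Matrix.blockDiagonal_smul]
    congr 1
    funext j
    rw [map_smul, Matrix.smul_kronecker]; rfl

lemma groupMatrix_apply {n g : ℕ} (U : Fin g → Matrix (Fin (blockSize g)) (Fin (blockSize g)) ℂ)
    (k : Fin g) (x : GroupCoord n k) :
    groupMatrix U k x = Matrix.blockDiagonal fun j => blockCoeff k j x ⊗ₖ U j := rfl

lemma blockWeight_eq {n g : ℕ} (k : Fin g) {V : Matrix (Fin n) (Fin n) ℂ} (hV : V.IsHermitian)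
    (U : Fin g → Matrix (Fin (blockSize g)) (Fin (blockSize g)) ℂ) (ε : Fin g → ℤˣ) :
    blockWeight k V U ε = groupMatrix U k (hermCoord V, fun j => ((ε j : ℤ) : ℝ)) := by
  rw [blockWeight, groupMatrix_apply]
  congr 1
  funext j
  split_ifs with h
  · subst h; rw [blockCoeff_self, hermOf_hermCoord hV]
  · rw [blockCoeff_of_ne h, Matrix.smul_kronecker, ← Int.cast_smul_eq_zsmul ℂ]
    push_cast
    rfl

/-- The left tensor factors are Hermitian and commute, so in each block the sum is their product
tensored with a Hurwitz-Radon relation. -/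
lemma groupMatrix_orthogonal {n g : ℕ}
    {U : Fin g → Fin g → Matrix (Fin (blockSize g)) (Fin (blockSize g)) ℂ}
    (hU : ∀ j k k', k ≠ k' → (U j k)ᴴ * U j k' + (U j k')ᴴ * U j k = 0) {k k' : Fin g}
    (hk : k ≠ k') (x : GroupCoord n k) (x' : GroupCoord n k') :
    (groupMatrix (fun j => U j k) k x)ᴴ * groupMatrix (fun j => U j k') k' x' +
      (groupMatrix (fun j => U j k') k' x')ᴴ * groupMatrix (fun j => U j k) k x = 0 := by
  simp only [groupMatrix_apply, Matrix.blockDiagonal_conjTranspose]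
  rw [← Matrix.blockDiagonal_mul, ← Matrix.blockDiagonal_mul, ← Matrix.blockDiagonal_add,
    ← Matrix.blockDiagonal_zero]
  congr 1
  funext j
  simp only [Pi.add_apply, Pi.zero_apply]
  rw [Matrix.conjTranspose_kronecker, Matrix.conjTranspose_kronecker, ← Matrix.mul_kronecker_mul,
    ← Matrix.mul_kronecker_mul, (isHermitian_blockCoeff k j x).eq,
    (isHermitian_blockCoeff k' j x').eq, ← commute_blockCoeff hk, ← Matrix.kronecker_add,
    hU j k k' hk, Matrix.kronecker_zero]

lemma blockSize_pos (g : ℕ) : 0 < blockSize g := Nat.pos_of_ne_zero (by simp [blockSize])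

lemma eq_zero_of_kronecker_one_eq_zero {n g : ℕ} {X : Matrix (Fin n) (Fin n) ℂ}
    (h : X ⊗ₖ (1 : Matrix (Fin (blockSize g)) (Fin (blockSize g)) ℂ) = 0) : X = 0 := by
  ext a b
  have := congrFun (congrFun h (a, ⟨0, blockSize_pos g⟩)) (b, ⟨0, blockSize_pos g⟩)
  simpa [Matrix.kroneckerMap_apply] using this

/-- The parametrizations of the different groups are jointly injective. -/
lemma groupMatrix_injective {n g : ℕ} (hn : 1 ≤ n)
    {U : Fin g → Fin g → Matrix (Fin (blockSize g)) (Fin (blockSize g)) ℂ}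
    (hU1 : ∀ j k, (U j k)ᴴ * U j k = 1)
    (hU : ∀ j k k', k ≠ k' → (U j k)ᴴ * U j k' + (U j k')ᴴ * U j k = 0)
    (x : ∀ k : Fin g, GroupCoord n k)
    (hx : ∑ k, groupMatrix (fun j => U j k) k (x k) = 0) (k : Fin g) : x k = 0 := by
  have hblock : ∀ j, ∑ k, blockCoeff k j (x k) ⊗ₖ U j k = 0 := by
    intro j
    ext i i'
    have := congrFun (congrFun hx (i, j)) (i', j)
    simpa [Matrix.sum_apply, groupMatrix_apply, Matrix.blockDiagonal_apply] using this
  have hzero : ∀ j, blockCoeff k j (x k) = 0 := by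
    intro j
    -- Multiplying by `(U j k)ᴴ` turns the term of group `k` into a Hermitian matrix and all the
    -- others into skew-Hermitian ones, so the Hermitian part isolates group `k`.
    set Y : Fin g → Matrix _ _ ℂ := fun k' => blockCoeff k' j (x k') ⊗ₖ ((U j k)ᴴ * U j k') with hY
    have h1 : ∑ k', Y k' = 0 := by
      have : ∀ k', Y k' = ((1 : Matrix (Fin n) (Fin n) ℂ) ⊗ₖ (U j k)ᴴ) *
          (blockCoeff k' j (x k') ⊗ₖ U j k') := fun k' => by
        rw [← Matrix.mul_kronecker_mul, one_mul]
      simp only [this, ← Matrix.mul_sum, hblock, mul_zero]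
    have h2 : ∑ k', (Y k' + (Y k')ᴴ) = 0 := by
      rw [Finset.sum_add_distrib, ← Matrix.conjTranspose_sum, h1]; simp
    have h3 : ∀ k', k' ≠ k → Y k' + (Y k')ᴴ = 0 := by
      intro k' hk'
      rw [hY]
      simp only
      rw [Matrix.conjTranspose_kronecker, (isHermitian_blockCoeff k' j _).eq,
        ← Matrix.kronecker_add, Matrix.conjTranspose_mul, Matrix.conjTranspose_conjTranspose,
        hU j k k' hk'.symm, Matrix.kronecker_zero]
    rw [Finset.sum_eq_single k (fun k' _ h => h3 k' h) (by simp)] at h2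
    rw [hY] at h2
    simp only at h2
    rw [hU1, Matrix.conjTranspose_kronecker, (isHermitian_blockCoeff k j _).eq,
      Matrix.conjTranspose_one, ← two_smul ℂ, ← Matrix.smul_kronecker] at h2
    have h4 := eq_zero_of_kronecker_one_eq_zero h2
    exact (smul_eq_zero.1 h4).resolve_left two_ne_zero
  refine Prod.ext ?_ ?_
  · have := hzero k
    rw [blockCoeff_self] at this
    rw [← hermCoord_hermOf (x k).1, this]
    funext a b; simp [hermCoord]
  · funext ⟨j, hj⟩
    have := hzero j
    rw [blockCoeff_of_ne hj] at this
    have h5 := congrFun (congrFun this ⟨0, hn⟩) ⟨0, hn⟩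
    simpa using h5

/-- The structure of a delay-optimal code that the proofs use: in each group the weight matrices are
the images of a basis of the parameter space. -/
lemma IsDelayOptimalCode.exists_basis {n g : ℕ} (hn : 1 ≤ n)
    {A : Fin g → Fin (groupSize n g) → Matrix (Antenna n g) (Antenna n g) ℂ}
    (hA : IsDelayOptimalCode A) :
    ∃ U : Fin g → Fin g → Matrix (Fin (blockSize g)) (Fin (blockSize g)) ℂ,
      (∀ j k, (U j k)ᴴ * U j k = 1) ∧
      (∀ j k k', k ≠ k' → (U j k)ᴴ * U j k' + (U j k')ᴴ * U j k = 0) ∧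
      ∀ k, ∃ B : Module.Basis (Fin (groupSize n g)) ℝ (GroupCoord n k),
        ∀ i, A k i = groupMatrix (fun j => U j k) k (B i) := by
  obtain ⟨U, V, idx, ε, hU1, hU, hV, -, hAk, hli⟩ := hA
  refine ⟨U, hU1, hU, fun k => ?_⟩
  let B : Fin (groupSize n g) → GroupCoord n k := fun i =>
    (hermCoord (V k (idx k i)), fun j => ((ε k i j : ℤ) : ℝ))
  have hB : ∀ i, A k i = groupMatrix (fun j => U j k) k (B i) := fun i => by
    rw [hAk, blockWeight_eq k (hV k _).1]
  have hli' : LinearIndependent ℝ (A k) :=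
    hli.comp (fun i => (k, i)) fun a b h => (Prod.ext_iff.1 h).2
  have hBli : LinearIndependent ℝ B := by
    refine LinearIndependent.of_comp (groupMatrix (fun j => U j k) k) ?_
    convert hli' using 1
    funext i
    exact (hB i).symm
  have hpos : Nonempty (Fin (groupSize n g)) :=
    Fin.pos_iff_nonempty.1 (by have : 0 < n ^ 2 := by positivity
                               rw [groupSize]; omega)
  refine ⟨basisOfLinearIndependentOfCardEqFinrank hBli ?_, fun i => ?_⟩
  · rw [finrank_groupCoord, Fintype.card_fin]
  · rw [coe_basisOfLinearIndependentOfCardEqFinrank, hB]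

lemma IsDelayOptimalCode.orthogonal {n g : ℕ} (hn : 1 ≤ n)
    {A : Fin g → Fin (groupSize n g) → Matrix (Antenna n g) (Antenna n g) ℂ}
    (hA : IsDelayOptimalCode A) (k k' : Fin g) (i i' : Fin (groupSize n g)) (hk : k ≠ k') :
    (A k i)ᴴ * A k' i' + (A k' i')ᴴ * A k i = 0 := by
  obtain ⟨U, -, hU, hB⟩ := hA.exists_basis hn
  obtain ⟨B, hB1⟩ := hB k
  obtain ⟨B', hB2⟩ := hB k'
  rw [hB1, hB2]
  exact groupMatrix_orthogonal hU hk _ _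

/-! ### A well-conditioned minor of the channel of a group -/

/-- The Gram-Schmidt basis of a family of vectors, with the distances to the preceding vectors on
the diagonal of the triangular factor. -/
lemma exists_orthonormalBasis_triangular {n p : ℕ} (h : Fin p → EuclideanSpace ℂ (Fin n)) :
    ∃ b : OrthonormalBasis (Fin n) ℂ (EuclideanSpace ℂ (Fin n)), ∀ a : Fin p,
      (∀ i : Fin n, (a : ℕ) < i → inner ℂ (b i) (h a) = 0) ∧
      ∀ ha : (a : ℕ) < n, ∃ δ : ℝ, columnDist h a ≤ δ ∧ inner ℂ (b ⟨a, ha⟩) (h a) = (δ : ℂ) := by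
  -- The family is cut or padded by zeros to length `n`. Vectors with `a ≥ n` are lost without harm,
  -- as both claims are void for them.
  let f : Fin n → EuclideanSpace ℂ (Fin n) := fun i => if hi : (i : ℕ) < p then h ⟨i, hi⟩ else 0
  have hcard : Module.finrank ℂ (EuclideanSpace ℂ (Fin n)) = Fintype.card (Fin n) := by simp
  have hf : ∀ (a : Fin p) (ha : (a : ℕ) < n), f ⟨a, ha⟩ = h a := fun a ha => by simp [f]
  refine ⟨gramSchmidtOrthonormalBasis hcard f, fun a => ⟨fun i hi => ?_, fun ha => ?_⟩⟩
  · rw [← hf a (hi.trans i.2)]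
    exact gramSchmidtOrthonormalBasis_inv_triangular hcard f hi
  · refine ⟨‖gramSchmidt ℂ f ⟨a, ha⟩‖, ?_, ?_⟩
    -- The Gram-Schmidt vector differs from `h a` by an element of the span of the predecessors, so
    -- its norm is at least the distance; equality is not needed.
    · have hmem : h a - gramSchmidt ℂ f ⟨a, ha⟩ ∈ Submodule.span ℂ (h '' Set.Iio a) := by
        rw [← hf a ha, gramSchmidt_def, sub_sub_cancel]
        have hsub : gramSchmidt ℂ f '' Set.Iio ⟨a, ha⟩ ⊆ Submodule.span ℂ (h '' Set.Iio a) := by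
          have h1 := Submodule.subset_span (R := ℂ) (s := gramSchmidt ℂ f '' Set.Iio ⟨a, ha⟩)
          rw [span_gramSchmidt_Iio] at h1
          refine h1.trans (Submodule.span_mono ?_)
          rintro _ ⟨i, hi, rfl⟩
          have hip : (i : ℕ) < p := lt_trans (show (i : ℕ) < a from hi) a.2
          exact ⟨⟨i, hip⟩, hi, by simp [f, hip]⟩
        refine Submodule.sum_mem _ fun i hi => ?_
        rw [Submodule.starProjection_singleton]
        exact Submodule.smul_mem _ _ (hsub ⟨i, by simpa using hi, rfl⟩)
      refine (Metric.infDist_le_dist_of_mem hmem).trans_eq ?_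
      rw [dist_eq_norm, sub_sub_cancel]
    · rw [← hf a ha]
      -- If the Gram-Schmidt vector vanishes, the basis vector in this place comes from the
      -- completion and is orthogonal to `h a`; then `δ = 0`.
      by_cases h0 : gramSchmidt ℂ f ⟨a, ha⟩ = 0
      · have h0' : gramSchmidtNormed ℂ f ⟨a, ha⟩ = 0 := by simp [gramSchmidtNormed, h0]
        rw [inner_gramSchmidtOrthonormalBasis_eq_zero hcard h0', h0]; simp
      · have h0' : gramSchmidtNormed ℂ f ⟨a, ha⟩ ≠ 0 := by
          simp [gramSchmidtNormed, h0]
        rw [gramSchmidtOrthonormalBasis_apply hcard h0', gramSchmidtNormed, inner_smul_left]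
        have h2 : inner ℂ (gramSchmidt ℂ f ⟨a, ha⟩) (f ⟨a, ha⟩) =
            (‖gramSchmidt ℂ f ⟨a, ha⟩‖ : ℂ) ^ 2 := by
          conv_lhs => rw [gramSchmidt_def' ℂ f ⟨a, ha⟩]
          rw [inner_add_right, inner_self_eq_norm_sq_to_K, inner_sum, Finset.sum_eq_zero, add_zero]
          · rfl
          · intro i hi
            rw [Submodule.starProjection_singleton, inner_smul_right,
              gramSchmidt_orthogonal ℂ f (ne_of_gt (Finset.mem_Iio.1 hi)), mul_zero]
        rw [h2]
        have : (‖gramSchmidt ℂ f ⟨a, ha⟩‖ : ℂ) ≠ 0 := by simpa using h0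
        simp
        field_simp

/-- The determinant of a matrix that becomes triangular when its indices are sorted. -/
lemma det_eq_prod_of_le {ι : Type*} [Fintype ι] [DecidableEq ι] (T : Matrix ι ι ℝ) (ρ : ι → ℕ)
    (hT : ∀ i j, i ≠ j → ρ i ≤ ρ j → T i j = 0) : T.det = ∏ i, T i i := by
  have hbt : Tᵀ.BlockTriangular ρ := fun i j hij =>
    hT j i (fun h => hij.ne (by rw [h])) hij.le
  rw [← Matrix.det_transpose, hbt.det, ← Finset.prod_fiberwise_of_maps_to
    (s := Finset.univ) (t := Finset.univ.image ρ) (g := ρ) (by simp)]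
  refine Finset.prod_congr rfl fun a _ => ?_
  -- `ρ` may repeat values: the hypothesis at equal values makes each diagonal block itself
  -- diagonal.
  have : Tᵀ.toSquareBlock ρ a = Matrix.diagonal fun i : {i // ρ i = a} => T i i := by
    ext i j
    rw [Matrix.toSquareBlock_def, Matrix.of_apply, Matrix.transpose_apply, Matrix.diagonal_apply]
    split_ifs with h
    · rw [h]
    · exact hT _ _ (fun h' => h (Subtype.ext h'.symm)) (by rw [i.2, j.2])
  rw [this, Matrix.det_diagonal, Finset.prod_subtype (p := fun i => ρ i = a)]
  simp

section Action

variable {n g M : ℕ} (U : Fin g → Matrix (Fin (blockSize g)) (Fin (blockSize g)) ℂ)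

/-- The unitary block diagonal matrix with blocks `1 ⊗ U j`. -/
def blockUnitary (n : ℕ) : Matrix (Antenna n g) (Antenna n g) ℂ :=
  Matrix.blockDiagonal fun j => (1 : Matrix (Fin n) (Fin n) ℂ) ⊗ₖ U j

lemma blockUnitary_mul_self (hU : ∀ j, (U j)ᴴ * U j = 1) :
    (blockUnitary U n)ᴴ * blockUnitary U n = 1 := by
  rw [blockUnitary, Matrix.blockDiagonal_conjTranspose, ← Matrix.blockDiagonal_mul]
  simp only [Matrix.conjTranspose_kronecker, ← Matrix.mul_kronecker_mul, hU,
    Matrix.conjTranspose_one, mul_one, Matrix.one_kronecker_one]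
  exact Matrix.blockDiagonal_one

/-- A unitary factor on the left preserves real inner products, so the matrices `U j` can be removed
altogether when the test vectors carry the same factor. -/
lemma groupMatrix_eq_mul (k : Fin g) (x : GroupCoord n k) :
    groupMatrix U k x = blockUnitary U n * groupMatrix (fun _ => 1) k x := by
  rw [blockUnitary, groupMatrix_apply, groupMatrix_apply, ← Matrix.blockDiagonal_mul]
  congr 1
  funext j
  rw [← Matrix.mul_kronecker_mul, one_mul, mul_one]

lemma trace_eq_sum_inner_blockColumns (Y Z : Antenna n g → Fin M → ℂ) :
    ((Matrix.of Y)ᴴ * Matrix.of Z).trace =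
      ∑ j, ∑ a, inner ℂ (blockColumns Y j a) (blockColumns Z j a) := by
  simp only [PiLp.inner_apply]
  rw [Matrix.trace]
  simp only [Matrix.diag_apply, Matrix.mul_apply]
  rw [Finset.sum_comm (s := (Finset.univ : Finset (Fin M))), Fintype.sum_prod_type_right]
  refine Finset.sum_congr rfl fun j _ => ?_
  rw [← finProdFinEquiv.sum_comp, Fintype.sum_prod_type, Fintype.sum_prod_type_right]
  refine Finset.sum_comm_cycle.trans (Finset.sum_congr rfl fun μ _ =>
    Finset.sum_comm.trans (Finset.sum_congr rfl fun β _ => Finset.sum_congr rfl fun α _ => ?_))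
  change _ = inner ℂ (Y ((α, (finProdFinEquiv.symm (finProdFinEquiv (β, μ))).1), j)
    (finProdFinEquiv.symm (finProdFinEquiv (β, μ))).2)
    (Z ((α, (finProdFinEquiv.symm (finProdFinEquiv (β, μ))).1), j)
    (finProdFinEquiv.symm (finProdFinEquiv (β, μ))).2)
  rw [Equiv.symm_apply_apply]
  simp [mul_comm]

/-- With trivial second tensor factors, the matrix acts on each of the `mM` vectors of a block
separately. -/
lemma blockColumns_groupMatrix_mul (k : Fin g) (x : GroupCoord n k)
    (H : Antenna n g → Fin M → ℂ) (j : Fin g) (a : Fin (blockSize g * M)) :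
    blockColumns (groupMatrix (fun _ => 1) k x * Matrix.of H : Matrix _ _ ℂ) j a =
      WithLp.toLp 2 (blockCoeff k j x *ᵥ blockColumns H j a) := by
  ext α
  change (groupMatrix (fun _ => 1) k x * Matrix.of H : Matrix _ _ ℂ) _ _ = _
  rw [Matrix.mul_apply, Fintype.sum_prod_type_right, Finset.sum_eq_single j]
  · rw [Fintype.sum_prod_type, PiLp.toLp_apply, Matrix.mulVec, dotProduct]
    refine Finset.sum_congr rfl fun α' _ => ?_
    rw [Finset.sum_eq_single (finProdFinEquiv.symm a).1]
    · simp [groupMatrix_apply, Matrix.blockDiagonal_apply, Matrix.kroneckerMap_apply, blockColumns]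
    · intro β _ hβ
      simp only [groupMatrix_apply, Matrix.blockDiagonal_apply, Matrix.kroneckerMap_apply, if_true]
      rw [Matrix.one_apply_ne hβ.symm]; simp
    · simp
  · intro j' _ hj'
    refine Finset.sum_eq_zero fun i _ => ?_
    simp [groupMatrix_apply, Matrix.blockDiagonal_apply, hj'.symm]
  · simp

/-- The real vector of the matrix with block columns `v`, rotated by the matrices `U j`. -/
def testVector (v : Fin g → Fin (blockSize g * M) → EuclideanSpace ℂ (Fin n)) :
    EuclideanSpace ℝ ((Fin M × Antenna n g) ⊕ (Fin M × Antenna n g)) :=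
  realVecL (blockUnitary U n * Matrix.of (blockColumns.symm v))

lemma inner_realVecL_blockUnitary_mul (hU : ∀ j, (U j)ᴴ * U j = 1)
    (Y Z : Matrix (Antenna n g) (Fin M) ℂ) :
    inner ℝ (realVecL (blockUnitary U n * Y)) (realVecL (blockUnitary U n * Z)) =
      (Yᴴ * Z).trace.re := by
  rw [inner_realVecL, Matrix.conjTranspose_mul, Matrix.mul_assoc, ← Matrix.mul_assoc _ _ Z,
    blockUnitary_mul_self U hU, Matrix.one_mul]

/-- A test vector concentrated on one block column reads off a single inner product in `ℂ ^ n`. -/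
lemma inner_testVector (hU : ∀ j, (U j)ᴴ * U j = 1) (j : Fin g) (a : Fin (blockSize g * M))
    (u : EuclideanSpace ℂ (Fin n)) (k : Fin g) (x : GroupCoord n k)
    (H : Antenna n g → Fin M → ℂ) :
    inner ℝ (testVector U (Pi.single j (Pi.single a u)))
      (realVecL (groupMatrix U k x * Matrix.of H)) =
      (inner ℂ u (WithLp.toLp 2 (blockCoeff k j x *ᵥ blockColumns H j a))).re := by
  rw [testVector, groupMatrix_eq_mul, Matrix.mul_assoc, inner_realVecL_blockUnitary_mul U hU]
  have := trace_eq_sum_inner_blockColumns (blockColumns.symm (Pi.single j (Pi.single a u)))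
    (groupMatrix (fun _ => 1) k x * Matrix.of H : Matrix _ _ ℂ)
  rw [show Matrix.of (groupMatrix (fun _ => 1) k x * Matrix.of H : Matrix _ _ ℂ) =
    groupMatrix (fun _ => 1) k x * Matrix.of H from rfl] at this
  rw [this, LinearEquiv.apply_symm_apply, Finset.sum_eq_single j, Finset.sum_eq_single a]
  · rw [Pi.single_eq_same, Pi.single_eq_same, blockColumns_groupMatrix_mul]
  · intro a' _ ha'; rw [Pi.single_eq_same, Pi.single_eq_of_ne ha', inner_zero_left]
  · simp
  · intro j' _ hj'; rw [Pi.single_eq_of_ne hj']; simp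
  · simp

lemma norm_testVector (hU : ∀ j, (U j)ᴴ * U j = 1) (j : Fin g) (a : Fin (blockSize g * M))
    (u : EuclideanSpace ℂ (Fin n)) :
    ‖testVector U (Pi.single j (Pi.single a u))‖ = ‖u‖ := by
  refine (sq_eq_sq₀ (norm_nonneg _) (norm_nonneg _)).1 ?_
  rw [← real_inner_self_eq_norm_sq, testVector, inner_realVecL_blockUnitary_mul U hU,
    trace_eq_sum_inner_blockColumns, LinearEquiv.apply_symm_apply, Finset.sum_eq_single j,
    Finset.sum_eq_single a]
  · rw [Pi.single_eq_same, Pi.single_eq_same, inner_self_eq_norm_sq_to_K]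
    norm_cast
  · intro a' _ ha'; rw [Pi.single_eq_same, Pi.single_eq_of_ne ha', inner_zero_left]
  · simp
  · intro j' _ hj'; rw [Pi.single_eq_of_ne hj']; simp
  · simp

lemma realVecL_groupMatrix_mul_eq_zero (k : Fin g) (x : GroupCoord n k)
    (H : Antenna n g → Fin M → ℂ) (hx : ∀ j a, blockCoeff k j x *ᵥ blockColumns H j a = 0) :
    realVecL (groupMatrix U k x * Matrix.of H) = 0 := by
  have : (groupMatrix (fun _ => 1) k x * Matrix.of H : Matrix _ _ ℂ) = 0 := by
    refine blockColumns.injective ?_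
    funext j a
    rw [blockColumns_groupMatrix_mul, hx, WithLp.toLp_zero]
    exact (congrFun (congrFun (map_zero blockColumns) j) a).symm
  rw [groupMatrix_eq_mul, Matrix.mul_assoc, this, Matrix.mul_zero, map_zero]

end Action

section

/-! ### Hermitian matrices with two nonzero entries -/

/-- The coordinate vectors of the Hermitian matrices. -/
def hermUnit {n : ℕ} (e : Fin n × Fin n) : Matrix (Fin n) (Fin n) ℂ :=
  hermOf fun i j => if (i, j) = e then 1 else 0

lemma hermUnit_apply {n : ℕ} (a b i j : Fin n) : hermUnit (a, b) i j =
    (1 + Complex.I) / 2 * (if i = a ∧ j = b then 1 else 0) +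
      (1 - Complex.I) / 2 * (if j = a ∧ i = b then 1 else 0) := by
  rw [hermUnit, hermOf_apply]
  simp only [Prod.mk.injEq]
  split_ifs <;> simp

/-- The unit at `(a, b)` has no entries in columns before `min a b`. Both the triangular shape of
the minor and the rank deficiency come from this. -/
lemma hermUnit_eq_zero {n : ℕ} {e : Fin n × Fin n} {i : Fin n} (hi : i < min e.1 e.2) (m : Fin n) :
    hermUnit e m i = 0 := by
  obtain ⟨a, b⟩ := e
  rw [lt_min_iff] at hi
  rw [hermUnit_apply, if_neg (fun h => hi.2.ne h.2), if_neg (fun h => hi.1.ne h.1)]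
  simp

/-- With equal minima the supports can meet here only if `e` is `e'` reversed. Then the two entries
are `(1 + i) / 2` and `(1 - i) / 2`, perpendicular as real vectors. -/
lemma re_hermUnit_mul_of_ne {n : ℕ} {e e' : Fin n × Fin n} (hne : e ≠ e')
    (h : min e.1 e.2 = min e'.1 e'.2) :
    (star (hermUnit e' (max e'.1 e'.2) (min e'.1 e'.2)) *
      hermUnit e (max e'.1 e'.2) (min e'.1 e'.2)).re = 0 := by
  obtain ⟨a, b⟩ := e
  obtain ⟨a', b'⟩ := e'
  simp only [hermUnit_apply]
  simp only [ne_eq, Prod.mk.injEq] at hne h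
  rcases le_total a b with h1 | h1 <;> rcases le_total a' b' with h2 | h2 <;>
    simp only [h1, h2, min_eq_left, min_eq_right, max_eq_left, max_eq_right] at h ⊢ <;>
    split_ifs <;> first | (exfalso; omega) | (norm_num)

/-- The entry is `1` on the diagonal and `(1 ± i) / 2` off it. -/
lemma half_le_re_hermUnit_mul {n : ℕ} (e : Fin n × Fin n) :
    1 / 2 ≤ (star (hermUnit e (max e.1 e.2) (min e.1 e.2)) *
      hermUnit e (max e.1 e.2) (min e.1 e.2)).re := by
  obtain ⟨a, b⟩ := e
  simp only [hermUnit_apply]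
  rcases le_total a b with h1 | h1 <;>
    simp only [h1, min_eq_left, min_eq_right, max_eq_left, max_eq_right, and_self, if_true] <;>
    split_ifs <;> norm_num

lemma norm_hermUnit_le {n : ℕ} (e : Fin n × Fin n) (i j : Fin n) : ‖hermUnit e i j‖ ≤ 1 := by
  obtain ⟨a, b⟩ := e
  refine abs_le_of_sq_le_sq' ?_ zero_le_one |>.2
  rw [← Complex.normSq_eq_norm_sq, hermUnit_apply, Complex.normSq_apply]
  split_ifs <;> norm_num

lemma sum_smul_hermUnit {n : ℕ} (R : Fin n → Fin n → ℝ) :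
    hermOf R = ∑ e : Fin n × Fin n, R e.1 e.2 • hermUnit e := by
  simp only [hermUnit, ← map_smul, ← map_sum]
  congr 1
  funext i j
  simp only [Finset.sum_apply, Pi.smul_apply, smul_eq_mul, mul_ite, mul_one, mul_zero]
  simp

section Rotated

variable {n : ℕ} (b : OrthonormalBasis (Fin n) ℂ (EuclideanSpace ℂ (Fin n)))

/-- The unitary matrix whose columns are the vectors of an orthonormal basis. -/
def basisMatrix : Matrix (Fin n) (Fin n) ℂ := Matrix.of fun α i => b i α

lemma basisMatrix_mul_self : (basisMatrix b)ᴴ * basisMatrix b = 1 := by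
  ext i j
  have := orthonormal_iff_ite.1 b.orthonormal i j
  rw [PiLp.inner_apply] at this
  rw [Matrix.mul_apply, Matrix.one_apply, ← this]
  refine Finset.sum_congr rfl fun α _ => ?_
  simp [basisMatrix, mul_comm]

/-- The matrix of the Hermitian operator that has the matrix `hermUnit e` in the basis `b`. -/
def rotatedUnit (e : Fin n × Fin n) : Matrix (Fin n) (Fin n) ℂ :=
  basisMatrix b * hermUnit e * (basisMatrix b)ᴴ

lemma isHermitian_rotatedUnit (e : Fin n × Fin n) : (rotatedUnit b e).IsHermitian :=
  Matrix.isHermitian_mul_mul_conjTranspose _ (isHermitian_hermOf _)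

lemma conjTranspose_basisMatrix_mulVec (v : EuclideanSpace ℂ (Fin n)) (i : Fin n) :
    ((basisMatrix b)ᴴ *ᵥ v) i = inner ℂ (b i) v := by
  rw [PiLp.inner_apply, Matrix.mulVec, dotProduct]
  refine Finset.sum_congr rfl fun α _ => ?_
  simp [basisMatrix, mul_comm]

lemma inner_rotatedUnit (e : Fin n × Fin n) (m : Fin n) (v : EuclideanSpace ℂ (Fin n)) :
    inner ℂ (b m) (WithLp.toLp 2 (rotatedUnit b e *ᵥ v)) =
      ∑ i, hermUnit e m i * inner ℂ (b i) v := by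
  rw [← conjTranspose_basisMatrix_mulVec]
  change ((basisMatrix b)ᴴ *ᵥ (rotatedUnit b e *ᵥ v)) m = _
  rw [rotatedUnit, Matrix.mulVec_mulVec, ← Matrix.mul_assoc, ← Matrix.mul_assoc,
    basisMatrix_mul_self, Matrix.one_mul, ← Matrix.mulVec_mulVec, Matrix.mulVec, dotProduct]
  simp only [conjTranspose_basisMatrix_mulVec]

lemma abs_hermCoord_rotatedUnit_le (e : Fin n × Fin n) (α β : Fin n) :
    |hermCoord (rotatedUnit b e) α β| ≤ 2 * (n : ℝ) ^ 2 := by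
  have h1 : ‖rotatedUnit b e α β‖ ≤ (n : ℝ) ^ 2 := by
    have hb : ∀ i α, ‖b i α‖ ≤ 1 := fun i α =>
      (PiLp.norm_apply_le (b i) α).trans_eq (b.orthonormal.1 i)
    simp only [rotatedUnit, Matrix.mul_apply, Finset.sum_mul]
    refine (norm_sum_le_of_le (n := fun _ => ∑ _ : Fin n, (1 : ℝ)) _ fun i _ =>
      norm_sum_le_of_le _ fun j _ => ?_).trans_eq ?_
    · rw [norm_mul, norm_mul, Matrix.conjTranspose_apply, norm_star]
      exact mul_le_one₀ (mul_le_one₀ (hb _ _) (norm_nonneg _) (norm_hermUnit_le _ _ _))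
        (norm_nonneg _) (hb _ _)
    · simp; ring
  rw [hermCoord]
  refine (abs_add_le _ _).trans ?_
  linarith [Complex.abs_re_le_norm (rotatedUnit b e α β),
    Complex.abs_im_le_norm (rotatedUnit b e α β)]

/-- Conjugation by a unitary matrix maps the Hermitian matrices onto themselves, so the rotated
units still span them over the reals. -/
lemma exists_hermOf_eq_sum_rotatedUnit (R : Fin n → Fin n → ℝ) :
    ∃ c : Fin n × Fin n → ℝ, hermOf R = ∑ e, c e • rotatedUnit b e := by
  set Q := basisMatrix b with hQ
  have hQQ : Q * Qᴴ = 1 := mul_eq_one_comm.1 (basisMatrix_mul_self b)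
  have hX : (Qᴴ * hermOf R * Q).IsHermitian :=
    Matrix.isHermitian_conjTranspose_mul_mul _ (isHermitian_hermOf R)
  refine ⟨fun e => hermCoord (Qᴴ * hermOf R * Q) e.1 e.2, ?_⟩
  have h1 : hermOf R = Q * (Qᴴ * hermOf R * Q) * Qᴴ := by
    rw [← Matrix.mul_assoc, ← Matrix.mul_assoc, hQQ, Matrix.one_mul, Matrix.mul_assoc, hQQ,
      Matrix.mul_one]
  conv_lhs => rw [h1, ← hermOf_hermCoord hX, sum_smul_hermUnit, Matrix.mul_sum, Matrix.sum_mul]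
  simp only [Matrix.mul_smul, Matrix.smul_mul, rotatedUnit, hQ]

end Rotated

/-! ### The minor -/

/-- The index set of the minor: it has as many elements as the rank of the channel submatrix. -/
abbrev MinorIndex (n p : ℕ) {g : ℕ} (k : Fin g) : Type :=
  {e : Fin n × Fin n // ((min e.1 e.2 : Fin n) : ℕ) < p} ⊕ {j : Fin g // j ≠ k}

/-- The parameters of the matrices from which the columns of the minor come. -/
def minorCoord {n p g : ℕ} (k : Fin g) (b : OrthonormalBasis (Fin n) ℂ (EuclideanSpace ℂ (Fin n))) :
    MinorIndex n p k → GroupCoord n k :=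
  Sum.elim (fun e => (hermCoord (rotatedUnit b e.1), 0)) (fun j => (0, Pi.single j 1))

lemma norm_minorCoord_le {n p g : ℕ} (k : Fin g)
    (b : OrthonormalBasis (Fin n) ℂ (EuclideanSpace ℂ (Fin n))) (l : MinorIndex n p k) :
    ‖minorCoord k b l‖ ≤ 2 * (n : ℝ) ^ 2 + 1 := by
  have h0 : 0 ≤ 2 * (n : ℝ) ^ 2 := by positivity
  rcases l with e | j
  · refine norm_prod_le_iff.2 ⟨(pi_norm_le_iff_of_nonneg (by linarith)).2 fun α =>
      (pi_norm_le_iff_of_nonneg (by linarith)).2 fun β => ?_, ?_⟩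
    · exact (abs_hermCoord_rotatedUnit_le b e.1 α β).trans (by linarith)
    · simp only [minorCoord, Sum.elim_inl, norm_zero]; linarith
  · refine norm_prod_le_iff.2 ⟨?_, (pi_norm_le_iff_of_nonneg (by linarith)).2 fun i => ?_⟩
    · simp only [minorCoord, Sum.elim_inr, norm_zero]; linarith
    · simp only [minorCoord, Sum.elim_inr]
      rw [Pi.single_apply]
      split_ifs
      · simp
      · simp only [norm_zero]; linarith

variable {n g M : ℕ} (U : Fin g → Matrix (Fin (blockSize g)) (Fin (blockSize g)) ℂ)

/-- The vectors against which the columns of the minor are tested. -/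
def minorTest (hp : 0 < blockSize g * M) (k : Fin g)
    (b : OrthonormalBasis (Fin n) ℂ (EuclideanSpace ℂ (Fin n))) (H : Antenna n g → Fin M → ℂ) :
    MinorIndex n (blockSize g * M) k →
      EuclideanSpace ℝ ((Fin M × Antenna n g) ⊕ (Fin M × Antenna n g)) :=
  Sum.elim
    -- The tested vector is number `min`, along the basis direction `max`. The scalar is the entry
    -- of the unit itself, which makes the reversed unit invisible to the test.
    (fun e => testVector U (Pi.single k (Pi.single ⟨_, e.2⟩
      (hermUnit e.1 (max e.1.1 e.1.2) (min e.1.1 e.1.2) • b (max e.1.1 e.1.2)))))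
    -- Normalized so that the diagonal entry is the norm of the vector; if the vector is zero, so is
    -- the test vector.
    (fun j => testVector U (Pi.single j.1 (Pi.single ⟨0, hp⟩
      (((‖blockColumns H j.1 ⟨0, hp⟩‖⁻¹ : ℝ) : ℂ) • blockColumns H j.1 ⟨0, hp⟩))))

lemma norm_minorTest_le (hU : ∀ j, (U j)ᴴ * U j = 1) (hp : 0 < blockSize g * M) (k : Fin g)
    (b : OrthonormalBasis (Fin n) ℂ (EuclideanSpace ℂ (Fin n))) (H : Antenna n g → Fin M → ℂ)
    (l : MinorIndex n (blockSize g * M) k) : ‖minorTest U hp k b H l‖ ≤ 1 := by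
  rcases l with e | j
  · simp only [minorTest, Sum.elim_inl]
    rw [norm_testVector U hU, norm_smul, b.orthonormal.1, mul_one]
    exact norm_hermUnit_le _ _ _
  · simp only [minorTest, Sum.elim_inr]
    rw [norm_testVector U hU, norm_smul, Complex.norm_real, norm_inv, norm_norm]
    exact inv_mul_le_one

/-- The matrix of the minor of the channel of group `k`. -/
def minorMatrix (hp : 0 < blockSize g * M) (k : Fin g)
    (b : OrthonormalBasis (Fin n) ℂ (EuclideanSpace ℂ (Fin n))) (H : Antenna n g → Fin M → ℂ) :
    Matrix (MinorIndex n (blockSize g * M) k) (MinorIndex n (blockSize g * M) k) ℝ :=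
  Matrix.of fun l' l => inner ℝ (minorTest U hp k b H l')
    (realVecL (groupMatrix U k (minorCoord k b l) * Matrix.of H))

section Entries

variable (hp : 0 < blockSize g * M) (k : Fin g)
    (b : OrthonormalBasis (Fin n) ℂ (EuclideanSpace ℂ (Fin n))) (H : Antenna n g → Fin M → ℂ)

/-- In the sum over basis directions, those before `min e'` are killed by the unit `e`, and those
after it by the triangular form of the vectors. Only one term survives. -/
lemma minorMatrix_inl_inl (hU : ∀ j, (U j)ᴴ * U j = 1)
    (e' e : {e : Fin n × Fin n // ((min e.1 e.2 : Fin n) : ℕ) < blockSize g * M}) {δ : ℝ}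
    (h0 : ∀ i : Fin n, min e'.1.1 e'.1.2 < i → inner ℂ (b i) (blockColumns H k ⟨_, e'.2⟩) = 0)
    (hδ : inner ℂ (b (min e'.1.1 e'.1.2)) (blockColumns H k ⟨_, e'.2⟩) = (δ : ℂ))
    (hle : min e'.1.1 e'.1.2 ≤ min e.1.1 e.1.2) :
    minorMatrix U hp k b H (Sum.inl e') (Sum.inl e) =
      (star (hermUnit e'.1 (max e'.1.1 e'.1.2) (min e'.1.1 e'.1.2)) *
        hermUnit e.1 (max e'.1.1 e'.1.2) (min e'.1.1 e'.1.2)).re * δ := by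
  rw [minorMatrix, Matrix.of_apply]
  simp only [minorTest, minorCoord, Sum.elim_inl]
  rw [inner_testVector U hU, blockCoeff_self, hermOf_hermCoord (isHermitian_rotatedUnit b e.1),
    inner_smul_left, inner_rotatedUnit, Finset.sum_eq_single (min e'.1.1 e'.1.2)]
  · rw [hδ, ← mul_assoc, Complex.re_mul_ofReal]; rfl
  · intro i _ hi
    rcases lt_or_gt_of_ne hi with hi | hi
    · rw [hermUnit_eq_zero (hi.trans_le hle), zero_mul]
    · rw [h0 i hi, mul_zero]
  · simp

lemma minorMatrix_inl_inr (hU : ∀ j, (U j)ᴴ * U j = 1)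
    (e' : {e : Fin n × Fin n // ((min e.1 e.2 : Fin n) : ℕ) < blockSize g * M}) (j : {j : Fin g // j ≠ k}) :
    minorMatrix U hp k b H (Sum.inl e') (Sum.inr j) = 0 := by
  rw [minorMatrix, Matrix.of_apply]
  simp only [minorTest, minorCoord, Sum.elim_inl, Sum.elim_inr]
  rw [inner_testVector U hU, blockCoeff_self, map_zero, Matrix.zero_mulVec]
  simp

lemma minorMatrix_inr_inl (hU : ∀ j, (U j)ᴴ * U j = 1) (j : {j : Fin g // j ≠ k})
    (e : {e : Fin n × Fin n // ((min e.1 e.2 : Fin n) : ℕ) < blockSize g * M}) :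
    minorMatrix U hp k b H (Sum.inr j) (Sum.inl e) = 0 := by
  rw [minorMatrix, Matrix.of_apply]
  simp only [minorTest, minorCoord, Sum.elim_inl, Sum.elim_inr]
  rw [inner_testVector U hU, blockCoeff_of_ne j.2]
  simp

lemma minorMatrix_inr_inr (hU : ∀ j, (U j)ᴴ * U j = 1) (j' j : {j : Fin g // j ≠ k}) :
    minorMatrix U hp k b H (Sum.inr j') (Sum.inr j) =
      if j' = j then ‖blockColumns H j.1 ⟨0, hp⟩‖ else 0 := by
  rw [minorMatrix, Matrix.of_apply]
  simp only [minorTest, minorCoord, Sum.elim_inr]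
  rw [inner_testVector U hU, blockCoeff_of_ne j'.2]
  simp only [Subtype.coe_eta, Pi.single_apply]
  split_ifs with h
  · subst h
    rw [Complex.ofReal_one, one_smul, Matrix.one_mulVec, inner_smul_left]
    have : inner ℂ (blockColumns H j'.1 ⟨0, hp⟩) (WithLp.toLp 2 (blockColumns H j'.1 ⟨0, hp⟩).ofLp) =
        ((‖blockColumns H j'.1 ⟨0, hp⟩‖ ^ 2 : ℝ) : ℂ) := by
      rw [WithLp.toLp_ofLp, inner_self_eq_norm_sq_to_K]; norm_cast
    rw [this, Complex.conj_ofReal, ← Complex.ofReal_mul, Complex.ofReal_re]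
    by_cases h0 : ‖blockColumns H j'.1 ⟨0, hp⟩‖ = 0
    · rw [h0]; simp
    · field_simp
  · simp

end Entries

end

/-! ### Size, determinant and column span of the minor -/

section

/-- The pairs form a hook with arms of lengths `n - c` and `n - 1 - c`. Their number is the exponent
of the distance in `columnWeight`. -/
lemma card_filter_min_eq {n : ℕ} (c : Fin n) :
    (Finset.univ.filter fun e : Fin n × Fin n => min e.1 e.2 = c).card = 2 * (n - 1 - c) + 1 := by
  have h1 : (Finset.univ.filter fun e : Fin n × Fin n => min e.1 e.2 = c) =
      ({c} ×ˢ Finset.Ici c) ∪ (Finset.Ioi c ×ˢ {c}) := by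
    ext ⟨a, b⟩
    simp only [Finset.mem_filter, Finset.mem_univ, true_and, Finset.mem_union, Finset.mem_product,
      Finset.mem_singleton, Finset.mem_Ici, Finset.mem_Ioi]
    rcases le_total a b with h | h
    · rw [min_eq_left h]; omega
    · rw [min_eq_right h]; omega
  rw [h1, Finset.card_union_of_disjoint, Finset.card_product, Finset.card_product]
  · simp only [Finset.card_singleton, Fin.card_Ici, Fin.card_Ioi]
    omega
  · rw [Finset.disjoint_left]
    rintro ⟨a, b⟩ h h'
    simp only [Finset.mem_product, Finset.mem_singleton, Finset.mem_Ici, Finset.mem_Ioi] at h h'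
    omega

/-- Grouping the pairs by their minimum recovers the powers; positions `a ≥ n` are the minimum of no
pair, which matches the factor `1`. -/
lemma columnWeight_eq_prod {n p : ℕ} (h : Fin p → EuclideanSpace ℂ (Fin n)) :
    columnWeight h = ∏ e : {e : Fin n × Fin n // ((min e.1 e.2 : Fin n) : ℕ) < p},
      (ENNReal.ofReal (columnDist h ⟨_, e.2⟩))⁻¹ := by
  rw [columnWeight, ← Finset.prod_fiberwise_of_maps_to (s := Finset.univ) (t := Finset.univ)
    (g := fun e : {e : Fin n × Fin n // ((min e.1 e.2 : Fin n) : ℕ) < p} =>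
      (⟨_, e.2⟩ : Fin p)) (by simp)]
  refine Finset.prod_congr rfl fun a _ => ?_
  rw [Finset.prod_congr rfl (g := fun _ => (ENNReal.ofReal (columnDist h a))⁻¹)
    fun e he => by rw [(Finset.mem_filter.1 he).2], Finset.prod_const]
  split_ifs with ha
  · congr 1
    rw [← card_filter_min_eq ⟨a, ha⟩]
    refine Finset.card_bij' (fun e he => ⟨e, ?_⟩) (fun e _ => e.1) ?_ ?_ ?_ ?_
    · rw [(Finset.mem_filter.1 he).2]; exact a.2
    · intro e he
      simp only [Finset.mem_filter, Finset.mem_univ, true_and] at he ⊢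
      have h' := Fin.ext_iff.1 he
      exact Fin.ext h'
    · intro e he
      simp only [Finset.mem_filter, Finset.mem_univ, true_and] at he ⊢
      have h' := Fin.ext_iff.1 he
      exact Fin.ext h'
    · intro e he; rfl
    · intro e he; rfl
  · rw [Finset.card_eq_zero.2, pow_zero]
    refine Finset.filter_eq_empty_iff.2 fun e _ he => ha ?_
    rw [← he]
    exact (min e.1.1 e.1.2).2

/-- The excluded pairs, with both members at least `p`, form a square of side `n - p`. -/
lemma card_minorIndex (n p : ℕ) {g : ℕ} (k : Fin g) :
    Fintype.card (MinorIndex n p k) = f n p + (g - 1) := by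
  rw [Fintype.card_sum, Fintype.card_subtype_compl, Fintype.card_subtype_eq, Fintype.card_fin]
  congr 1
  have h1 := Fintype.card_subtype_compl fun e : Fin n × Fin n => ((min e.1 e.2 : Fin n) : ℕ) < p
  have h2 : Fintype.card {e : Fin n × Fin n // ¬ ((min e.1 e.2 : Fin n) : ℕ) < p} =
      (n - p) ^ 2 := by
    rw [Fintype.card_subtype]
    have : (Finset.univ.filter fun e : Fin n × Fin n => ¬ ((min e.1 e.2 : Fin n) : ℕ) < p) =
        (Finset.univ.filter fun i : Fin n => p ≤ i) ×ˢ (Finset.univ.filter fun i : Fin n => p ≤ i) := by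
      ext ⟨a, b⟩
      simp only [Finset.mem_filter, Finset.mem_univ, true_and, Finset.mem_product]
      rcases le_total a b with h | h
      · rw [min_eq_left h]; omega
      · rw [min_eq_right h]; omega
    rw [this, Finset.card_product, ← pow_two]
    congr 1
    have h3 := Finset.card_filter_add_card_filter_not (s := (Finset.univ : Finset (Fin n)))
      (fun i : Fin n => (i : ℕ) < p)
    simp only [not_lt, Finset.card_univ, Fintype.card_fin] at h3
    rw [Fin.card_filter_val_lt] at h3
    omega
  have h4 := Fintype.card_subtype_le fun e : Fin n × Fin n => ((min e.1 e.2 : Fin n) : ℕ) < p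
  rw [h2] at h1
  simp only [Fintype.card_prod, Fintype.card_fin] at h1 h4
  rw [f, pow_two n]
  omega

variable {n g M : ℕ} (U : Fin g → Matrix (Fin (blockSize g)) (Fin (blockSize g)) ℂ)

/-- The columns of the minor come from a spanning set of the column space. -/
lemma realVecL_groupMatrix_mem_span (k : Fin g) (b : OrthonormalBasis (Fin n) ℂ (EuclideanSpace ℂ (Fin n)))
    (H : Antenna n g → Fin M → ℂ)
    (hb : ∀ (a : Fin (blockSize g * M)) (i : Fin n), (a : ℕ) < i →
      inner ℂ (b i) (blockColumns H k a) = 0) (y : GroupCoord n k) :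
    realVecL (groupMatrix U k y * Matrix.of H) ∈ Submodule.span ℝ
      (Set.range fun l : MinorIndex n (blockSize g * M) k =>
        realVecL (groupMatrix U k (minorCoord k b l) * Matrix.of H)) := by
  set Φ : GroupCoord n k →ₗ[ℝ] EuclideanSpace ℝ ((Fin M × Antenna n g) ⊕ (Fin M × Antenna n g)) :=
    { toFun := fun x => realVecL (groupMatrix U k x * Matrix.of H)
      map_add' := fun x y => by rw [map_add, Matrix.add_mul, map_add]
      map_smul' := fun c x => by rw [map_smul, Matrix.smul_mul, map_smul]; rfl } with hΦ
  change Φ y ∈ Submodule.span ℝ (Set.range fun l => Φ (minorCoord k b l))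
  obtain ⟨c, hc⟩ := exists_hermOf_eq_sum_rotatedUnit b y.1
  have hy : y = ∑ e, c e • ((hermCoord (rotatedUnit b e), 0) : GroupCoord n k) +
      ∑ j, y.2 j • ((0, Pi.single j 1) : GroupCoord n k) := by
    refine Prod.ext ?_ ?_
    · simp only [Prod.fst_add, Prod.fst_sum, Prod.smul_fst, smul_zero, Finset.sum_const_zero,
        add_zero]
      rw [← hermCoord_hermOf y.1, hc]
      funext α β
      simp only [hermCoord, Matrix.sum_apply, Complex.re_sum, Complex.im_sum, Finset.sum_apply,
        Pi.smul_apply, Matrix.smul_apply, Complex.smul_re, Complex.smul_im, smul_eq_mul, mul_add,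
        Finset.sum_add_distrib]
    · simp only [Prod.snd_add, Prod.snd_sum, Prod.smul_snd, smul_zero, Finset.sum_const_zero,
        zero_add]
      exact pi_eq_sum_univ' y.2
  rw [hy, map_add, map_sum, map_sum]
  refine Submodule.add_mem _ (Submodule.sum_mem _ fun e _ => ?_)
    (Submodule.sum_mem _ fun j _ => ?_)
  · rw [map_smul]
    refine Submodule.smul_mem _ _ ?_
    by_cases he : ((min e.1 e.2 : Fin n) : ℕ) < blockSize g * M
    · exact Submodule.subset_span ⟨Sum.inl ⟨e, he⟩, rfl⟩
    -- This is the source of the rank deficiency: all vectors of block `k` lie in the directions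
    -- before `mM`, where a unit with minimum at least `mM` has only zero columns.
    · have : Φ (hermCoord (rotatedUnit b e), 0) = 0 := by
        refine realVecL_groupMatrix_mul_eq_zero U k _ H fun j a => ?_
        by_cases hj : j = k
        · subst hj
          rw [blockCoeff_self, hermOf_hermCoord (isHermitian_rotatedUnit b e)]
          have h1 : (WithLp.toLp 2 (rotatedUnit b e *ᵥ blockColumns H j a) :
              EuclideanSpace ℂ (Fin n)) = 0 := by
            refine b.repr.map_eq_zero_iff.1 ?_
            ext m
            rw [b.repr_apply_apply, inner_rotatedUnit]
            refine Finset.sum_eq_zero fun i _ => ?_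
            rcases lt_or_ge i (min e.1 e.2) with hi | hi
            · rw [hermUnit_eq_zero hi, zero_mul]
            · rw [hb a i (by have := a.2; omega), mul_zero]
          exact congrArg WithLp.ofLp h1
        · rw [blockCoeff_of_ne hj]; simp
      rw [this]
      exact Submodule.zero_mem _
  · rw [map_smul]
    exact Submodule.smul_mem _ _ (Submodule.subset_span ⟨Sum.inr j, rfl⟩)

/-- The matrix is triangular when sorted by `min`. Each diagonal entry of block `k` is at least half
a distance, which costs a factor `2` for at most `n ^ 2` entries; the entries of the other blocks
are exactly the norms in the weight. -/
lemma inv_ofReal_abs_det_minorMatrix_le (hU : ∀ j, (U j)ᴴ * U j = 1) (hp : 0 < blockSize g * M)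
    (k : Fin g) (b : OrthonormalBasis (Fin n) ℂ (EuclideanSpace ℂ (Fin n)))
    (H : Antenna n g → Fin M → ℂ)
    (hb : ∀ a : Fin (blockSize g * M),
      (∀ i : Fin n, (a : ℕ) < i → inner ℂ (b i) (blockColumns H k a) = 0) ∧
      ∀ ha : (a : ℕ) < n, ∃ δ : ℝ, columnDist (blockColumns H k) a ≤ δ ∧
        inner ℂ (b ⟨a, ha⟩) (blockColumns H k a) = (δ : ℂ)) :
    (ENNReal.ofReal |(minorMatrix U hp k b H).det|)⁻¹ ≤ 2 ^ (n ^ 2) * channelWeight hp k H := by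
  have hdet : (minorMatrix U hp k b H).det = ∏ l, minorMatrix U hp k b H l l := by
    -- The indices of the other blocks are coupled to nothing, so any rank would do for them.
    refine det_eq_prod_of_le _ (Sum.elim (fun e => ((min e.1.1 e.1.2 : Fin n) : ℕ)) fun _ => 0) ?_
    rintro (e' | j') (e | j) hne hle
    · obtain ⟨δ, -, hδ⟩ := (hb ⟨_, e'.2⟩).2 (min e'.1.1 e'.1.2).2
      rw [minorMatrix_inl_inl U hp k b H hU e' e (hb ⟨_, e'.2⟩).1 hδ hle]
      rcases (Fin.le_def.2 hle).lt_or_eq with hlt | heq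
      · rw [hermUnit_eq_zero hlt]; simp
      · rw [re_hermUnit_mul_of_ne (fun h => hne (by rw [Subtype.ext h])) heq.symm, zero_mul]
    · exact minorMatrix_inl_inr U hp k b H hU _ _
    · exact minorMatrix_inr_inl U hp k b H hU _ _
    · rw [minorMatrix_inr_inr U hp k b H hU, if_neg (fun h => hne (by rw [h]))]
  have hdiag : ∀ e : {e : Fin n × Fin n // ((min e.1 e.2 : Fin n) : ℕ) < blockSize g * M},
      1 / 2 * columnDist (blockColumns H k) ⟨_, e.2⟩ ≤
        |minorMatrix U hp k b H (Sum.inl e) (Sum.inl e)| := by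
    intro e
    obtain ⟨δ, hle, hδ⟩ := (hb ⟨_, e.2⟩).2 (min e.1.1 e.1.2).2
    have hδ0 : 0 ≤ columnDist (blockColumns H k) ⟨_, e.2⟩ := Metric.infDist_nonneg
    rw [minorMatrix_inl_inl U hp k b H hU e e (hb ⟨_, e.2⟩).1 hδ le_rfl]
    refine le_trans ?_ (le_abs_self _)
    exact mul_le_mul (half_le_re_hermUnit_mul e.1) hle hδ0
      (le_trans (by norm_num) (half_le_re_hermUnit_mul e.1))
  rw [hdet, Fintype.prod_sum_type, abs_mul, Finset.abs_prod, Finset.abs_prod,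
    ENNReal.ofReal_mul (Finset.prod_nonneg fun _ _ => abs_nonneg _),
    ENNReal.ofReal_prod_of_nonneg fun _ _ => abs_nonneg _,
    ENNReal.ofReal_prod_of_nonneg fun _ _ => abs_nonneg _,
    ENNReal.mul_inv (Or.inr (ENNReal.prod_ne_top fun _ _ => ENNReal.ofReal_ne_top))
      (Or.inl (ENNReal.prod_ne_top fun _ _ => ENNReal.ofReal_ne_top)),
    ENNReal.prod_inv_distrib fun _ _ _ _ _ => Or.inr ENNReal.ofReal_ne_top,
    ENNReal.prod_inv_distrib fun _ _ _ _ _ => Or.inr ENNReal.ofReal_ne_top]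
  have hcw : channelWeight hp k H = columnWeight (blockColumns H k) *
      ∏ j : {j : Fin g // j ≠ k}, (ENNReal.ofReal ‖blockColumns H j.1 ⟨0, hp⟩‖)⁻¹ := by
    rw [channelWeight, Fintype.prod_eq_mul_prod_subtype_ne _ k, if_pos rfl]
    congr 1
    exact Finset.prod_congr rfl fun j _ => if_neg j.2
  rw [hcw, ← mul_assoc, columnWeight_eq_prod]
  refine mul_le_mul' ?_ (le_of_eq (Finset.prod_congr rfl fun j _ => ?_))
  · refine (Finset.prod_le_prod' (g := fun e => 2 *
      (ENNReal.ofReal (columnDist (blockColumns H k) ⟨_, e.2⟩))⁻¹) fun e _ => ?_).trans ?_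
    · refine (ENNReal.inv_le_inv.2 (ENNReal.ofReal_le_ofReal (hdiag e))).trans_eq ?_
      rw [ENNReal.ofReal_mul (by norm_num), ENNReal.mul_inv (Or.inr ENNReal.ofReal_ne_top)
        (Or.inl ENNReal.ofReal_ne_top)]
      congr 1
      rw [one_div, ENNReal.ofReal_inv_of_pos (by norm_num), inv_inv]
      norm_num
    · rw [Finset.prod_mul_distrib, Finset.prod_const]
      refine mul_le_mul' (pow_le_pow_right₀ (by norm_num) ?_) le_rfl
      rw [Finset.card_univ]
      refine (Fintype.card_subtype_le _).trans_eq ?_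
      simp [pow_two]
  · rw [minorMatrix_inr_inr U hp k b H hU, if_pos rfl, abs_norm]

end

/-! ### Rank and complexity for a single channel -/

lemma exists_norm_le_mul {E F : Type*} [NormedAddCommGroup E] [NormedSpace ℝ E]
    [FiniteDimensional ℝ E] [NormedAddCommGroup F] [NormedSpace ℝ F] (L : E →ₗ[ℝ] F) :
    ∃ K : ℝ, 0 < K ∧ ∀ x, ‖L x‖ ≤ K * ‖x‖ := by
  refine ⟨‖LinearMap.toContinuousLinearMap L‖ + 1, by positivity, fun x => ?_⟩
  refine ((LinearMap.toContinuousLinearMap L).le_opNorm x).trans ?_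
  gcongr
  linarith

section Rank

variable {n g M : ℕ} {A : Fin g → Fin (groupSize n g) → Matrix (Antenna n g) (Antenna n g) ℂ}
  {U : Fin g → Matrix (Fin (blockSize g)) (Fin (blockSize g)) ℂ} {k : Fin g}

/-- A zero determinant has infinite reciprocal, against the bound by a finite weight. -/
lemma det_minorMatrix_ne_zero (hU : ∀ j, (U j)ᴴ * U j = 1) (hp : 0 < blockSize g * M)
    {b : OrthonormalBasis (Fin n) ℂ (EuclideanSpace ℂ (Fin n))} {H : Antenna n g → Fin M → ℂ}
    (hb : ∀ a : Fin (blockSize g * M),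
      (∀ i : Fin n, (a : ℕ) < i → inner ℂ (b i) (blockColumns H k a) = 0) ∧
      ∀ ha : (a : ℕ) < n, ∃ δ : ℝ, columnDist (blockColumns H k) a ≤ δ ∧
        inner ℂ (b ⟨a, ha⟩) (blockColumns H k a) = (δ : ℂ))
    (hH : channelWeight hp k H < ∞) : (minorMatrix U hp k b H).det ≠ 0 := by
  intro h0
  have h1 := inv_ofReal_abs_det_minorMatrix_le U hU hp k b H hb
  rw [h0, abs_zero, ENNReal.ofReal_zero, ENNReal.inv_zero, top_le_iff] at h1
  exact (ENNReal.mul_lt_top (ENNReal.pow_lt_top ENNReal.ofNat_lt_top) hH).ne h1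

/-- The rank of the channel submatrix of group `k`, for all channels where the controlling minor
does not vanish. -/
lemma finrank_span_channel (hU : ∀ j, (U j)ᴴ * U j = 1) (hp : 0 < blockSize g * M)
    (B : Module.Basis (Fin (groupSize n g)) ℝ (GroupCoord n k))
    (hB : ∀ i, A k i = groupMatrix U k (B i)) {H : Antenna n g → Fin M → ℂ}
    (hH : channelWeight hp k H < ∞) :
    Module.finrank ℝ (Submodule.span ℝ (Set.range fun i =>
      (realVecL (A k i * Matrix.of H) :
        EuclideanSpace ℝ ((Fin M × Antenna n g) ⊕ (Fin M × Antenna n g))))) =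
      f n (blockSize g * M) + (g - 1) := by
  obtain ⟨b, hb⟩ := exists_orthonormalBasis_triangular (blockColumns H k)
  have hdet := det_minorMatrix_ne_zero hU hp hb hH
  let v : MinorIndex n (blockSize g * M) k → EuclideanSpace ℝ _ := fun l =>
    realVecL (groupMatrix U k (minorCoord k b l) * Matrix.of H)
  have hspan : Submodule.span ℝ (Set.range fun i => (realVecL (A k i * Matrix.of H) :
      EuclideanSpace ℝ ((Fin M × Antenna n g) ⊕ (Fin M × Antenna n g)))) =
      Submodule.span ℝ (Set.range v) := by
    refine le_antisymm (Submodule.span_le.2 ?_) (Submodule.span_le.2 ?_)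
    · rintro _ ⟨i, rfl⟩
      simp only [hB]
      exact realVecL_groupMatrix_mem_span U k b H (fun a => (hb a).1) (B i)
    · rintro _ ⟨l, rfl⟩
      have : v l = ∑ i, B.repr (minorCoord k b l) i • realVecL (A k i * Matrix.of H) := by
        simp only [v, hB, ← map_smul, ← Matrix.smul_mul, ← map_sum, ← Matrix.sum_mul,
          B.sum_repr]
      rw [this]
      exact Submodule.sum_mem _ fun i _ => Submodule.smul_mem _ _ (Submodule.subset_span ⟨i, rfl⟩)
  have hli : LinearIndependent ℝ v := by
    rw [Fintype.linearIndependent_iff]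
    intro c hc
    -- Testing a linear relation among the columns against `minorTest` gives a vector in the kernel
    -- of an invertible matrix.
    refine congrFun (Matrix.eq_zero_of_mulVec_eq_zero hdet ?_)
    funext l'
    have h1 : inner ℝ (minorTest U hp k b H l') (∑ l, c l • v l) = 0 := by
      rw [hc, inner_zero_right]
    rw [inner_sum] at h1
    rw [Matrix.mulVec, dotProduct, Pi.zero_apply, ← h1]
    refine Finset.sum_congr rfl fun l _ => ?_
    rw [inner_smul_right, mul_comm]
    rfl
  rw [hspan, finrank_span_eq_card hli, card_minorIndex]

lemma card_pivots_groupColumns (hU : ∀ j, (U j)ᴴ * U j = 1) (hp : 0 < blockSize g * M)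
    (B : Module.Basis (Fin (groupSize n g)) ℝ (GroupCoord n k))
    (hB : ∀ i, A k i = groupMatrix U k (B i)) {H : Antenna n g → Fin M → ℂ}
    (hH : channelWeight hp k H < ∞)
    {Θ : Fin g → Matrix (Fin (groupSize n g)) (Fin (groupSize n g)) ℝ}
    (hΘ : IsUnit (Θ k).det) :
    (pivots (groupColumns A Θ (Matrix.of H) k)).card = f n (blockSize g * M) + (g - 1) := by
  rw [card_pivots, span_groupColumns A Θ _ k hΘ, finrank_span_channel hU hp B hB hH]

lemma groupSize_sub (n g p : ℕ) : groupSize n g - (f n p + (g - 1)) = (n - p) ^ 2 := by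
  have : (n - p) ^ 2 ≤ n ^ 2 := Nat.pow_le_pow_left (Nat.sub_le n p) 2
  rw [groupSize, f]
  omega

/-- The number of nodes visited by the decoder of group `k` is at most the claimed power of the
alphabet size, up to factors with finite expectation. -/
lemma exists_decoderNodes_le (hn : 1 ≤ n)
    (hA : ∀ k k' i i', k ≠ k' → (A k i)ᴴ * A k' i' + (A k' i')ᴴ * A k i = 0)
    (hU : ∀ j, (U j)ᴴ * U j = 1) (hp : 0 < blockSize g * M)
    (B : Module.Basis (Fin (groupSize n g)) ℝ (GroupCoord n k))
    (hB : ∀ i, A k i = groupMatrix U k (B i))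
    (Θ : Fin g → Matrix (Fin (groupSize n g)) (Fin (groupSize n g)) ℝ)
    (hΘ : IsUnit (Θ k).det) {r : ℝ} (hr : 0 < r) :
    ∃ C : ℝ, ∀ (S : Finset ℤ) (s : Fin g → Fin (groupSize n g) → ℤ), (∀ k i, s k i ∈ S) →
      ∀ H : Antenna n g → Fin M → ℂ, channelWeight hp k H < ∞ → ∀ W : Antenna n g → Fin M → ℂ,
      (decoderNodes (groupColumns A Θ (Matrix.of H) k)
        (WithLp.toLp 2 (realVec (codeword A Θ s * Matrix.of H + Matrix.of W))) S r : ℝ≥0∞) ≤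
      ENNReal.ofReal ((S.card : ℝ) ^ ((n - blockSize g * M) ^ 2)) * (ENNReal.ofReal C *
        (ENNReal.ofReal ((1 + ‖H‖) ^ (2 * groupSize n g)) * channelWeight hp k H)) *
        ENNReal.ofReal ((1 + ‖W‖) ^ (2 * groupSize n g + 1)) := by
  have hd1 : 1 ≤ groupSize n g := by
    have : 0 < n ^ 2 := by positivity
    rw [groupSize]; omega
  -- `Z` gives the coefficients of a parameter with respect to the columns of `G_k Θ_k`; it does not
  -- depend on the channel. Through it the minor becomes a test determinant of the decoder.
  let Z : GroupCoord n k →ₗ[ℝ] (Fin (groupSize n g) → ℝ) := (Θ k)⁻¹.mulVecLin ∘ₗ B.equivFun.toLinearMap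
  obtain ⟨Kz, hKz, hZ⟩ := exists_norm_le_mul Z
  have hG : ∃ K : ℝ, 0 < K ∧ ∀ (H : Antenna n g → Fin M → ℂ) (j : Fin (groupSize n g)),
      ‖groupColumns A Θ (Matrix.of H) k j‖ ≤ K * ‖H‖ := by
    let L : Fin (groupSize n g) → ((Antenna n g → Fin M → ℂ) →ₗ[ℝ] EuclideanSpace ℝ
        ((Fin M × Antenna n g) ⊕ (Fin M × Antenna n g))) := fun j =>
      { toFun := fun H => realVecL ((∑ i, Θ k i j • A k i) * Matrix.of H)
        map_add' := fun H H' => by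
          rw [← map_add, ← Matrix.mul_add]; rfl
        map_smul' := fun c H => by
          rw [RingHom.id_apply, ← map_smul, ← Matrix.mul_smul]; rfl }
    obtain ⟨K, hK, hL⟩ := exists_norm_le_mul (LinearMap.pi L)
    refine ⟨K, hK, fun H j => ?_⟩
    rw [groupColumns_eq]
    exact (norm_le_pi_norm (LinearMap.pi L H) j).trans (hL H)
  obtain ⟨K, hK, hG⟩ := hG
  have hW : ∃ K : ℝ, 0 < K ∧ ∀ W : Antenna n g → Fin M → ℂ, ‖(realVecL (Matrix.of W) :
      EuclideanSpace ℝ ((Fin M × Antenna n g) ⊕ (Fin M × Antenna n g)))‖ ≤ K * ‖W‖ := by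
    let L : (Antenna n g → Fin M → ℂ) →ₗ[ℝ] EuclideanSpace ℝ
        ((Fin M × Antenna n g) ⊕ (Fin M × Antenna n g)) :=
      { toFun := fun W => realVecL (Matrix.of W)
        map_add' := fun W W' => map_add realVecL (Matrix.of W) (Matrix.of W')
        map_smul' := fun c W => map_smul realVecL c (Matrix.of W) }
    exact exists_norm_le_mul L
  obtain ⟨Kw, hKw, hW⟩ := hW
  -- The orthonormal basis `b` varies with the channel, but the parameters `minorCoord` are bounded
  -- uniformly in it, so `ξ` is a constant.
  set ξ : ℝ := Kz * (2 * (n : ℝ) ^ 2 + 1) + 1 with hξ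
  have hξ1 : 1 ≤ ξ := by
    have : 0 ≤ Kz * (2 * (n : ℝ) ^ 2 + 1) := by positivity
    linarith
  obtain ⟨C, hC, hdec⟩ := decoderNodes_mul_abs_det_le (d := groupSize n g)
    (E := EuclideanSpace ℝ ((Fin M × Antenna n g) ⊕ (Fin M × Antenna n g))) hr hξ1 hd1
  refine ⟨C * (1 + Kw) ^ (2 * groupSize n g + 1) * (1 + K) ^ (2 * groupSize n g) * 2 ^ (n ^ 2),
    fun S s hs H hH W => ?_⟩
  obtain ⟨b, hb⟩ := exists_orthonormalBasis_triangular (blockColumns H k)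
  have hdet := det_minorMatrix_ne_zero hU hp hb hH
  have hcard := card_pivots_groupColumns hU hp B hB hH hΘ
  set c := groupColumns A Θ (Matrix.of H) k with hc
  set y : EuclideanSpace ℝ ((Fin M × Antenna n g) ⊕ (Fin M × Antenna n g)) :=
    WithLp.toLp 2 (realVec (codeword A Θ s * Matrix.of H + Matrix.of W)) with hy
  have hmain := hdec c y S (s k) (K * ‖H‖) (Kw * ‖W‖) (hG H) (by positivity) (hs k)
    ((fullMetric_received_le A Θ (Matrix.of H) k hA s (Matrix.of W)).trans
      (pow_le_pow_left₀ (norm_nonneg _) (hW W) 2))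
    (MinorIndex n (blockSize g * M) k) (minorTest U hp k b H)
    (Matrix.of fun j l => Z (minorCoord k b l) j)
    (by rw [hcard, card_minorIndex]) (norm_minorTest_le U hU hp k b H) (fun j l => by
      rw [Matrix.of_apply, ← Real.norm_eq_abs]
      refine (norm_le_pi_norm _ j).trans ((hZ _).trans ?_)
      have := mul_le_mul_of_nonneg_left (norm_minorCoord_le k b l) hKz.le
      linarith)
  have hT : (Matrix.of fun l' l => inner ℝ (minorTest U hp k b H l')
      (∑ j, (Matrix.of fun j l => Z (minorCoord k b l) j) j l • c j)) =
      minorMatrix U hp k b H := by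
    ext l' l
    simp only [Matrix.of_apply, minorMatrix]
    rw [hc, sum_smul_groupColumns]
    congr 3
    simp only [Z, LinearMap.comp_apply, Matrix.mulVecLin_apply, Matrix.mulVec_mulVec,
      Matrix.mul_nonsing_inv _ hΘ, Matrix.one_mulVec, hB, LinearEquiv.coe_coe, ← map_smul,
      ← map_sum, B.sum_equivFun]
  rw [hT, hcard, groupSize_sub] at hmain
  have hreal : (decoderNodes c y S r : ℝ) * |(minorMatrix U hp k b H).det| ≤
      (S.card : ℝ) ^ ((n - blockSize g * M) ^ 2) * (C * (1 + Kw) ^ (2 * groupSize n g + 1) * (1 + K) ^ (2 * groupSize n g) *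
        (1 + ‖H‖) ^ (2 * groupSize n g)) * (1 + ‖W‖) ^ (2 * groupSize n g + 1) := by
    refine hmain.trans ?_
    have h1 : 1 + Kw * ‖W‖ ≤ (1 + Kw) * (1 + ‖W‖) := by nlinarith [norm_nonneg W]
    have h2 : 1 + K * ‖H‖ ≤ (1 + K) * (1 + ‖H‖) := by nlinarith [norm_nonneg H]
    calc C * (1 + Kw * ‖W‖) ^ (2 * groupSize n g + 1) * (1 + K * ‖H‖) ^ (2 * groupSize n g) *
          (S.card : ℝ) ^ ((n - blockSize g * M) ^ 2) ≤
        C * ((1 + Kw) * (1 + ‖W‖)) ^ (2 * groupSize n g + 1) * ((1 + K) * (1 + ‖H‖)) ^ (2 * groupSize n g) *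
          (S.card : ℝ) ^ ((n - blockSize g * M) ^ 2) := by gcongr
      _ = _ := by rw [mul_pow, mul_pow]; ring
  have hpos : 0 < |(minorMatrix U hp k b H).det| := abs_pos.2 hdet
  -- Divide by the nonzero determinant and replace its reciprocal by the integrable weight.
  calc (decoderNodes c y S r : ℝ≥0∞)
      ≤ ENNReal.ofReal ((S.card : ℝ) ^ ((n - blockSize g * M) ^ 2) * (C * (1 + Kw) ^ (2 * groupSize n g + 1) *
          (1 + K) ^ (2 * groupSize n g) * (1 + ‖H‖) ^ (2 * groupSize n g)) * (1 + ‖W‖) ^ (2 * groupSize n g + 1)) *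
        (ENNReal.ofReal |(minorMatrix U hp k b H).det|)⁻¹ := by
        rw [← div_eq_mul_inv, ENNReal.le_div_iff_mul_le (Or.inl (by simpa using hdet))
          (Or.inl ENNReal.ofReal_ne_top), ← ENNReal.ofReal_natCast,
          ← ENNReal.ofReal_mul (Nat.cast_nonneg _)]
        exact ENNReal.ofReal_le_ofReal hreal
    _ ≤ ENNReal.ofReal ((S.card : ℝ) ^ ((n - blockSize g * M) ^ 2) * (C * (1 + Kw) ^ (2 * groupSize n g + 1) *
          (1 + K) ^ (2 * groupSize n g) * (1 + ‖H‖) ^ (2 * groupSize n g)) * (1 + ‖W‖) ^ (2 * groupSize n g + 1)) *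
        (2 ^ (n ^ 2) * channelWeight hp k H) :=
        mul_le_mul' le_rfl (inv_ofReal_abs_det_minorMatrix_le U hU hp k b H hb)
    _ = _ := by
        rw [ENNReal.ofReal_mul (by positivity), ENNReal.ofReal_mul (by positivity),
          ENNReal.ofReal_mul (by positivity), ENNReal.ofReal_mul (q := 2 ^ (n ^ 2)) (by positivity),
          ENNReal.ofReal_pow (p := 2) (by norm_num), ENNReal.ofReal_ofNat]
        ring

end Rank

section

/-! ### Averaging over the channel and the noise -/

lemma lintegral_pow_gaussianMatrix_lt_top (ν μ : Type*) [Fintype ν] [Fintype μ] (K : ℕ) :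
    ∫⁻ W, ENNReal.ofReal ((1 + ‖W‖) ^ K) ∂(gaussianMatrix ν μ) < ∞ := by
  obtain ⟨C, hC, hle⟩ := lintegral_pow_mul_gaussianMatrix_le ν μ K
  have h1 := hle fun _ => 1
  simp only [mul_one, one_mul] at h1
  have : (volume : Measure (ν → μ → ℂ)).IsAddHaarMeasure := Measure.pi.isAddHaarMeasure _
  refine h1.trans_lt (ENNReal.mul_lt_top hC.lt_top ((lintegral_mono fun W => ?_).trans_lt
    (lintegral_exp_norm_lt_top (volume : Measure (ν → μ → ℂ)) (b := 1 / 2) (by norm_num))))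
  refine ENNReal.ofReal_le_ofReal (Real.exp_le_exp.2 ?_)
  linarith [norm_sq_le_sum W]

variable {n g M : ℕ} {A : Fin g → Fin (groupSize n g) → Matrix (Antenna n g) (Antenna n g) ℂ}

/-- A finite expectation forces almost sure finiteness, so the generic rank needs no separate
argument about zero sets of polynomials. -/
lemma ae_channelWeight_lt_top (hn : 1 ≤ n) (hp : 0 < blockSize g * M) (k : Fin g) :
    ∀ᵐ H ∂(gaussianMatrix (Antenna n g) (Fin M)), channelWeight hp k H < ∞ := by
  have h := lintegral_channelWeight_lt_top (M := M) hn hp k 0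
  simp only [pow_zero, ENNReal.ofReal_one, one_mul] at h
  exact ae_lt_top (measurable_channelWeight hp k) h.ne

/-- The channel submatrix of each group has almost surely rank `f n (m * M) + g - 1`. -/
theorem IsDelayOptimalCode.ae_rank_equivChannel (hn : 1 ≤ n) (hp : 0 < blockSize g * M)
    (hA : IsDelayOptimalCode A) (k : Fin g) :
    ∀ᵐ H ∂(gaussianMatrix (Antenna n g) (Fin M)),
      (equivChannel (A k) (Matrix.of H)).rank = f n (blockSize g * M) + (g - 1) := by
  obtain ⟨U, hU, -, hB⟩ := hA.exists_basis hn
  obtain ⟨B, hB⟩ := hB k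
  filter_upwards [ae_channelWeight_lt_top hn hp k] with H hH
  rw [rank_equivChannel, finrank_span_channel (fun j => hU j k) hp B hB hH]

/-- The bound holds pointwise for almost every channel and every noise, already for the decoder of
one group. -/
lemma IsDelayOptimalCode.le_avgComplexity (hn : 1 ≤ n) (hg : 1 ≤ g) (hp : 0 < blockSize g * M)
    (hA : IsDelayOptimalCode A)
    {Θ : Fin g → Matrix (Fin (groupSize n g)) (Fin (groupSize n g)) ℝ}
    (hΘ : ∀ k, IsUnit (Θ k).det) (S : Finset ℤ) (r : ℝ) (s : Fin g → Fin (groupSize n g) → ℤ) :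
    ENNReal.ofReal ((S.card : ℝ) ^ ((n - blockSize g * M) ^ 2)) ≤
      avgComplexity (Fin M) A Θ S r s := by
  let k : Fin g := ⟨0, hg⟩
  obtain ⟨U, hU, -, hB⟩ := hA.exists_basis hn
  obtain ⟨B, hB⟩ := hB k
  set q := ENNReal.ofReal ((S.card : ℝ) ^ ((n - blockSize g * M) ^ 2)) with hq
  calc q = ∫⁻ _ : Antenna n g → Fin M → ℂ, ∫⁻ _ : Antenna n g → Fin M → ℂ, q
        ∂(gaussianMatrix (Antenna n g) (Fin M)) ∂(gaussianMatrix (Antenna n g) (Fin M)) := by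
        simp
    _ ≤ _ := by
      refine lintegral_mono_ae ?_
      filter_upwards [ae_channelWeight_lt_top hn hp k] with H hH
      refine lintegral_mono fun W => ?_
      have h1 := le_decoderNodes (groupColumns A Θ (Matrix.of H) k)
        (WithLp.toLp 2 (realVec (codeword A Θ s * Matrix.of H + Matrix.of W))) S r
      rw [card_pivots_groupColumns (fun j => hU j k) hp B hB hH (hΘ k), groupSize_sub] at h1
      rw [hq, ← Nat.cast_pow, ENNReal.ofReal_natCast]
      refine Nat.cast_le.2 (h1.trans ?_)
      exact Finset.single_le_sum (f := fun k => decoderNodes (groupColumns A Θ (Matrix.of H) k)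
        (WithLp.toLp 2 (realVec (codeword A Θ s * Matrix.of H + Matrix.of W))) S r)
        (fun _ _ => Nat.zero_le _) (Finset.mem_univ k)

/-- Only finite constants are pulled out of the integrals over `x`, so `F` need not be measurable.
-/
lemma lintegral_lintegral_mul_mul {α β : Type*} [MeasurableSpace α] [MeasurableSpace β]
    (μ : Measure α) (ν : Measure β) {q : ℝ≥0∞} (hq : q ≠ ∞) (F : α → ℝ≥0∞) {G : β → ℝ≥0∞}
    (hGm : Measurable G) (hG : ∫⁻ y, G y ∂ν ≠ ∞) :
    ∫⁻ x, ∫⁻ y, q * F x * G y ∂ν ∂μ = q * ((∫⁻ x, F x ∂μ) * ∫⁻ y, G y ∂ν) := by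
  simp only [lintegral_const_mul _ hGm]
  rw [lintegral_mul_const' _ _ hG, lintegral_const_mul' _ _ hq, mul_assoc]

lemma lintegral_sum_channelWeight_lt_top (hn : 1 ≤ n) (hp : 0 < blockSize g * M) (C : Fin g → ℝ)
    (K : ℕ) : ∫⁻ H, ∑ k, ENNReal.ofReal (C k) *
      (ENNReal.ofReal ((1 + ‖H‖) ^ K) * channelWeight hp k H)
      ∂(gaussianMatrix (Antenna n g) (Fin M)) < ∞ := by
  have hFm : ∀ k, Measurable fun H : Antenna n g → Fin M → ℂ =>
      ENNReal.ofReal ((1 + ‖H‖) ^ K) * channelWeight hp k H := fun k =>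
    Measurable.mul ((measurable_norm.const_add 1).pow_const K).ennreal_ofReal
      (measurable_channelWeight hp k)
  rw [lintegral_finsetSum _ fun k _ => (hFm k).const_mul _]
  refine ENNReal.sum_lt_top.2 fun k _ => ?_
  rw [lintegral_const_mul _ (hFm k)]
  exact ENNReal.mul_lt_top ENNReal.ofReal_lt_top (lintegral_channelWeight_lt_top hn hp k _)

lemma IsDelayOptimalCode.exists_avgComplexity_le (hn : 1 ≤ n) (hp : 0 < blockSize g * M)
    (hA : IsDelayOptimalCode A)
    {Θ : Fin g → Matrix (Fin (groupSize n g)) (Fin (groupSize n g)) ℝ}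
    (hΘ : ∀ k, IsUnit (Θ k).det) {r : ℝ} (hr : 0 < r) :
    ∃ C : ℝ, 0 < C ∧ ∀ (S : Finset ℤ) (s : Fin g → Fin (groupSize n g) → ℤ),
      (∀ k i, s k i ∈ S) → avgComplexity (Fin M) A Θ S r s ≤
        ENNReal.ofReal (C * (S.card : ℝ) ^ ((n - blockSize g * M) ^ 2)) := by
  obtain ⟨U, hU, -, hB⟩ := hA.exists_basis hn
  choose B hB using hB
  choose C hC using fun k => exists_decoderNodes_le hn (hA.orthogonal hn) (fun j => hU j k) hp
    (B k) (hB k) Θ (hΘ k) hr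
  have hF := lintegral_sum_channelWeight_lt_top hn hp C (2 * groupSize n g)
  have hG := lintegral_pow_gaussianMatrix_lt_top (Antenna n g) (Fin M) (2 * groupSize n g + 1)
  have hGm : Measurable fun W : Antenna n g → Fin M → ℂ =>
      ENNReal.ofReal ((1 + ‖W‖) ^ (2 * groupSize n g + 1)) :=
    ((measurable_norm.const_add 1).pow_const _).ennreal_ofReal
  obtain ⟨x, hx⟩ := ENNReal.lt_iff_exists_coe.1 (ENNReal.mul_lt_top hF hG) |>.imp fun _ h => h.1
  -- The summand `1` only serves to make the constant positive.
  refine ⟨x + 1, by positivity, fun S s hs => ?_⟩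
  have hq : ENNReal.ofReal ((S.card : ℝ) ^ ((n - blockSize g * M) ^ 2)) ≠ ∞ :=
    ENNReal.ofReal_ne_top
  have hle : avgComplexity (Fin M) A Θ S r s ≤
      ENNReal.ofReal ((S.card : ℝ) ^ ((n - blockSize g * M) ^ 2)) * x := by
    rw [← hx, ← lintegral_lintegral_mul_mul _ _ hq _ hGm hG.ne]
    refine lintegral_mono_ae ?_
    filter_upwards [ae_all_iff.2 fun k => ae_channelWeight_lt_top hn hp k] with H hH
    refine lintegral_mono fun W => ?_
    rw [codeNodes, Nat.cast_sum, Finset.mul_sum, Finset.sum_mul]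
    exact Finset.sum_le_sum fun k _ => hC k S s hs H (hH k) W
  refine hle.trans ?_
  rw [mul_comm (_ + 1), ENNReal.ofReal_mul (by positivity)]
  refine mul_le_mul' le_rfl ?_
  rw [← ENNReal.ofReal_coe_nnreal]
  exact ENNReal.ofReal_le_ofReal (by linarith)

end

/-! ### Existence of delay-optimal codes -/

/-- A family of `2 * a + 1` anticommuting skew-Hermitian unitary matrices of size `2 ^ a`. -/
lemma exists_anticommuting (a : ℕ) :
    ∃ W : Fin (2 * a + 1) → Matrix (Fin (2 ^ a)) (Fin (2 ^ a)) ℂ,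
      (∀ i, (W i)ᴴ = -W i) ∧ (∀ i, W i * W i = -1) ∧
      ∀ i j, i ≠ j → W i * W j + W j * W i = 0 := by
  induction a with
  | zero =>
    -- In size `1` the family consists of the imaginary unit alone.
    refine ⟨fun _ => Complex.I • 1, fun i => ?_, fun i => ?_, fun i j hij => ?_⟩
    · rw [Matrix.conjTranspose_smul]; simp
    · rw [Matrix.smul_mul, Matrix.mul_smul, smul_smul]; simp
    · exact absurd (Subsingleton.elim (α := Fin 1) i j) hij
  | succ a ih =>
    obtain ⟨W, hW1, hW2, hW3⟩ := ih
    -- `σ₁` is Hermitian with square `1`, while `σ₂` and `σ₃` are skew-Hermitian with square `-1`,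
    -- and all three anticommute. The new family is `W i ⊗ σ₁`, `1 ⊗ σ₂`, `1 ⊗ σ₃`.
    let σ₁ : Matrix (Fin 2) (Fin 2) ℂ := !![0, 1; 1, 0]
    let σ₂ : Matrix (Fin 2) (Fin 2) ℂ := !![0, 1; -1, 0]
    let σ₃ : Matrix (Fin 2) (Fin 2) ℂ := !![Complex.I, 0; 0, -Complex.I]
    have h1 : σ₁ᴴ = σ₁ := by ext i j; fin_cases i <;> fin_cases j <;> simp [σ₁]
    have h2 : σ₂ᴴ = -σ₂ := by ext i j; fin_cases i <;> fin_cases j <;> simp [σ₂]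
    have h3 : σ₃ᴴ = -σ₃ := by ext i j; fin_cases i <;> fin_cases j <;> simp [σ₃]
    have h11 : σ₁ * σ₁ = 1 := by
      ext i j; fin_cases i <;> fin_cases j <;> simp [σ₁]
    have h22 : σ₂ * σ₂ = -1 := by
      ext i j; fin_cases i <;> fin_cases j <;> simp [σ₂]
    have h33 : σ₃ * σ₃ = -1 := by
      ext i j; fin_cases i <;> fin_cases j <;> simp [σ₃]
    have h12 : σ₁ * σ₂ + σ₂ * σ₁ = 0 := by
      ext i j; fin_cases i <;> fin_cases j <;> simp [σ₁, σ₂]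
    have h13 : σ₁ * σ₃ + σ₃ * σ₁ = 0 := by
      ext i j; fin_cases i <;> fin_cases j <;> simp [σ₁, σ₃]
    have h23 : σ₂ * σ₃ + σ₃ * σ₂ = 0 := by
      ext i j; fin_cases i <;> fin_cases j <;> simp [σ₂, σ₃]
    have h31 := (add_comm _ _).trans h13
    have h32 := (add_comm _ _).trans h23
    let φ : Matrix (Fin (2 ^ a) × Fin 2) (Fin (2 ^ a) × Fin 2) ℂ ≃ₐ[ℂ]
        Matrix (Fin (2 ^ (a + 1))) (Fin (2 ^ (a + 1))) ℂ :=
      Matrix.reindexAlgEquiv ℂ ℂ finProdFinEquiv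
    have hφ : ∀ X, (φ X)ᴴ = φ Xᴴ := fun X => Matrix.conjTranspose_reindex _ _ X
    let Y : Option (Option (Fin (2 * a + 1))) → Matrix (Fin (2 ^ a)) (Fin (2 ^ a)) ℂ ×
        Matrix (Fin 2) (Fin 2) ℂ := fun o =>
      o.elim (1, σ₂) fun o => o.elim (1, σ₃) fun i => (W i, σ₁)
    let Z : Option (Option (Fin (2 * a + 1))) →
        Matrix (Fin (2 ^ (a + 1))) (Fin (2 ^ (a + 1))) ℂ := fun o => φ ((Y o).1 ⊗ₖ (Y o).2)
    have hneg : ∀ (X : Matrix (Fin (2 ^ a)) (Fin (2 ^ a)) ℂ) (σ : Matrix (Fin 2) (Fin 2) ℂ),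
        X ⊗ₖ (-σ) = -(X ⊗ₖ σ) ∧ (-X) ⊗ₖ σ = -(X ⊗ₖ σ) := fun X σ => by
      constructor <;> (ext i j; simp [Matrix.kroneckerMap_apply])
    have hZ1 : ∀ o, (Z o)ᴴ = -Z o := by
      intro o
      simp only [Z, hφ, Matrix.conjTranspose_kronecker, ← map_neg]
      congr 1
      rcases o with _ | _ | i
      · simp only [Y, Option.elim, h2, Matrix.conjTranspose_one, hneg]
      · simp only [Y, Option.elim, h3, Matrix.conjTranspose_one, hneg]
      · simp only [Y, Option.elim, h1, hW1, hneg]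
    have hZ2 : ∀ o, Z o * Z o = -1 := by
      intro o
      simp only [Z, ← map_mul, ← Matrix.mul_kronecker_mul]
      rw [← map_one φ, ← map_neg φ, ← Matrix.one_kronecker_one]
      congr 1
      rcases o with _ | _ | i
      · simp only [Y, Option.elim, h22, mul_one, hneg]
      · simp only [Y, Option.elim, h33, mul_one, hneg]
      · simp only [Y, Option.elim, h11, hW2, hneg]
    have hZ3 : ∀ o o', o ≠ o' → Z o * Z o' + Z o' * Z o = 0 := by
      intro o o' ho
      simp only [Z, ← map_mul, ← Matrix.mul_kronecker_mul, ← map_add]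
      rw [← map_zero φ]
      congr 1
      rcases o with _ | _ | i <;> rcases o' with _ | _ | i'
      · exact absurd rfl ho
      · simp only [Y, Option.elim, mul_one, ← Matrix.kronecker_add, h23, Matrix.kronecker_zero]
      · simp only [Y, Option.elim, mul_one, one_mul, ← Matrix.kronecker_add, add_comm, h12,
          Matrix.kronecker_zero]
      · simp only [Y, Option.elim, mul_one, ← Matrix.kronecker_add, h32,
          Matrix.kronecker_zero]
      · exact absurd rfl ho
      · simp only [Y, Option.elim, mul_one, one_mul, ← Matrix.kronecker_add, h31,
          Matrix.kronecker_zero]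
      · simp only [Y, Option.elim, mul_one, one_mul, ← Matrix.kronecker_add, h12,
          Matrix.kronecker_zero]
      · simp only [Y, Option.elim, mul_one, one_mul, ← Matrix.kronecker_add, h13,
          Matrix.kronecker_zero]
      · simp only [Y, Option.elim, h11, ← Matrix.add_kronecker]
        rw [hW3 i i' (fun h => ho (by rw [h])), Matrix.zero_kronecker]
    have e : Fin (2 * (a + 1) + 1) ≃ Option (Option (Fin (2 * a + 1))) :=
      Fintype.equivOfCardEq (by simp; ring)
    exact ⟨fun i => Z (e i), fun i => hZ1 _, fun i => hZ2 _, fun i j hij =>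
      hZ3 _ _ fun h => hij (e.injective h)⟩

/-- Hurwitz-Radon orthogonal unitary matrices, as many as groups. -/
lemma exists_hurwitzRadon_unitary {g : ℕ} (hg : 2 ≤ g) (hge : Even g) :
    ∃ U : Fin g → Matrix (Fin (blockSize g)) (Fin (blockSize g)) ℂ,
      (∀ k, (U k)ᴴ * U k = 1) ∧ ∀ k k', k ≠ k' → (U k)ᴴ * U k' + (U k')ᴴ * U k = 0 := by
  obtain ⟨W, hW1, hW2, hW3⟩ := exists_anticommuting ((g - 1) / 2)
  obtain ⟨t, ht⟩ := hge
  -- For even `g` the family has `g - 1` members. The identity is the missing one, since it is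
  -- Hurwitz-Radon orthogonal to every skew-Hermitian matrix.
  have e : Fin g ≃ Option (Fin (2 * ((g - 1) / 2) + 1)) := Fintype.equivOfCardEq (by
    simp only [Fintype.card_fin, Fintype.card_option]
    omega)
  refine ⟨fun k => (e k).elim 1 W, fun k => ?_, fun k k' hk => ?_⟩
  · rcases h : e k with _ | i
    · simp only [h, Option.elim, Matrix.conjTranspose_one, mul_one]
    · simp only [h, Option.elim, hW1, Matrix.neg_mul, hW2, neg_neg]
  · have hne : e k ≠ e k' := fun h => hk (e.injective h)
    rcases h : e k with _ | i <;> rcases h' : e k' with _ | i'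
    · exact absurd (h.trans h'.symm) hne
    · simp only [h, h', Option.elim, Matrix.conjTranspose_one, one_mul, mul_one, hW1, add_neg_cancel]
    · simp only [h, h', Option.elim, Matrix.conjTranspose_one, one_mul, mul_one, hW1, neg_add_cancel]
    · have := hW3 i i' fun hii => hne (by rw [h, h', hii])
      simp only [h, h', Option.elim, hW1, Matrix.neg_mul]
      rw [← neg_add, this, neg_zero]

/-- For `v ≠ 0` the matrix is a multiple of the difference of the identity and the reflection in the
hyperplane orthogonal to `v`, both unitary and Hermitian. -/
lemma vecMulVec_mem_span {n : ℕ} (v : Fin n → ℂ) :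
    Matrix.vecMulVec v (star v) ∈ Submodule.span ℝ
      {X : Matrix (Fin n) (Fin n) ℂ | X.IsHermitian ∧ Xᴴ * X = 1} := by
  set P := Matrix.vecMulVec v (star v) with hP
  set t : ℝ := ∑ i, ‖v i‖ ^ 2 with ht
  have hPP : P * P = t • P := by
    rw [hP, Matrix.vecMulVec_mul_vecMulVec, dotProduct]
    ext i j
    simp [Matrix.vecMulVec_apply, ht, Complex.conj_mul']
    ring
  have hPH : Pᴴ = P := by
    ext i j; simp [hP, Matrix.vecMulVec_apply, mul_comm]
  by_cases ht0 : t = 0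
  · have hv : v = 0 := by
      funext i
      have := (Finset.sum_eq_zero_iff_of_nonneg fun _ _ => sq_nonneg _).1 ht0 i (Finset.mem_univ i)
      simpa using this
    rw [hP, hv]; simp
  · have hone : (1 : Matrix (Fin n) (Fin n) ℂ) ∈
        {X : Matrix (Fin n) (Fin n) ℂ | X.IsHermitian ∧ Xᴴ * X = 1} :=
      ⟨Matrix.isHermitian_one, by simp⟩
    have hrefl : 1 - (2 / t) • P ∈
        {X : Matrix (Fin n) (Fin n) ℂ | X.IsHermitian ∧ Xᴴ * X = 1} := by
      have hH : (1 - (2 / t) • P)ᴴ = 1 - (2 / t) • P := by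
        rw [Matrix.conjTranspose_sub, Matrix.conjTranspose_smul, hPH]; simp
      refine ⟨hH, ?_⟩
      simp only [hH, sub_mul, mul_sub, Matrix.smul_mul, Matrix.mul_smul, hPP, smul_smul, one_mul,
        mul_one]
      have : 2 / t * (2 / t * t) = 2 / t + 2 / t := by field_simp; ring
      rw [this, add_smul]
      abel
    have : P = (t / 2) • ((1 : Matrix (Fin n) (Fin n) ℂ) - (1 - (2 / t) • P)) := by
      rw [sub_sub_cancel, smul_smul]
      have : t / 2 * (2 / t) = 1 := by field_simp
      rw [this, one_smul]
    rw [this]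
    exact Submodule.smul_mem _ _ (Submodule.sub_mem _ (Submodule.subset_span hone)
      (Submodule.subset_span hrefl))

/-- Polarization: the cross terms of one rank-one matrix are the unit, and the square terms are
subtracted. The coefficient `1 / 2` is the squared modulus of `(1 - i) / 2`. -/
lemma hermUnit_eq_vecMulVec {n : ℕ} (a b : Fin n) :
    hermUnit (a, b) = Matrix.vecMulVec (Pi.single a 1 + Pi.single b ((1 - Complex.I) / 2))
      (star (Pi.single a 1 + Pi.single b ((1 - Complex.I) / 2))) -
      Matrix.vecMulVec (Pi.single a 1) (star (Pi.single a 1)) -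
      (1 / 2 : ℝ) • Matrix.vecMulVec (Pi.single b 1) (star (Pi.single b 1)) := by
  ext i j
  rw [hermUnit_apply]
  simp only [Matrix.sub_apply, Matrix.smul_apply, Matrix.vecMulVec_apply, Pi.star_apply,
    Pi.add_apply, Pi.single_apply]
  split_ifs <;> first | (exfalso; tauto) | (apply Complex.ext <;> simp <;> norm_num)

/-- There are `n ^ 2` linearly independent unitary Hermitian matrices. -/
lemma exists_linearIndependent_unitary_hermitian (n : ℕ) :
    ∃ V : Fin (n ^ 2) → Matrix (Fin n) (Fin n) ℂ,
      (∀ l, (V l).IsHermitian ∧ (V l)ᴴ * V l = 1) ∧ LinearIndependent ℝ V := by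
  obtain ⟨V, hV, -, hli⟩ := Submodule.exists_fun_fin_finrank_span_eq ℝ
    {X : Matrix (Fin n) (Fin n) ℂ | X.IsHermitian ∧ Xᴴ * X = 1}
  have hle : n ^ 2 ≤ Module.finrank ℝ (Submodule.span ℝ
      {X : Matrix (Fin n) (Fin n) ℂ | X.IsHermitian ∧ Xᴴ * X = 1}) := by
    -- The real dimension of the Hermitian matrices is `n ^ 2`, and all of them lie in the span of
    -- the unitary ones.
    have hinj : Function.Injective (hermOf (n := n)) :=
      Function.LeftInverse.injective hermCoord_hermOf
    have h1 := LinearMap.finrank_range_of_inj hinj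
    have h2 : Module.finrank ℝ (Fin n → Fin n → ℝ) = n ^ 2 := by
      rw [Module.finrank_pi_fintype]
      simp [pow_two]
    rw [← h2, ← h1]
    refine Submodule.finrank_mono ?_
    rintro _ ⟨R, rfl⟩
    rw [sum_smul_hermUnit]
    refine Submodule.sum_mem _ fun e _ => Submodule.smul_mem _ _ ?_
    rw [← Prod.mk.eta (p := e), hermUnit_eq_vecMulVec]
    exact Submodule.sub_mem _ (Submodule.sub_mem _ (vecMulVec_mem_span _) (vecMulVec_mem_span _))
      (Submodule.smul_mem _ _ (vecMulVec_mem_span _))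
  exact ⟨fun l => V (Fin.castLE hle l), fun l => hV _,
    hli.comp _ (Fin.castLE_injective hle)⟩

/-- In a relation, the Hermitian components force the coefficients of the first kind to be `0`,
except `-D` at `l₀`, with `D` the sum of the others. So all coefficients sum to zero, and the
component at `t`, where one sign is flipped, equals `-2` times the coefficient of `t`. -/
lemma linearIndependent_groupCoord {n g : ℕ} (k : Fin g) {V : Fin (n ^ 2) → Matrix (Fin n) (Fin n) ℂ}
    (hV : ∀ l, (V l).IsHermitian) (hli : LinearIndependent ℝ V) (l₀ : Fin (n ^ 2)) :
    LinearIndependent ℝ (Sum.elim (fun l => (hermCoord (V l), fun _ => 1))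
      (fun t => (hermCoord (V l₀), fun j => if j = t then -1 else 1)) :
      Fin (n ^ 2) ⊕ {j : Fin g // j ≠ k} → GroupCoord n k) := by
  have hli' : LinearIndependent ℝ fun l => hermCoord (V l) := by
    refine LinearIndependent.of_comp hermOf ?_
    convert hli using 1
    funext l
    exact hermOf_hermCoord (hV l)
  rw [Fintype.linearIndependent_iff] at hli' ⊢
  intro c hc
  rw [Fintype.sum_sum_type] at hc
  simp only [Sum.elim_inl, Sum.elim_inr] at hc
  have hc1 := congrArg Prod.fst hc
  have hc2 := congrArg Prod.snd hc
  simp only [Prod.fst_add, Prod.fst_sum, Prod.smul_fst, Prod.snd_add, Prod.snd_sum, Prod.smul_snd,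
    Prod.fst_zero, Prod.snd_zero] at hc1 hc2
  set D := ∑ t, c (Sum.inr t) with hD
  have h1 : ∀ l, c (Sum.inl l) + (if l = l₀ then D else 0) = 0 := by
    refine hli' _ ?_
    simp only [add_smul, Finset.sum_add_distrib, ite_smul, zero_smul, Finset.sum_ite_eq',
      Finset.mem_univ, if_true]
    rw [hD, Finset.sum_smul]
    exact hc1
  have hsum : ∑ l, c (Sum.inl l) + D = 0 := by
    have := Finset.sum_congr (rfl : (Finset.univ : Finset (Fin (n ^ 2))) = _) fun l _ => h1 l
    simpa [Finset.sum_add_distrib] using this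
  have h2 : ∀ t, c (Sum.inr t) = 0 := by
    intro t
    have := congrFun hc2 t
    simp only [Pi.add_apply, Finset.sum_apply, Pi.smul_apply, smul_eq_mul, mul_one,
      Pi.zero_apply] at this
    have h3 : ∀ t', c (Sum.inr t') * (if t = t' then (-1 : ℝ) else 1) =
        c (Sum.inr t') - if t = t' then 2 * c (Sum.inr t') else 0 := by
      intro t'
      split_ifs <;> ring
    simp only [h3, Finset.sum_sub_distrib, Finset.sum_ite_eq, Finset.mem_univ, if_true] at this
    linarith
  rintro (l | t)
  · have := h1 l
    have hD0 : D = 0 := Finset.sum_eq_zero fun t _ => h2 t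
    rw [hD0] at this
    simpa using this
  · exact h2 t

/-- The same `U` serves in all blocks and the same `V` in all groups. `groupMatrix_injective`
separates the groups, and `linearIndependent_groupCoord` then works within each group. -/
theorem exists_isDelayOptimalCode {n g : ℕ} (hn : 1 ≤ n) (hg : 2 ≤ g) (hge : Even g) :
    ∃ A : Fin g → Fin (groupSize n g) → Matrix (Antenna n g) (Antenna n g) ℂ,
      IsDelayOptimalCode A := by
  obtain ⟨V, hV, hVli⟩ := exists_linearIndependent_unitary_hermitian n
  obtain ⟨U, hU1, hU2⟩ := exists_hurwitzRadon_unitary hg hge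
  let l₀ : Fin (n ^ 2) := ⟨0, by positivity⟩
  let σ : ∀ k : Fin g, Fin (groupSize n g) ≃ Fin (n ^ 2) ⊕ {j : Fin g // j ≠ k} := fun k =>
    Fintype.equivOfCardEq (by
      rw [Fintype.card_sum, Fintype.card_subtype_compl, Fintype.card_subtype_eq]; simp)
  let idx : Fin g → Fin (groupSize n g) → Fin (n ^ 2) := fun k i =>
    Sum.elim id (fun _ => l₀) (σ k i)
  let ε : Fin g → Fin (groupSize n g) → Fin g → ℤˣ := fun k i =>
    Sum.elim (fun _ _ => 1) (fun t j => if j = t.1 then -1 else 1) (σ k i)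
  have hA : ∀ k i, blockWeight k (V (idx k i)) (fun _ => U k) (ε k i) =
      groupMatrix (fun _ => U k) k
      (Sum.elim (fun l => (hermCoord (V l), fun _ => 1))
        (fun t => (hermCoord (V l₀), fun j => if j = t then -1 else 1)) (σ k i)) := by
    intro k i
    rw [blockWeight_eq k (hV _).1]
    congr 1
    simp only [idx, ε]
    rcases σ k i with l | t
    · simp
    · refine Prod.ext rfl ?_
      funext j
      simp only [Sum.elim_inr, Subtype.ext_iff]
      split_ifs <;> simp
  refine ⟨fun k i => blockWeight k (V (idx k i)) (fun _ => U k) (ε k i), fun _ => U, fun _ => V, idx, ε,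
    fun _ k => hU1 k, fun _ k k' hk => hU2 k k' hk, fun _ => hV, fun _ => hVli,
    fun _ _ => rfl, ?_⟩
  simp only [hA]
  rw [Fintype.linearIndependent_iff]
  intro c hc p
  rw [Fintype.sum_prod_type] at hc
  have h1 := groupMatrix_injective hn (fun _ k => hU1 k) (fun _ k k' hk => hU2 k k' hk)
    (fun k => ∑ i, c (k, i) • (Sum.elim (fun l => (hermCoord (V l), fun _ => 1))
      (fun t => (hermCoord (V l₀), fun j => if j = t then -1 else 1)) (σ k i) : GroupCoord n k))
    (by simpa only [map_sum, map_smul] using hc) p.1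
  have h2 := (linearIndependent_groupCoord p.1 (fun l => (hV l).1) hVli l₀).comp (σ p.1)
    (σ p.1).injective
  rw [Fintype.linearIndependent_iff] at h2
  exact h2 (fun i => c (p.1, i)) h1 p.2

end STBC

end

/-! ### The main theorem -/

theorem mainTheorem8 (n g M : ℕ) (hn : 1 ≤ n) (hg : 2 ≤ g) (hge : Even g) (hM : 1 ≤ M) :
    (∃ A : Fin g → Fin (STBC.groupSize n g) →
        Matrix (STBC.Antenna n g) (STBC.Antenna n g) ℂ, STBC.IsDelayOptimalCode A) ∧
    ∀ A : Fin g → Fin (STBC.groupSize n g) → Matrix (STBC.Antenna n g) (STBC.Antenna n g) ℂ,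
      STBC.IsDelayOptimalCode A →
      (∀ k, ∀ᵐ H ∂(STBC.gaussianMatrix (STBC.Antenna n g) (Fin M)),
        (STBC.equivChannel (A k) (Matrix.of H)).rank = STBC.f n (2 ^ ((g - 1) / 2) * M) + (g - 1)) ∧
      ∀ Θ : Fin g → Matrix (Fin (STBC.groupSize n g)) (Fin (STBC.groupSize n g)) ℝ,
        (∀ k, IsUnit (Θ k).det) → ∀ r : ℝ, 0 < r →
        ∃ c C : ℝ, 0 < c ∧ 0 < C ∧ ∀ q : ℕ, 1 ≤ q → ∀ S : Finset ℤ, S.card = q →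
          ∀ s : Fin g → Fin (STBC.groupSize n g) → ℤ, (∀ k i, s k i ∈ S) →
            ENNReal.ofReal (c * (q : ℝ) ^ ((n - 2 ^ ((g - 1) / 2) * M) ^ 2)) ≤
              STBC.avgComplexity (Fin M) A Θ S r s ∧
            STBC.avgComplexity (Fin M) A Θ S r s ≤
              ENNReal.ofReal (C * (q : ℝ) ^ ((n - 2 ^ ((g - 1) / 2) * M) ^ 2)) := by
  have hp : 0 < STBC.blockSize g * M := Nat.mul_pos (STBC.blockSize_pos g) hM
  refine ⟨STBC.exists_isDelayOptimalCode hn hg hge, fun A hA =>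
    ⟨fun k => hA.ae_rank_equivChannel hn hp k, fun Θ hΘ r hr => ?_⟩⟩
  obtain ⟨C, hC, hle⟩ := hA.exists_avgComplexity_le hn hp hΘ hr
  refine ⟨1, C, one_pos, hC, ?_⟩
  rintro q - S rfl s hs
  rw [one_mul]
  exact ⟨hA.le_avgComplexity hn (by omega) hp hΘ S r s, hle S s hs⟩
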